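/- **Setting.** Let $\mathcal X$ be a nonempty finite set, $k:\mathcal X\times\mathcal X\to\mathbb R$ a positive semidefinite kernel with $k(x,x)\le 1$ for all $x$, and $\sigma>0$. Let $f\sim\mathcal{GP}(0,k)$, and let an evaluation at $x_t\in\mathcal X$ return $y_t=f(x_t)+\varepsilon_t$ with independent $\varepsilon_t\sim\mathcal N(0,\sigma^2)$. For a data set $D=((x_i,y_i))_{i}$ let $p(f\mid D)$ be the posterior of $f$ (Bayes' rule with i.i.d. $\mathcal N(0,\sigma^2)$ noise), and let $$\sigma^2(x;D)=k(x,x)-\mathbf k(x)^\top(\mathbf K+\sigma^2 I)^{-1}\mathbf k(x),\qquad \mathbf k(x)=(k(x,x_i))_i,\quad \mathbf K=(k(x_i,x_j))_{i,j}.$$ Let $\gamma_T=\max_{x_1,\dots,x_T\in\mathcal X} I(\mathbf y_T;\mathbf f_T)$ be the maximum information gain, where $I$ is Shannon mutual information (natural logarithm), $\mathbf f_T=(f(x_i))_{i\le T}$, and $\mathbf y_T=(f(x_i)+\varepsilon_i)_{i\le T}$. Write $f^*=\max_{x\in\mathcal X}f(x)$. **Base algorithm.** A (possibly randomized) sequential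 algorithm $\mathcal A$ maps each data set $D_{t-1}$ of size $t-1$, together with an internal random seed that is independent of $f$ given $D_{t-1}$, to a point $\mathcal A(D_{t-1})\in\mathcal X$. Assume that there are real sequences $(\zeta_t)_{t\ge1}$, $(\xi_t)_{t\ge1}$ such that for every $t\ge1$ there are random variables $u_t(D_{t-1})$ (square integrable) and $v_t(D_{t-1})$ (integrable), which may depend on $f$ and on the seed, with the following property for *every* data set $D_{t-1}$ of size $t-1$. With expectations over $f\sim p(f\mid D_{t-1})$ and the seed, and with $x_t=\mathcal A(D_{t-1})$, $$\mathbb E[f^*-f(x_t)\mid D_{t-1}]\le \mathbb E[u_t\,\sigma(x_t;D_{t-1})+v_t\mid D_{t-1}],\qquad \mathbb E[u_t^2\mid D_{t-1}]\le\zeta_t,\qquad \mathbb E[v_t\mid D_{t-1}]\le\xi_t .$$ Assume moreover that $\sum_{t\le T}\zeta_t=\tilde O(T)$ (that is, $O(T\log^m T)$ for some $m$) and $\sum_{t\le T}\xi_t=O(1)$. **Randomized kriging believer.** Let $N_0\subseteq N_1\subseteq N_2\subseteq\cdots$ be fixed index sets with $N_{t-1}\subseteq\{1,\dots,t-1\}$,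 where $N_{t-1}$ lists the evaluations available when $x_t$ is chosen, and assume that $Q=\max_{t\ge1}\,(t-1-|N_{t-1}|)$ exists (is finite). At iteration $t$ draw a path $g_t\sim p(f\mid (x_i,y_i)_{i\in N_{t-1}})$ and fresh independent noises $\varepsilon^{(t)}_i\sim\mathcal N(0,\sigma^2)$, set $$D^{\rm RKB}_{t-1}=\big((x_i,y_i^{(t)})\big)_{i=1}^{t-1},\qquad y_i^{(t)}=\begin{cases}y_i & i\in N_{t-1},\\ g_t(x_i)+\varepsilon_i^{(t)} & i\notin N_{t-1},\end{cases}$$ and choose $x_t=\mathcal A(D^{\rm RKB}_{t-1})$. **Theorem.** For every $T\in\mathbb N$ the cumulative regret $\sum_{t=1}^T (f^*-f(x_t))$ is integrable, and ${\rm BCR}_T=\mathbb E\big[\sum_{t=1}^T (f^*-f(x_t))\big]$ satisfies $${\rm BCR}_T\le B_T+\sqrt{C_1C_2C_Q\,\gamma_T\,T},\qquad B_T=\sqrt{C_1\gamma_T\textstyle\sum_{t=1}^T\zeta_t}+\sum_{t=1}^T\xi_t,$$ where $C_1=2/\log(1+\sigma^{-2})$, $C_2=2+2\log(|\mathcal X|/2)$,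 and $C_Q=(Q+\sigma^2)/\sigma^2$. -/

import Mathlib

open MeasureTheory ProbabilityTheory
open scoped ENNReal NNReal

namespace KrigingBeliever

/-! Iterations are counted from `0`: what is usually called iteration `t + 1` has index `t`, and
the data set available to a sequential method at that point has exactly `t` entries. -/

/-- Data sets with `n` input-output pairs. -/
abbrev Dataset (X : Type*) (n : ℕ) : Type _ := Fin n → X × ℝ

noncomputable section

section GaussianProcess

/-- The law of a centred Gaussian process with kernel `k` on a finite domain, as a measure on the
space of functions `X → ℝ`. -/
def gpPrior {X : Type*} [Fintype X] [DecidableEq X] (k : X → X → ℝ) : Measure (X → ℝ) :=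
  (multivariateGaussian 0 (Matrix.of k)).map (fun f : EuclideanSpace ℝ X => f.ofLp)

instance {X : Type*} [Fintype X] [DecidableEq X] (k : X → X → ℝ) :
    IsProbabilityMeasure (gpPrior k) := by
  unfold gpPrior
  exact Measure.isProbabilityMeasure_map (by fun_prop)

/-- The density of the outputs in `D` given `f`, when each output is `f` at the input plus
independent centred Gaussian noise with standard deviation `σ`. -/
def likelihood {X ι : Type*} [Fintype ι] (σ : ℝ≥0) (D : ι → X × ℝ) (f : X → ℝ) : ℝ≥0∞ :=
  ∏ i, gaussianPDF (f (D i).1) (σ ^ 2) (D i).2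

theorem measurable_eval {X : Type*} [Fintype X] [MeasurableSpace X]
    [MeasurableSingletonClass X] : Measurable (fun p : (X → ℝ) × X => p.1 p.2) :=
  measurable_from_prod_countable_left (fun x => measurable_pi_apply x)

theorem measurable_likelihood {X ι : Type*} [Fintype X] [MeasurableSpace X]
    [MeasurableSingletonClass X] [Fintype ι] (σ : ℝ≥0) :
    Measurable (Function.uncurry (likelihood σ : (ι → X × ℝ) → (X → ℝ) → ℝ≥0∞)) := by
  unfold likelihood Function.uncurry
  refine Finset.measurable_prod _ fun i _ => ?_
  have h1 : Measurable (fun a : (ι → X × ℝ) × (X → ℝ) => a.2 (a.1 i).1) :=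
    measurable_eval.comp (f := fun a : (ι → X × ℝ) × (X → ℝ) => (a.2, (a.1 i).1)) (by fun_prop)
  exact stronglyMeasurable_uncurry_gaussianPDF.measurable.comp
    (h1.prodMk (measurable_const.prodMk (by fun_prop : Measurable
      (fun a : (ι → X × ℝ) × (X → ℝ) => (a.1 i).2))))

/-- The posterior distribution `p(f ∣ D)` by Bayes' rule: the prior reweighted by the normalised
likelihood. The data set may be indexed by any finite type, so that it also applies to the part of
the data which has been observed. -/
def posterior {X ι : Type*} [Fintype X] [DecidableEq X] [MeasurableSpace X] [Fintype ι]
    (k : X → X → ℝ) (σ : ℝ≥0) : Kernel (ι → X × ℝ) (X → ℝ) :=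
  Kernel.withDensity (Kernel.const _ (gpPrior k))
    (fun D f => likelihood σ D f / ∫⁻ f', likelihood σ D f' ∂(gpPrior k))

theorem measurable_posteriorDensity {X ι : Type*} [Fintype X] [DecidableEq X] [MeasurableSpace X]
    [MeasurableSingletonClass X] [Fintype ι] (k : X → X → ℝ) (σ : ℝ≥0) :
    Measurable (Function.uncurry (fun (D : ι → X × ℝ) (f : X → ℝ) =>
      likelihood σ D f / ∫⁻ f', likelihood σ D f' ∂(gpPrior k))) := by
  have h := measurable_likelihood (X := X) (ι := ι) σ
  exact h.div (h.lintegral_prod_right'.comp measurable_fst)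

theorem evidence_ne_zero {X ι : Type*} [Fintype X] [DecidableEq X] [MeasurableSpace X]
    [MeasurableSingletonClass X] [Fintype ι] (k : X → X → ℝ) (σ : ℝ≥0) (hσ : 0 < σ)
    (D : ι → X × ℝ) : ∫⁻ f, likelihood σ D f ∂(gpPrior k) ≠ 0 := by
  have hmeas : Measurable (likelihood σ D) := (measurable_likelihood σ).of_uncurry_left
  intro h
  obtain ⟨f, hf⟩ := ((lintegral_eq_zero_iff hmeas).1 h).exists
  exact Finset.prod_ne_zero_iff.2
    (fun i _ => (gaussianPDF_pos (f (D i).1) (pow_ne_zero 2 hσ.ne') (D i).2).ne') hf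

theorem likelihood_le {X ι : Type*} [Fintype ι] (σ : ℝ≥0) (D : ι → X × ℝ) (f : X → ℝ) :
    likelihood σ D f ≤ ∏ _i : ι, ENNReal.ofReal (√(2 * Real.pi * (σ ^ 2 : ℝ≥0)))⁻¹ := by
  refine Finset.prod_le_prod' fun i _ => ENNReal.ofReal_le_ofReal ?_
  rw [gaussianPDFReal]
  refine mul_le_of_le_one_right (inv_nonneg.2 (Real.sqrt_nonneg _)) ?_
  rw [Real.exp_le_one_iff, neg_div]
  exact neg_nonpos.2 (div_nonneg (sq_nonneg _) (mul_nonneg zero_le_two (NNReal.coe_nonneg _)))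

theorem evidence_ne_top {X ι : Type*} [Fintype X] [DecidableEq X] [Fintype ι]
    (k : X → X → ℝ) (σ : ℝ≥0) (D : ι → X × ℝ) :
    ∫⁻ f, likelihood σ D f ∂(gpPrior k) ≠ ∞ := by
  refine ne_top_of_le_ne_top ?_ (lintegral_mono (likelihood_le σ D))
  rw [lintegral_const, measure_univ, mul_one]
  exact ENNReal.prod_ne_top fun i _ => ENNReal.ofReal_ne_top

theorem isMarkovKernel_posterior {X ι : Type*} [Fintype X] [DecidableEq X] [MeasurableSpace X]
    [MeasurableSingletonClass X] [Fintype ι] (k : X → X → ℝ) (σ : ℝ≥0) (hσ : 0 < σ) :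
    IsMarkovKernel (posterior k σ : Kernel (ι → X × ℝ) (X → ℝ)) := by
  refine ⟨fun D => ⟨?_⟩⟩
  have hmeas : Measurable (likelihood σ D) := (measurable_likelihood σ).of_uncurry_left
  have h : posterior k σ D Set.univ =
      ∫⁻ f, likelihood σ D f * (∫⁻ f', likelihood σ D f' ∂(gpPrior k))⁻¹ ∂(gpPrior k) := by
    rw [posterior, Kernel.withDensity_apply' _ (measurable_posteriorDensity k σ),
      Measure.restrict_univ, Kernel.const_apply]
    rfl
  rw [h, lintegral_mul_const _ hmeas]
  exact ENNReal.mul_inv_cancel (evidence_ne_zero k σ hσ D) (evidence_ne_top k σ D)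

/-- The posterior variance `σ²(x; D)`, where `D` has the inputs `xs`. -/
def posteriorVar {X ι : Type*} [Fintype ι] [DecidableEq ι] (k : X → X → ℝ) (σ : ℝ≥0)
    (xs : ι → X) (x : X) : ℝ :=
  k x x - (fun i => k x (xs i)) ⬝ᵥ
    ((Matrix.of fun i j => k (xs i) (xs j)) + (σ : ℝ) ^ 2 • (1 : Matrix ι ι ℝ))⁻¹.mulVec
      (fun i => k x (xs i))

/-- The posterior standard deviation `σ(x; D)`. -/
def posteriorStd {X ι : Type*} [Fintype ι] [DecidableEq ι] (k : X → X → ℝ) (σ : ℝ≥0)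
    (D : ι → X × ℝ) (x : X) : ℝ :=
  √(posteriorVar k σ (fun i => (D i).1) x)

end GaussianProcess

section InformationGain

/-- Shannon mutual information (in nats) of the two coordinates of a pair with law `ρ`. -/
def mutualInformation {α β : Type*} [MeasurableSpace α] [MeasurableSpace β]
    (ρ : Measure (α × β)) : ℝ≥0∞ :=
  InformationTheory.klDiv ρ (ρ.fst.prod ρ.snd)

/-- `n` independent noise variables. -/
def noiseVec (σ : ℝ≥0) (n : ℕ) : Measure (Fin n → ℝ) :=
  Measure.pi fun _ => gaussianReal 0 (σ ^ 2)

instance (σ : ℝ≥0) (n : ℕ) : IsProbabilityMeasure (noiseVec σ n) := by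
  unfold noiseVec; infer_instance

/-- The joint law of the noisy outputs and of the function values at the fixed inputs `xs`. -/
def outputValueLaw {X : Type*} [Fintype X] [DecidableEq X] (k : X → X → ℝ) (σ : ℝ≥0) {T : ℕ}
    (xs : Fin T → X) : Measure ((Fin T → ℝ) × (Fin T → ℝ)) :=
  ((gpPrior k).prod (noiseVec σ T)).map
    (fun p => (fun i => p.1 (xs i) + p.2 i, fun i => p.1 (xs i)))

/-- The maximum information gain `γ_T`; the maximum is over the finitely many choices of `T`
inputs. -/
def maxInfoGain {X : Type*} [Fintype X] [DecidableEq X] (k : X → X → ℝ) (σ : ℝ≥0) (T : ℕ) : ℝ :=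
  ⨆ xs : Fin T → X, (mutualInformation (outputValueLaw k σ xs)).toReal

end InformationGain

section Algorithms

/-- A sequential, possibly randomised, Bayesian optimisation algorithm. Given the data set, it
draws an internal random seed and selects the next input from the data set and the seed. -/
structure BOAlgorithm (X S : Type*) [MeasurableSpace X] [MeasurableSpace S] where
  seed : ∀ t : ℕ, Kernel (Dataset X t) S
  isMarkovKernel_seed : ∀ t, IsMarkovKernel (seed t)
  query : ∀ t : ℕ, Dataset X t × S → X
  measurable_query : ∀ t, Measurable (query t)

/-- The conditional law of the next input given the data set. -/
def BOAlgorithm.queryKernel {X S : Type*} [MeasurableSpace X] [MeasurableSpace S]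
    (A : BOAlgorithm X S) (t : ℕ) : Kernel (Dataset X t) X :=
  (Kernel.id ×ₖ A.seed t).map (A.query t)

theorem BOAlgorithm.isMarkovKernel_queryKernel {X S : Type*} [MeasurableSpace X]
    [MeasurableSpace S] (A : BOAlgorithm X S) (t : ℕ) : IsMarkovKernel (A.queryKernel t) := by
  have := A.isMarkovKernel_seed t
  exact Kernel.IsMarkovKernel.map _ (A.measurable_query t)

/-- The part of the data set with indices in `N`. -/
def observedPart {X : Type*} {t : ℕ} (N : Finset ℕ) (D : Dataset X t) :
    {i : Fin t // (i : ℕ) ∈ N} → X × ℝ :=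
  fun i => D i

theorem measurable_observedPart {X : Type*} [MeasurableSpace X] {t : ℕ} (N : Finset ℕ) :
    Measurable (observedPart N : Dataset X t → _) := by
  unfold observedPart; fun_prop

/-- Outputs with indices in `N` are kept; every other output is replaced by the value of `g` at
that input plus the noise `e`. -/
def impute {X : Type*} {t : ℕ} (N : Finset ℕ) (p : Dataset X t × ((X → ℝ) × (Fin t → ℝ))) :
    Dataset X t :=
  fun i => if (i : ℕ) ∈ N then p.1 i else ((p.1 i).1, p.2.1 (p.1 i).1 + p.2.2 i)

theorem measurable_impute {X : Type*} [Fintype X] [MeasurableSpace X]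
    [MeasurableSingletonClass X] {t : ℕ} (N : Finset ℕ) :
    Measurable (impute N : Dataset X t × ((X → ℝ) × (Fin t → ℝ)) → _) := by
  refine measurable_pi_lambda _ fun i => ?_
  unfold impute
  by_cases h : (i : ℕ) ∈ N
  · simp only [h, if_true]; fun_prop
  · simp only [h, if_false]
    have h1 : Measurable (fun p : Dataset X t × ((X → ℝ) × (Fin t → ℝ)) => p.2.1 (p.1 i).1) :=
      measurable_eval.comp
        (f := fun p : Dataset X t × ((X → ℝ) × (Fin t → ℝ)) => (p.2.1, (p.1 i).1)) (by fun_prop)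
    fun_prop

/-- The conditional law of the imputed data set given the data: one path `g` is drawn from the
posterior given the observed part, and the pending outputs are `g` plus fresh noise. The pending
outputs of the argument are not used. -/
def imputedData {X : Type*} [Fintype X] [DecidableEq X] [MeasurableSpace X]
    (k : X → X → ℝ) (σ : ℝ≥0) (N : Finset ℕ) (t : ℕ) : Kernel (Dataset X t) (Dataset X t) :=
  (Kernel.id ×ₖ ((posterior k σ).comap (observedPart N) (measurable_observedPart N) ×ₖ
    Kernel.const _ (noiseVec σ t))).map (impute N)

theorem isMarkovKernel_imputedData {X : Type*} [Fintype X] [DecidableEq X] [MeasurableSpace X]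
    [MeasurableSingletonClass X] (k : X → X → ℝ) (σ : ℝ≥0) (hσ : 0 < σ) (N : Finset ℕ) (t : ℕ) :
    IsMarkovKernel (imputedData (X := X) k σ N t) := by
  have := isMarkovKernel_posterior (ι := {i : Fin t // (i : ℕ) ∈ N}) k σ hσ
  exact Kernel.IsMarkovKernel.map _ (measurable_impute N)

/-- Randomised kriging believer: the base algorithm is applied to the imputed data set. `N t` is
the set of the indices whose outputs are available when the input with index `t` is selected. -/
def rkbQuery {X S : Type*} [Fintype X] [DecidableEq X] [MeasurableSpace X] [MeasurableSpace S]
    (k : X → X → ℝ) (σ : ℝ≥0) (N : ℕ → Finset ℕ) (A : BOAlgorithm X S) (t : ℕ) :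
    Kernel (Dataset X t) X :=
  A.queryKernel t ∘ₖ imputedData k σ (N t) t

theorem isMarkovKernel_rkbQuery {X S : Type*} [Fintype X] [DecidableEq X] [MeasurableSpace X]
    [MeasurableSingletonClass X] [MeasurableSpace S] (k : X → X → ℝ) (σ : ℝ≥0) (hσ : 0 < σ)
    (N : ℕ → Finset ℕ) (A : BOAlgorithm X S) (t : ℕ) :
    IsMarkovKernel (rkbQuery k σ N A t) := by
  have := A.isMarkovKernel_queryKernel t
  have := isMarkovKernel_imputedData (X := X) k σ hσ (N t) t
  unfold rkbQuery; infer_instance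

end Algorithms

section Regret

/-- One round: given `f` and the data so far, select an input by the rule `R` (which sees the data
but not `f`) and evaluate `f` there with fresh noise. -/
def roundKernel {X : Type*} [MeasurableSpace X] (σ : ℝ≥0)
    (t : ℕ) (R : Kernel (Dataset X t) X) : Kernel ((X → ℝ) × Dataset X t) (X × ℝ) :=
  (Kernel.id ×ₖ (R.comap Prod.snd measurable_snd ×ₖ
    Kernel.const _ (gaussianReal 0 (σ ^ 2)))).map (fun p => (p.2.1, p.1.1 p.2.1 + p.2.2))

/-- The joint law of the random function `f` and of the first `t` inputs and outputs (including
outputs that are still pending), when the inputs are selected by the rules `R`. -/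
def runLaw {X : Type*} [Fintype X] [DecidableEq X] [MeasurableSpace X]
    (k : X → X → ℝ) (σ : ℝ≥0) (R : ∀ t, Kernel (Dataset X t) X) :
    ∀ t : ℕ, Measure ((X → ℝ) × Dataset X t)
  | 0 => (gpPrior k).map (fun f => (f, Fin.elim0))
  | t + 1 => (runLaw k σ R t ⊗ₘ roundKernel σ t (R t)).map
      (fun p => (p.1.1, (Fin.snoc p.1.2 p.2 : Dataset X (t + 1))))

theorem isMarkovKernel_roundKernel {X : Type*} [Fintype X] [MeasurableSpace X]
    [MeasurableSingletonClass X] (σ : ℝ≥0) (t : ℕ) (R : Kernel (Dataset X t) X)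
    [IsMarkovKernel R] : IsMarkovKernel (roundKernel σ t R) := by
  refine Kernel.IsMarkovKernel.map _ ?_
  have h1 : Measurable (fun p : ((X → ℝ) × Dataset X t) × (X × ℝ) => p.1.1 p.2.1) :=
    measurable_eval.comp
      (f := fun p : ((X → ℝ) × Dataset X t) × (X × ℝ) => (p.1.1, p.2.1)) (by fun_prop)
  fun_prop

theorem measurable_snocData {X : Type*} [MeasurableSpace X] (t : ℕ) :
    Measurable (fun p : ((X → ℝ) × Dataset X t) × (X × ℝ) =>
      (p.1.1, (Fin.snoc p.1.2 p.2 : Dataset X (t + 1)))) := by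
  refine (by fun_prop : Measurable fun p : ((X → ℝ) × Dataset X t) × (X × ℝ) => p.1.1).prodMk ?_
  refine measurable_pi_lambda _ fun i => ?_
  induction i using Fin.lastCases with
  | last => simpa using measurable_snd
  | cast i =>
    simp only [Fin.snoc_castSucc]
    fun_prop

theorem isProbabilityMeasure_runLaw {X : Type*} [Fintype X] [DecidableEq X] [MeasurableSpace X]
    [MeasurableSingletonClass X] (k : X → X → ℝ) (σ : ℝ≥0) (R : ∀ t, Kernel (Dataset X t) X)
    (hR : ∀ t, IsMarkovKernel (R t)) (t : ℕ) : IsProbabilityMeasure (runLaw k σ R t) := by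
  induction t with
  | zero => exact Measure.isProbabilityMeasure_map (by fun_prop)
  | succ t ih =>
    have := hR t
    have := isMarkovKernel_roundKernel σ t (R t)
    exact Measure.isProbabilityMeasure_map (measurable_snocData t).aemeasurable

/-- The regret accumulated over `T` rounds. -/
def cumulativeRegret {X : Type*} {T : ℕ} (p : (X → ℝ) × Dataset X T) : ℝ :=
  ∑ t : Fin T, ((⨆ x, p.1 x) - p.1 (p.2 t).1)

/-- The Bayesian cumulative regret: the expectation over the random function, the noise, and the
randomness of the selection rules. -/
def bcr {X : Type*} [Fintype X] [DecidableEq X] [MeasurableSpace X]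
    (k : X → X → ℝ) (σ : ℝ≥0) (R : ∀ t, Kernel (Dataset X t) X) (T : ℕ) : ℝ :=
  ∫ p, cumulativeRegret p ∂(runLaw k σ R T)

/-- The joint law of `f` and of the internal seed of the algorithm, given the data set `D`. -/
def conditionalLaw {X S : Type*} [Fintype X] [DecidableEq X] [MeasurableSpace X]
    [MeasurableSpace S] (k : X → X → ℝ) (σ : ℝ≥0) (A : BOAlgorithm X S) {t : ℕ}
    (D : Dataset X t) : Measure ((X → ℝ) × S) :=
  (posterior k σ D).prod (A.seed t D)

/-- The regret condition on a base algorithm, with rate sequences `ζ` and `ξ`. For every data set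
`D` of size `t` the expectations are conditional on `D`; the random variables `u t D` and `v t D`
may depend on `f` and on the internal seed of the algorithm. -/
structure RegretCondition {X S : Type*} [Fintype X] [DecidableEq X] [MeasurableSpace X]
    [MeasurableSpace S] (k : X → X → ℝ) (σ : ℝ≥0) (A : BOAlgorithm X S) (ζ ξ : ℕ → ℝ) :
    Prop where
  exists_bound : ∀ t : ℕ, ∃ u v : Dataset X t → (X → ℝ) × S → ℝ, ∀ D : Dataset X t,
    MemLp (u D) 2 (conditionalLaw k σ A D) ∧
    Integrable (v D) (conditionalLaw k σ A D) ∧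
    ∫ p, ((⨆ x, p.1 x) - p.1 (A.query t (D, p.2))) ∂(conditionalLaw k σ A D) ≤
      ∫ p, (u D p * posteriorStd k σ D (A.query t (D, p.2)) + v D p)
        ∂(conditionalLaw k σ A D) ∧
    ∫ p, (u D p) ^ 2 ∂(conditionalLaw k σ A D) ≤ ζ t ∧
    ∫ p, v D p ∂(conditionalLaw k σ A D) ≤ ξ t
  /-- `∑ ζ = Õ(T)`: linear up to a polylogarithmic factor. -/
  sum_zeta : ∃ m : ℕ, (fun T : ℕ => ∑ t ∈ Finset.range T, ζ t) =O[Filter.atTop]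
    (fun T : ℕ => (T : ℝ) * Real.log T ^ m)
  sum_xi : (fun T : ℕ => ∑ t ∈ Finset.range T, ξ t) =O[Filter.atTop] (fun _ : ℕ => (1 : ℝ))

/-- `C₁ = 2 / log (1 + σ⁻²)`. -/
def constC₁ (σ : ℝ≥0) : ℝ := 2 / Real.log (1 + ((σ : ℝ) ^ 2)⁻¹)

/-- `C₂ = 2 + 2 log (|X| / 2)`. -/
def constC₂ (X : Type*) [Fintype X] : ℝ := 2 + 2 * Real.log ((Fintype.card X : ℝ) / 2)

/-- `C_Q = (Q + σ²) / σ²`. -/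
def constCQ (σ : ℝ≥0) (Q : ℕ) : ℝ := ((Q : ℝ) + (σ : ℝ) ^ 2) / (σ : ℝ) ^ 2

/-- The bound `B_T` for the sequential method. -/
def sequentialBound {X : Type*} [Fintype X] [DecidableEq X] (k : X → X → ℝ) (σ : ℝ≥0)
    (ζ ξ : ℕ → ℝ) (T : ℕ) : ℝ :=
  √(constC₁ σ * maxInfoGain k σ T * ∑ t ∈ Finset.range T, ζ t) + ∑ t ∈ Finset.range T, ξ t

end Regret

end

end KrigingBeliever

/-! Fix a round `t`, and call an output available if its index lies in `N t`. Given all inputs so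
far and the available outputs, the pair (posterior path, imputed data) has the same conditional law
as the pair (true function, actual data). This is `lintegral_runLaw_resample`. It needs `N` to be
monotone: every earlier query was computed from outputs that are available now, so the probability
of having selected these inputs does not change when the pending outputs are resampled.

Compare the actual query `x`, drawn from `rkbQuery`, with the fictitious query `x'` that the base
algorithm would make on the actual data, pending outputs included. Let `μ` be the posterior mean
given the available outputs, and write the regret as `(f* - μ(x)) - (f(x) - μ(x))`. The first
bracket has the same expectation for `x` and `x'`, by resampling. The second bracket has mean zero
for `x`, because `x` sees nothing beyond the inputs and the available outputs. Hence the expected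
regret at `x` is the expected regret at `x'` plus `E[f(x') - μ(x')]`
(`integral_expectedRegret_rkbQuery_le`).

For `x'` the function really has the posterior law given the full data, so the regret condition,
Cauchy-Schwarz and Jensen bound its regret (`integral_expectedRegret_queryKernel_le`). The
correction is at most the expectation of the selected standard deviation times the largest
standardised residual. These residuals are `|X|` standard Gaussians, and the largest squared
positive part has mean at most `C₂`. The standard deviation given the available outputs is replaced
by the one given all inputs at the cost of `C_Q` (`posteriorVar_restrict_le`,
`integral_sum_kernel_mul_residual_le`).

Posterior variances depend on the inputs alone, so by resampling they have the same expectation at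
`x` and `x'`. Their sum along any sequence of inputs is at most `C₁ γ_T`, by the chain rule for
Gaussian entropy (`sumPosteriorVar_le`). Cauchy-Schwarz over the rounds concludes. -/

namespace KrigingBeliever

/-! ### Posterior variance as a regularised least-squares error; loss from dropping outputs. -/

section PosteriorVariance

variable {X ι : Type*} [DecidableEq ι]

/-- The Gram matrix of the noisy outputs at the inputs `xs`. -/
noncomputable def noisyGram (k : X → X → ℝ) (σ : ℝ≥0) (xs : ι → X) : Matrix ι ι ℝ :=
  (Matrix.of fun i j => k (xs i) (xs j)) + (σ : ℝ) ^ 2 • (1 : Matrix ι ι ℝ)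

theorem posDef_noisyGram [Fintype X] [DecidableEq X] {k : X → X → ℝ}
    (hk : (Matrix.of k).PosSemidef) {σ : ℝ≥0} (hσ : 0 < σ) (xs : ι → X) :
    (noisyGram k σ xs).PosDef := by
  have h1 : (Matrix.of fun i j => k (xs i) (xs j)).PosSemidef := hk.submatrix xs
  have h2 : ((σ : ℝ) ^ 2 • (1 : Matrix ι ι ℝ)).PosDef := Matrix.PosDef.one.smul (by positivity)
  exact Matrix.PosDef.posSemidef_add h1 h2

variable [Fintype ι]

/-- The coefficients of the posterior mean at `x` as a linear function of the outputs at `xs`. -/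
noncomputable def krigingWeights (k : X → X → ℝ) (σ : ℝ≥0) (xs : ι → X) (x : X) : ι → ℝ :=
  (noisyGram k σ xs)⁻¹.mulVec fun i => k x (xs i)

theorem posteriorVar_eq_sub_sum (k : X → X → ℝ) (σ : ℝ≥0) (xs : ι → X) (x : X) :
    posteriorVar k σ xs x = k x x - ∑ i, krigingWeights k σ xs x i * k x (xs i) := by
  rw [posteriorVar, dotProduct_comm]
  rfl

-- Factor the kernel matrix as `Bᴴ B` and take the columns of `B`. Statements about posterior
-- variances then become Euclidean geometry of feature vectors.
open scoped MatrixOrder in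
theorem exists_featureMap [Fintype X] [DecidableEq X] {k : X → X → ℝ}
    (hk : (Matrix.of k).PosSemidef) :
    ∃ φ : X → EuclideanSpace ℝ X, ∀ a b, k a b = inner ℝ (φ a) (φ b) := by
  obtain ⟨B, hB⟩ := CStarAlgebra.nonneg_iff_eq_star_mul_self.1 hk.nonneg
  refine ⟨fun a => WithLp.toLp 2 fun i => B i a, fun a b => ?_⟩
  have := congrFun (congrFun hB a) b
  simp only [Matrix.of_apply] at this
  rw [this, Matrix.mul_apply]
  simp [PiLp.inner_apply, mul_comm]

/-- These are the normal equations: row `j` of `(K + σ² I) w = k(x)`, using that the positive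
definite matrix `K + σ² I` is invertible. -/
theorem krigingWeights_normal_eq [Fintype X] [DecidableEq X] {k : X → X → ℝ}
    (hk : (Matrix.of k).PosSemidef) {σ : ℝ≥0} (hσ : 0 < σ) (xs : ι → X) (x : X) (j : ι) :
    ∑ i, krigingWeights k σ xs x i * k (xs i) (xs j) + (σ : ℝ) ^ 2 * krigingWeights k σ xs x j =
      k x (xs j) := by
  have hM := posDef_noisyGram hk hσ xs
  have h : (noisyGram k σ xs).mulVec (krigingWeights k σ xs x) = fun i => k x (xs i) := by
    rw [krigingWeights, Matrix.mulVec_mulVec, Matrix.mul_nonsing_inv _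
      ((Matrix.isUnit_iff_isUnit_det _).1 hM.isUnit), Matrix.one_mulVec]
  rw [← congrFun h j, noisyGram, Matrix.add_mulVec, Matrix.smul_mulVec, Matrix.one_mulVec]
  simp only [Pi.add_apply, Pi.smul_apply, smul_eq_mul, Matrix.mulVec, dotProduct, Matrix.of_apply]
  congr 1
  refine Finset.sum_congr rfl fun i _ => ?_
  have : k (xs i) (xs j) = k (xs j) (xs i) := by simpa using hk.isHermitian.apply (xs j) (xs i)
  rw [this, mul_comm]

variable {H : Type*} [NormedAddCommGroup H] [InnerProductSpace ℝ H]

/-- Mean squared error of the linear predictor of `f x` with coefficients `c`. -/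
theorem sq_error_eq_posteriorVar_add [Fintype X] [DecidableEq X] {k : X → X → ℝ}
    (hk : (Matrix.of k).PosSemidef) {σ : ℝ≥0} (hσ : 0 < σ) {φ : X → H}
    (hφ : ∀ a b, k a b = inner ℝ (φ a) (φ b)) (xs : ι → X) (x : X) (c : ι → ℝ) :
    ‖φ x - ∑ i, c i • φ (xs i)‖ ^ 2 + (σ : ℝ) ^ 2 * ∑ i, c i ^ 2 =
      posteriorVar k σ xs x +
        (‖∑ i, (c i - krigingWeights k σ xs x i) • φ (xs i)‖ ^ 2 +
          (σ : ℝ) ^ 2 * ∑ i, (c i - krigingWeights k σ xs x i) ^ 2) := by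
  set w := krigingWeights k σ xs x with hw
  set r := φ x - ∑ i, w i • φ (xs i) with hr
  set d := ∑ i, (c i - w i) • φ (xs i) with hd
  have hdec : φ x - ∑ i, c i • φ (xs i) = r - d := by
    simp only [hr, hd, sub_smul, Finset.sum_sub_distrib]; abel
  -- The normal equations give the inner products of the optimal residual `r` with the features.
  -- With them, the cross term of `‖r - d‖²` cancels that of `σ² ∑ c²` when `c` is expanded around
  -- `w`.
  have hrj : ∀ j, inner ℝ r (φ (xs j)) = (σ : ℝ) ^ 2 * w j := fun j => by
    have := krigingWeights_normal_eq hk hσ xs x j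
    rw [hr, inner_sub_left, sum_inner, ← hφ, ← this]
    simp only [real_inner_smul_left, ← hφ]
    ring
  have hrd : inner ℝ r d = (σ : ℝ) ^ 2 * ∑ i, (c i - w i) * w i := by
    rw [hd, inner_sum, Finset.mul_sum]
    refine Finset.sum_congr rfl fun i _ => ?_
    rw [real_inner_smul_right, hrj]; ring
  have hrr : ‖r‖ ^ 2 = posteriorVar k σ xs x - (σ : ℝ) ^ 2 * ∑ i, w i ^ 2 := by
    rw [← real_inner_self_eq_norm_sq]
    nth_rewrite 2 [hr]
    rw [inner_sub_right, inner_sum, posteriorVar_eq_sub_sum]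
    simp only [real_inner_smul_right, hrj]
    rw [hr, inner_sub_left, sum_inner]
    simp only [real_inner_smul_left, ← hφ]
    have hs : ∀ i, k (xs i) x = k x (xs i) := fun i => by rw [hφ, hφ, real_inner_comm]
    simp only [hs, Finset.mul_sum]
    congr 1
    exact Finset.sum_congr rfl fun i _ => by ring
  rw [hdec, norm_sub_sq_real, hrd, hrr]
  have : ∑ i, c i ^ 2 = ∑ i, w i ^ 2 + 2 * ∑ i, (c i - w i) * w i + ∑ i, (c i - w i) ^ 2 := by
    rw [Finset.mul_sum, ← Finset.sum_add_distrib, ← Finset.sum_add_distrib]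
    exact Finset.sum_congr rfl fun i _ => by ring
  rw [this]; ring

/-- The posterior variance is the minimal error over all linear predictors, so every choice of `c`
yields an upper bound: `c = 0` gives the prior variance, and truncated weights give
`posteriorVar_restrict_le`. -/
theorem posteriorVar_le_sq_error [Fintype X] [DecidableEq X] {k : X → X → ℝ}
    (hk : (Matrix.of k).PosSemidef) {σ : ℝ≥0} (hσ : 0 < σ) {φ : X → H}
    (hφ : ∀ a b, k a b = inner ℝ (φ a) (φ b)) (xs : ι → X) (x : X) (c : ι → ℝ) :
    posteriorVar k σ xs x ≤
      ‖φ x - ∑ i, c i • φ (xs i)‖ ^ 2 + (σ : ℝ) ^ 2 * ∑ i, c i ^ 2 := by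
  rw [sq_error_eq_posteriorVar_add hk hσ hφ]
  have : 0 ≤ ∑ i, (c i - krigingWeights k σ xs x i) ^ 2 := Finset.sum_nonneg fun i _ => sq_nonneg _
  exact le_add_of_nonneg_right (by positivity)

theorem posteriorVar_eq_sq_error [Fintype X] [DecidableEq X] {k : X → X → ℝ}
    (hk : (Matrix.of k).PosSemidef) {σ : ℝ≥0} (hσ : 0 < σ) {φ : X → H}
    (hφ : ∀ a b, k a b = inner ℝ (φ a) (φ b)) (xs : ι → X) (x : X) :
    posteriorVar k σ xs x =
      ‖φ x - ∑ i, krigingWeights k σ xs x i • φ (xs i)‖ ^ 2 +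
        (σ : ℝ) ^ 2 * ∑ i, krigingWeights k σ xs x i ^ 2 := by
  rw [sq_error_eq_posteriorVar_add hk hσ hφ]
  simp

theorem posteriorVar_nonneg [Fintype X] [DecidableEq X] {k : X → X → ℝ}
    (hk : (Matrix.of k).PosSemidef) {σ : ℝ≥0} (hσ : 0 < σ) (xs : ι → X) (x : X) :
    0 ≤ posteriorVar k σ xs x := by
  obtain ⟨φ, hφ⟩ := exists_featureMap hk
  rw [posteriorVar_eq_sq_error hk hσ hφ]
  have : 0 ≤ ∑ i, krigingWeights k σ xs x i ^ 2 := Finset.sum_nonneg fun i _ => sq_nonneg _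
  positivity

theorem posteriorVar_le_prior [Fintype X] [DecidableEq X] {k : X → X → ℝ}
    (hk : (Matrix.of k).PosSemidef) {σ : ℝ≥0} (hσ : 0 < σ) (xs : ι → X) (x : X) :
    posteriorVar k σ xs x ≤ k x x := by
  obtain ⟨φ, hφ⟩ := exists_featureMap hk
  refine (posteriorVar_le_sq_error hk hσ hφ xs x 0).trans_eq ?_
  simp [hφ]

theorem posteriorStd_sq [Fintype X] [DecidableEq X] {k : X → X → ℝ}
    (hk : (Matrix.of k).PosSemidef) {σ : ℝ≥0} (hσ : 0 < σ) (D : ι → X × ℝ) (x : X) :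
    posteriorStd k σ D x ^ 2 = posteriorVar k σ (fun i => (D i).1) x :=
  Real.sq_sqrt (posteriorVar_nonneg hk hσ _ _)

/-- Discarding all but the outputs with indices in `p` increases the posterior variance at most by
the factor `C_Q`, if at most `Q` outputs are discarded. -/
theorem posteriorVar_restrict_le [Fintype X] [DecidableEq X] {k : X → X → ℝ}
    (hk : (Matrix.of k).PosSemidef) (hk1 : ∀ x, k x x ≤ 1) {σ : ℝ≥0} (hσ : 0 < σ)
    (p : ι → Prop) [DecidablePred p] {Q : ℕ} (hQ : Fintype.card {i // ¬ p i} ≤ Q)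
    (xs : ι → X) (x : X) :
    posteriorVar k σ (fun i : {i // p i} => xs i) x ≤ constCQ σ Q * posteriorVar k σ xs x := by
  obtain ⟨φ, hφ⟩ := exists_featureMap hk
  set w := krigingWeights k σ xs x with hw
  set u := φ x - ∑ i : {i // p i}, w i • φ (xs i) with hu
  set z := ∑ i : {i // ¬ p i}, w i • φ (xs i) with hz
  set a := ∑ i : {i // p i}, w i ^ 2 with ha
  set b := ∑ i : {i // ¬ p i}, w i ^ 2 with hb
  have ha0 : 0 ≤ a := Finset.sum_nonneg fun i _ => sq_nonneg _
  have hb0 : 0 ≤ b := Finset.sum_nonneg fun i _ => sq_nonneg _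
  have hσ' : (0 : ℝ) < (σ : ℝ) ^ 2 := by positivity
  -- The competitor for the reduced data consists of the optimal weights for the full data, with the
  -- discarded ones deleted.
  have h1 := posteriorVar_le_sq_error hk hσ hφ (fun i : {i // p i} => xs i) x (fun i => w i)
  have h2 := posteriorVar_eq_sq_error hk hσ hφ xs x
  rw [← hw, ← Fintype.sum_subtype_add_sum_subtype p (fun i => w i • φ (xs i)),
    ← Fintype.sum_subtype_add_sum_subtype p (fun i => w i ^ 2), ← sub_sub] at h2
  change _ ≤ ‖u‖ ^ 2 + (σ : ℝ) ^ 2 * a at h1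
  change _ = ‖u - z‖ ^ 2 + (σ : ℝ) ^ 2 * (a + b) at h2
  -- Features have norm at most `1`, and Cauchy-Schwarz over at most `Q` discarded indices produces
  -- the factor `Q`.
  have hz2 : ‖z‖ ^ 2 ≤ Q * b := by
    have hn : ‖z‖ ≤ ∑ i : {i // ¬ p i}, |w i| := by
      refine (norm_sum_le _ _).trans (Finset.sum_le_sum fun i _ => ?_)
      rw [norm_smul, Real.norm_eq_abs]
      refine mul_le_of_le_one_right (abs_nonneg _) ?_
      have := hk1 (xs i)
      rw [hφ, real_inner_self_eq_norm_sq] at this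
      exact (sq_le_one_iff₀ (norm_nonneg _)).1 this
    calc ‖z‖ ^ 2 ≤ (∑ i : {i // ¬ p i}, |w i|) ^ 2 := by gcongr
      _ ≤ Fintype.card {i // ¬ p i} * ∑ i : {i // ¬ p i}, |w i| ^ 2 := by
        simpa using sq_sum_le_card_mul_sum_sq (s := Finset.univ)
          (f := fun i : {i // ¬ p i} => |w i|)
      _ ≤ Q * b := by
        simp only [sq_abs]
        exact mul_le_mul_of_nonneg_right (by exact_mod_cast hQ) hb0
  have hC : constCQ σ Q = 1 + Q / (σ : ℝ) ^ 2 := by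
    rw [constCQ]; field_simp; ring
  have hq0 : (0 : ℝ) ≤ Q / (σ : ℝ) ^ 2 := by positivity
  -- Expand `(A + Z)²`. With `Z² ≤ Q b`, weighted AM-GM gives `2 A Z ≤ (Q/σ²) A² + σ² b`, and the
  -- terms add up to exactly `1 + Q/σ²` times the part of the full error without `a`.
  have key : ‖u‖ ^ 2 ≤ (1 + Q / (σ : ℝ) ^ 2) * (‖u - z‖ ^ 2 + (σ : ℝ) ^ 2 * b) := by
    have ht : ‖u‖ ≤ ‖u - z‖ + ‖z‖ := by simpa using norm_add_le (u - z) z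
    have h3 : ‖u‖ ^ 2 ≤ (‖u - z‖ + ‖z‖) ^ 2 := by gcongr
    refine h3.trans ?_
    set A := ‖u - z‖
    set Z := ‖z‖
    have e : (1 + Q / (σ : ℝ) ^ 2) * (A ^ 2 + (σ : ℝ) ^ 2 * b) =
      A ^ 2 + (Q / (σ : ℝ) ^ 2 * A ^ 2 + (σ : ℝ) ^ 2 * b) + Q * b := by field_simp; ring
    rw [e]
    have h4 : 2 * A * Z ≤ Q / (σ : ℝ) ^ 2 * A ^ 2 + (σ : ℝ) ^ 2 * b := by
      refine le_of_sq_le_sq ?_ (by positivity)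
      have : (2 * A * Z) ^ 2 ≤ 4 * A ^ 2 * (Q * b) := by
        have := mul_le_mul_of_nonneg_left hz2 (show 0 ≤ 4 * A ^ 2 by positivity)
        linarith
      refine this.trans ?_
      have h5 : Q / (σ : ℝ) ^ 2 * A ^ 2 * ((σ : ℝ) ^ 2 * b) = A ^ 2 * (Q * b) := by field_simp
      nlinarith [sq_nonneg (Q / (σ : ℝ) ^ 2 * A ^ 2 - (σ : ℝ) ^ 2 * b)]
    nlinarith
  rw [hC, h2]
  refine h1.trans ?_
  have : (σ : ℝ) ^ 2 * a ≤ (1 + Q / (σ : ℝ) ^ 2) * ((σ : ℝ) ^ 2 * a) :=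
    le_mul_of_one_le_left (by positivity) (by linarith)
  nlinarith

end PosteriorVariance

/-! ### Gaussian conditioning at fixed inputs: the residual of the posterior mean. -/

section FixedDesign

/-- Independent noise variables indexed by `ι`. -/
noncomputable def noisePi (σ : ℝ≥0) (ι : Type*) [Fintype ι] : Measure (ι → ℝ) :=
  Measure.pi fun _ => gaussianReal 0 (σ ^ 2)

instance (σ : ℝ≥0) (ι : Type*) [Fintype ι] : IsProbabilityMeasure (noisePi σ ι) := by
  unfold noisePi; infer_instance

theorem iIndepFun_noisePi (σ : ℝ≥0) (ι : Type*) [Fintype ι] :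
    iIndepFun (fun i (e : ι → ℝ) => e i) (noisePi σ ι) :=
  iIndepFun_pi (X := fun _ x => x) fun _ => aemeasurable_id

theorem noisePi_map_eval (σ : ℝ≥0) {ι : Type*} [Fintype ι] (i : ι) :
    (noisePi σ ι).map (fun e => e i) = gaussianReal 0 (σ ^ 2) :=
  (measurePreserving_eval (fun _ : ι => gaussianReal 0 (σ ^ 2)) i).map_eq

instance (σ : ℝ≥0) (ι : Type*) [Fintype ι] : IsGaussian (noisePi σ ι) := by
  have h : HasGaussianLaw (fun (e : ι → ℝ) i => e i) (noisePi σ ι) :=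
    (iIndepFun_noisePi σ ι).hasGaussianLaw fun i =>
      ⟨by rw [noisePi_map_eval]; infer_instance⟩
  have := h.isGaussian_map
  rwa [show (fun (e : ι → ℝ) i => e i) = id from rfl, Measure.map_id] at this

instance {X : Type*} [Fintype X] [DecidableEq X] (k : X → X → ℝ) : IsGaussian (gpPrior k) := by
  have h : gpPrior k = (multivariateGaussian 0 (Matrix.of k)).map
    (EuclideanSpace.equiv X ℝ : EuclideanSpace ℝ X →L[ℝ] (X → ℝ)) := rfl
  rw [h]; infer_instance

variable {X ι : Type*} [Fintype X] [DecidableEq X] [Fintype ι]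

theorem covariance_gpPrior {k : X → X → ℝ} (hk : (Matrix.of k).PosSemidef) (a b : X) :
    cov[fun f => f a, fun f => f b; gpPrior k] = k a b := by
  rw [gpPrior, covariance_map_fun (measurable_pi_apply _).aestronglyMeasurable
    (measurable_pi_apply _).aestronglyMeasurable (by fun_prop)]
  exact covariance_eval_multivariateGaussian hk a b

theorem integral_gpPrior (k : X → X → ℝ) (a : X) : ∫ f, f a ∂(gpPrior k) = 0 := by
  rw [gpPrior, integral_map (f := fun f : X → ℝ => f a) (by fun_prop)
    (measurable_pi_apply _).aestronglyMeasurable]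
  have h : Integrable (fun x => x) (multivariateGaussian 0 (Matrix.of k)) :=
    IsGaussian.integrable_fun_id
  have := (EuclideanSpace.proj a : EuclideanSpace ℝ X →L[ℝ] ℝ).integral_comp_comm h
  simpa using this

theorem covariance_noisePi [DecidableEq ι] (σ : ℝ≥0) (i j : ι) :
    cov[fun e => e i, fun e => e j; noisePi σ ι] = if i = j then (σ : ℝ) ^ 2 else 0 := by
  split_ifs with h
  · subst h
    rw [covariance_self (measurable_pi_apply _).aemeasurable]
    have := variance_map (X := id) (Y := fun e : ι → ℝ => e i) (μ := noisePi σ ι)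
      (by fun_prop) (measurable_pi_apply _).aemeasurable
    rw [noisePi_map_eval, variance_id_gaussianReal] at this
    simpa using this.symm
  · have hG : HasGaussianLaw (fun e : ι → ℝ => e) (noisePi σ ι) := IsGaussian.hasGaussianLaw_id
    exact ((iIndepFun_noisePi σ ι).indepFun h).covariance_eq_zero
      (hG.eval i).memLp_two (hG.eval j).memLp_two

/-- The law of the random function and of the noise. -/
noncomputable def priorNoise (k : X → X → ℝ) (σ : ℝ≥0) (ι : Type*) [Fintype ι] :
    Measure ((X → ℝ) × (ι → ℝ)) :=
  (gpPrior k).prod (noisePi σ ι)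

instance (k : X → X → ℝ) (σ : ℝ≥0) : IsGaussian (priorNoise k σ ι) := by
  unfold priorNoise; infer_instance

/-- The noisy outputs at the inputs `xs`. -/
def noisyOutputs {X ι : Type*} (xs : ι → X) (p : (X → ℝ) × (ι → ℝ)) : ι → ℝ :=
  fun i => p.1 (xs i) + p.2 i

@[fun_prop]
theorem measurable_noisyOutputs {X ι : Type*} (xs : ι → X) : Measurable (noisyOutputs xs) := by
  unfold noisyOutputs; fun_prop

theorem hasGaussianLaw_priorNoise (k : X → X → ℝ) (σ : ℝ≥0) :
    HasGaussianLaw (fun p => p) (priorNoise k σ ι) := IsGaussian.hasGaussianLaw_id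

theorem memLp_value (k : X → X → ℝ) (σ : ℝ≥0) (a : X) :
    MemLp (fun p : (X → ℝ) × (ι → ℝ) => p.1 a) 2 (priorNoise k σ ι) :=
  ((hasGaussianLaw_priorNoise k σ).map_fun
    ((ContinuousLinearMap.proj a).comp (ContinuousLinearMap.fst ℝ (X → ℝ) (ι → ℝ)))).memLp_two

theorem memLp_noise (k : X → X → ℝ) (σ : ℝ≥0) (i : ι) :
    MemLp (fun p : (X → ℝ) × (ι → ℝ) => p.2 i) 2 (priorNoise k σ ι) :=
  ((hasGaussianLaw_priorNoise k σ).map_fun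
    ((ContinuousLinearMap.proj i).comp (ContinuousLinearMap.snd ℝ (X → ℝ) (ι → ℝ)))).memLp_two

theorem covariance_value_value {k : X → X → ℝ} (hk : (Matrix.of k).PosSemidef) (σ : ℝ≥0)
    (a b : X) : cov[fun p => p.1 a, fun p => p.1 b; priorNoise k σ ι] = k a b := by
  rw [← covariance_gpPrior hk a b]
  have : (priorNoise k σ ι).map Prod.fst = gpPrior k := by simp [priorNoise]
  rw [← this, covariance_map_fun (measurable_pi_apply _).aestronglyMeasurable
    (measurable_pi_apply _).aestronglyMeasurable (by fun_prop)]

theorem covariance_noise_noise [DecidableEq ι] (k : X → X → ℝ) (σ : ℝ≥0) (i j : ι) :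
    cov[fun p => p.2 i, fun p => p.2 j; priorNoise k σ ι] = if i = j then (σ : ℝ) ^ 2 else 0 := by
  rw [← covariance_noisePi σ i j]
  have : (priorNoise k σ ι).map Prod.snd = noisePi σ ι := by simp [priorNoise]
  rw [← this, covariance_map_fun (measurable_pi_apply _).aestronglyMeasurable
    (measurable_pi_apply _).aestronglyMeasurable (by fun_prop)]

theorem covariance_value_noise (k : X → X → ℝ) (σ : ℝ≥0) (a : X) (i : ι) :
    cov[fun p => p.1 a, fun p => p.2 i; priorNoise k σ ι] = 0 := by
  have hG : HasGaussianLaw (fun e : ι → ℝ => e) (noisePi σ ι) := IsGaussian.hasGaussianLaw_id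
  have hF : HasGaussianLaw (fun f : X → ℝ => f) (gpPrior k) := IsGaussian.hasGaussianLaw_id
  exact covariance_fst_snd_prod (hF.eval a).memLp_two (hG.eval i).memLp_two

theorem memLp_noisyOutputs (k : X → X → ℝ) (σ : ℝ≥0) (xs : ι → X) (i : ι) :
    MemLp (fun p => noisyOutputs xs p i) 2 (priorNoise k σ ι) :=
  (memLp_value k σ (xs i)).add (memLp_noise k σ i)

theorem covariance_value_output {k : X → X → ℝ} (hk : (Matrix.of k).PosSemidef) (σ : ℝ≥0)
    (xs : ι → X) (a : X) (i : ι) :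
    cov[fun p => p.1 a, fun p => noisyOutputs xs p i; priorNoise k σ ι] = k a (xs i) := by
  have := covariance_add_right (memLp_value (ι := ι) k σ a) (memLp_value k σ (xs i))
    (memLp_noise k σ i)
  refine this.trans ?_
  rw [covariance_value_value hk, covariance_value_noise, add_zero]

theorem covariance_output_output [DecidableEq ι] {k : X → X → ℝ} (hk : (Matrix.of k).PosSemidef)
    (σ : ℝ≥0) (xs : ι → X) (i j : ι) :
    cov[fun p => noisyOutputs xs p i, fun p => noisyOutputs xs p j; priorNoise k σ ι] =
      k (xs i) (xs j) + if i = j then (σ : ℝ) ^ 2 else 0 := by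
  have := covariance_add_left (memLp_value k σ (xs i)) (memLp_noise k σ i)
    (memLp_noisyOutputs k σ xs j)
  refine this.trans ?_
  rw [covariance_value_output hk]
  have := covariance_add_right (memLp_noise k σ i) (memLp_value k σ (xs j)) (memLp_noise k σ j)
  rw [show (fun p => noisyOutputs xs p j) = (fun p : (X → ℝ) × (ι → ℝ) => p.1 (xs j)) +
    fun p => p.2 j from rfl, this, covariance_noise_noise, covariance_comm,
    covariance_value_noise, zero_add]

variable [DecidableEq ι]

/-- The posterior mean at `x` given the outputs `y` at the inputs `xs`. -/
noncomputable def posteriorMean (k : X → X → ℝ) (σ : ℝ≥0) (xs : ι → X) (x : X) (y : ι → ℝ) : ℝ :=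
  ∑ i, krigingWeights k σ xs x i * y i

@[fun_prop]
theorem measurable_posteriorMean {X : Type*} (k : X → X → ℝ) (σ : ℝ≥0) (xs : ι → X) (x : X) :
    Measurable (posteriorMean k σ xs x) := by
  unfold posteriorMean; fun_prop

/-- The error of the posterior mean as a predictor of `f x`. -/
noncomputable def residual (k : X → X → ℝ) (σ : ℝ≥0) (xs : ι → X) (x : X)
    (p : (X → ℝ) × (ι → ℝ)) : ℝ :=
  p.1 x - posteriorMean k σ xs x (noisyOutputs xs p)

@[fun_prop]
theorem measurable_residual {X : Type*} (k : X → X → ℝ) (σ : ℝ≥0) (xs : ι → X) (x : X) :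
    Measurable (residual k σ xs x) := by
  unfold residual; fun_prop

theorem memLp_posteriorMean (k : X → X → ℝ) (σ : ℝ≥0) (xs : ι → X) (x : X) :
    MemLp (fun p => posteriorMean k σ xs x (noisyOutputs xs p)) 2 (priorNoise k σ ι) :=
  memLp_finsetSum _ fun i _ => (memLp_noisyOutputs k σ xs i).const_mul _

theorem memLp_residual (k : X → X → ℝ) (σ : ℝ≥0) (xs : ι → X) (x : X) :
    MemLp (residual k σ xs x) 2 (priorNoise k σ ι) :=
  (memLp_value k σ x).sub (memLp_posteriorMean k σ xs x)

/-- By bilinearity the covariance is `k(x, xⱼ) - ∑ wᵢ (k(xᵢ, xⱼ) + σ² δᵢⱼ)`, which vanishes by the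
normal equations. -/
theorem covariance_residual_output {k : X → X → ℝ} (hk : (Matrix.of k).PosSemidef) {σ : ℝ≥0}
    (hσ : 0 < σ) (xs : ι → X) (x : X) (j : ι) :
    cov[residual k σ xs x, fun p => noisyOutputs xs p j; priorNoise k σ ι] = 0 := by
  have h1 := covariance_sub_left (memLp_value (ι := ι) k σ x) (memLp_posteriorMean k σ xs x)
    (memLp_noisyOutputs k σ xs j)
  refine h1.trans ?_
  have h2 := covariance_fun_sum_left (X := fun i p => krigingWeights k σ xs x i *
    noisyOutputs xs p i) (fun i => (memLp_noisyOutputs k σ xs i).const_mul _)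
    (memLp_noisyOutputs k σ xs j)
  rw [covariance_value_output hk]
  unfold posteriorMean
  rw [h2]
  simp only [covariance_const_mul_left, covariance_output_output hk, mul_add, mul_ite, mul_zero,
    Finset.sum_add_distrib, Finset.sum_ite_eq', Finset.mem_univ, if_true]
  rw [← krigingWeights_normal_eq hk hσ xs x j]
  ring

/-- The residual is uncorrelated with the outputs, hence with the posterior mean. Its variance is
therefore its covariance with `f x`, namely `k(x, x) - ∑ wᵢ k(x, xᵢ)`. -/
theorem variance_residual {k : X → X → ℝ} (hk : (Matrix.of k).PosSemidef) {σ : ℝ≥0}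
    (hσ : 0 < σ) (xs : ι → X) (x : X) :
    Var[residual k σ xs x; priorNoise k σ ι] = posteriorVar k σ xs x := by
  rw [← covariance_self (by fun_prop)]
  have h1 := covariance_sub_right (memLp_residual k σ xs x) (memLp_value (ι := ι) k σ x)
    (memLp_posteriorMean k σ xs x)
  refine h1.trans ?_
  have h2 := covariance_fun_sum_right (X := fun i p => krigingWeights k σ xs x i *
    noisyOutputs xs p i) (fun i => (memLp_noisyOutputs k σ xs i).const_mul _)
    (memLp_residual k σ xs x)
  have h3 := covariance_sub_left (memLp_value (ι := ι) k σ x) (memLp_posteriorMean k σ xs x)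
    (memLp_value k σ x)
  have h4 := covariance_fun_sum_left (X := fun i p => krigingWeights k σ xs x i *
    noisyOutputs xs p i) (fun i => (memLp_noisyOutputs k σ xs i).const_mul _)
    (memLp_value k σ x)
  have h5 : cov[residual k σ xs x, fun p => posteriorMean k σ xs x (noisyOutputs xs p);
      priorNoise k σ ι] = 0 := by
    refine h2.trans ?_
    simp [covariance_const_mul_right, covariance_residual_output hk hσ]
  rw [h5, sub_zero]
  refine h3.trans ?_
  rw [covariance_value_value hk, posteriorVar_eq_sub_sum]
  congr 1
  refine h4.trans (Finset.sum_congr rfl fun i _ => ?_)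
  rw [covariance_const_mul_left, covariance_comm, covariance_value_output hk]

theorem integral_residual (k : X → X → ℝ) (σ : ℝ≥0) (xs : ι → X) (x : X) :
    ∫ p, residual k σ xs x p ∂(priorNoise k σ ι) = 0 := by
  have hv : ∀ a, ∫ p, p.1 a ∂(priorNoise k σ ι) = 0 := fun a => by
    rw [← integral_gpPrior k a]
    have : (priorNoise k σ ι).map Prod.fst = gpPrior k := by simp [priorNoise]
    rw [← this, integral_map (f := fun f : X → ℝ => f a) (by fun_prop)
      (measurable_pi_apply _).aestronglyMeasurable]
  have he : ∀ i, ∫ p, p.2 i ∂(priorNoise k σ ι) = 0 := fun i => by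
    have : (priorNoise k σ ι).map Prod.snd = noisePi σ ι := by simp [priorNoise]
    rw [← integral_map (φ := Prod.snd) (f := fun e : ι → ℝ => e i) (by fun_prop)
        (measurable_pi_apply _).aestronglyMeasurable,
      this, ← integral_map (φ := fun e : ι → ℝ => e i) (f := fun z : ℝ => z)
      (measurable_pi_apply _).aemeasurable (by fun_prop), noisePi_map_eval,
        integral_id_gaussianReal]
  have ho : ∀ i, ∫ p, noisyOutputs xs p i ∂(priorNoise k σ ι) = 0 := fun i => by
    refine (integral_add ((memLp_value k σ (xs i)).integrable one_le_two)
      ((memLp_noise k σ i).integrable one_le_two)).trans ?_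
    rw [hv, he, add_zero]
  refine (integral_sub ((memLp_value k σ x).integrable one_le_two)
    ((memLp_posteriorMean k σ xs x).integrable one_le_two)).trans ?_
  unfold posteriorMean
  rw [hv, integral_finsetSum _ fun i _ =>
    ((memLp_noisyOutputs k σ xs i).integrable one_le_two).const_mul _]
  simp [integral_const_mul, ho]

/-- Residual and outputs are jointly a linear image of a Gaussian vector. The residual is presented
as a family over `Unit` to fit the independence criterion for two jointly Gaussian families. -/
theorem hasGaussianLaw_residual_outputs (k : X → X → ℝ) (σ : ℝ≥0) (xs : ι → X) (x : X) :
    HasGaussianLaw (fun p => (fun _ : Unit => residual k σ xs x p, noisyOutputs xs p))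
      (priorNoise k σ ι) := by
  let Y : (X → ℝ) × (ι → ℝ) →ₗ[ℝ] (ι → ℝ) :=
    { toFun := noisyOutputs xs
      map_add' := fun p q => by ext i; simp [noisyOutputs]; ring
      map_smul' := fun c p => by ext i; simp [noisyOutputs]; ring }
  let L : (X → ℝ) × (ι → ℝ) →ₗ[ℝ] (Unit → ℝ) × (ι → ℝ) :=
    { toFun := fun p => (fun _ : Unit => residual k σ xs x p, Y p)
      map_add' := fun p q => by
        refine Prod.ext ?_ (map_add Y p q)
        ext
        have := map_add Y p q
        change noisyOutputs xs (p + q) = noisyOutputs xs p + noisyOutputs xs q at this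
        simp [residual, posteriorMean, this, mul_add, Finset.sum_add_distrib]
        ring
      map_smul' := fun c p => by
        refine Prod.ext ?_ (map_smul Y c p)
        ext
        have := map_smul Y c p
        change noisyOutputs xs (c • p) = c • noisyOutputs xs p at this
        simp [residual, posteriorMean, this, mul_sub, Finset.mul_sum]
        exact Finset.sum_congr rfl fun i _ => by ring }
  exact (hasGaussianLaw_priorNoise k σ).map_fun L.toContinuousLinearMap

/-- Jointly Gaussian and uncorrelated implies independent. Together with `map_residual` this
identifies the conditional law of `f x` given the outputs. -/
theorem indepFun_residual_outputs {k : X → X → ℝ} (hk : (Matrix.of k).PosSemidef) {σ : ℝ≥0}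
    (hσ : 0 < σ) (xs : ι → X) (x : X) :
    IndepFun (residual k σ xs x) (noisyOutputs xs) (priorNoise k σ ι) :=
  ((hasGaussianLaw_residual_outputs k σ xs x).indepFun_of_covariance_eval
    (X := fun (_ : Unit) p => residual k σ xs x p) (Y := fun i p => noisyOutputs xs p i)
    fun _ j => covariance_residual_output hk hσ xs x j).comp
    (φ := fun z : Unit → ℝ => z ()) (ψ := id) (by fun_prop) measurable_id

theorem map_residual {k : X → X → ℝ} (hk : (Matrix.of k).PosSemidef) {σ : ℝ≥0}
    (hσ : 0 < σ) (xs : ι → X) (x : X) :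
    (priorNoise k σ ι).map (residual k σ xs x) =
      gaussianReal 0 (posteriorVar k σ xs x).toNNReal := by
  have h := ((hasGaussianLaw_residual_outputs k σ xs x).fst.eval ()).map_eq_gaussianReal
  rwa [integral_residual, variance_residual hk hσ] at h

end FixedDesign

/-! ### Product Gaussian noise: densities, recombination and restriction of coordinates. -/

section NoiseTransformations

theorem pi_gaussianReal_eq_withDensity {ι : Type*} [Fintype ι] (m : ι → ℝ) {v : ℝ≥0} (hv : v ≠ 0) :
    Measure.pi (fun i => gaussianReal (m i) v) =
      (volume : Measure (ι → ℝ)).withDensity fun y => ∏ i, gaussianPDF (m i) v (y i) := by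
  classical
  refine Measure.pi_eq fun s hs => ?_
  rw [withDensity_apply _ (MeasurableSet.univ_pi hs),
    ← lintegral_indicator (MeasurableSet.univ_pi hs)]
  -- On a box the integrand is a product of one-variable functions. It is written as
  -- `ENNReal.ofReal` of a real product so that the product formula for Bochner integrals applies.
  have h1 : ∀ y : ι → ℝ, (Set.univ.pi s).indicator (fun y => ∏ i, gaussianPDF (m i) v (y i)) y =
      ENNReal.ofReal (∏ i, (s i).indicator (gaussianPDFReal (m i) v) (y i)) := fun y => by
    rw [ENNReal.ofReal_prod_of_nonneg fun i _ =>
      Set.indicator_nonneg (fun z _ => gaussianPDFReal_nonneg _ _ z) _]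
    by_cases hy : y ∈ Set.univ.pi s
    · rw [Set.indicator_of_mem hy]
      refine Finset.prod_congr rfl fun i _ => ?_
      rw [Set.indicator_of_mem (hy i trivial)]
      rfl
    · rw [Set.indicator_of_notMem hy]
      simp only [Set.mem_pi, Set.mem_univ, true_implies, not_forall] at hy
      obtain ⟨i, hi⟩ := hy
      refine (Finset.prod_eq_zero (Finset.mem_univ i) ?_).symm
      rw [Set.indicator_of_notMem hi, ENNReal.ofReal_zero]
  have hint : ∀ i, Integrable ((s i).indicator (gaussianPDFReal (m i) v)) := fun i =>
    (integrable_gaussianPDFReal _ _).indicator (hs i)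
  have hnn : ∀ i z, 0 ≤ (s i).indicator (gaussianPDFReal (m i) v) z := fun i z =>
    Set.indicator_nonneg (fun z _ => gaussianPDFReal_nonneg _ _ z) _
  simp_rw [h1]
  rw [← ofReal_integral_eq_lintegral_ofReal (μ := volume)
    (Integrable.fintype_prod (μ := fun _ => volume) hint)
      (Filter.Eventually.of_forall fun y => Finset.prod_nonneg fun i _ => hnn i _),
    integral_fintype_prod_volume_eq_prod,
    ENNReal.ofReal_prod_of_nonneg fun i _ => integral_nonneg (hnn i)]
  refine Finset.prod_congr rfl fun i _ => ?_
  rw [integral_indicator (hs i), ← gaussianReal_apply_eq_integral _ hv]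

theorem map_add_noisePi {ι : Type*} [Fintype ι] {σ : ℝ≥0} (hσ : 0 < σ) (m : ι → ℝ) :
    (noisePi σ ι).map (fun e i => m i + e i) =
      (volume : Measure (ι → ℝ)).withDensity fun y => ∏ i, gaussianPDF (m i) (σ ^ 2) (y i) := by
  rw [← pi_gaussianReal_eq_withDensity m (pow_ne_zero 2 hσ.ne'), noisePi,
    Measure.pi_map_pi (f := fun i z => m i + z) fun i => by fun_prop]
  simp [gaussianReal_map_const_add]

/-- Keeping the noise on some coordinates and redrawing it on the others leaves the noise law
unchanged. This is why imputed outputs are distributed like real ones. -/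
theorem map_piecewise_noisePi {ι : Type*} [Fintype ι] (σ : ℝ≥0) (p : ι → Prop) [DecidablePred p] :
    ((noisePi σ ι).prod (noisePi σ ι)).map (fun e i => if p i then e.1 i else e.2 i) =
      noisePi σ ι := by
  symm
  refine Measure.pi_eq fun s hs => ?_
  have hm : Measurable fun (e : (ι → ℝ) × (ι → ℝ)) i => if p i then e.1 i else e.2 i := by
    refine measurable_pi_lambda _ fun i => ?_
    by_cases h : p i <;> simp only [h, if_true, if_false] <;> fun_prop
  rw [Measure.map_apply hm (MeasurableSet.univ_pi hs)]
  have : (fun (e : (ι → ℝ) × (ι → ℝ)) i => if p i then e.1 i else e.2 i) ⁻¹' (Set.univ.pi s) =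
      (Set.univ.pi fun i => if p i then s i else Set.univ) ×ˢ
        (Set.univ.pi fun i => if p i then Set.univ else s i) := by
    ext e
    simp only [Set.mem_preimage, Set.mem_pi, Set.mem_univ, true_implies, Set.mem_prod]
    rw [← forall_and]
    refine forall_congr' fun i => ?_
    by_cases h : p i <;> simp [h]
  rw [this, Measure.prod_prod, noisePi, Measure.pi_pi, Measure.pi_pi, ← Finset.prod_mul_distrib]
  refine Finset.prod_congr rfl fun i _ => ?_
  by_cases h : p i <;> simp [h]

theorem map_restrict_noisePi {ι : Type*} [Fintype ι] (σ : ℝ≥0) (p : ι → Prop) [DecidablePred p] :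
    (noisePi σ ι).map (fun e (i : {i // p i}) => e i) = noisePi σ {i // p i} := by
  have h := (measurePreserving_piEquivPiSubtypeProd (fun _ : ι => gaussianReal 0 (σ ^ 2)) p).map_eq
  have h2 := congrArg (Measure.map Prod.fst) h
  rw [Measure.map_map measurable_fst (MeasurableEquiv.measurable _), Measure.map_fst_prod,
    measure_univ, one_smul] at h2
  exact h2

theorem map_snoc_prod_pi {α : Type*} [MeasurableSpace α] (μ : Measure α) [SigmaFinite μ] (n : ℕ) :
    ((Measure.pi fun _ : Fin n => μ).prod μ).map
      (fun p => (Fin.snoc p.1 p.2 : Fin (n + 1) → α)) = Measure.pi fun _ => μ := by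
  symm
  refine Measure.pi_eq fun s hs => ?_
  have hm : Measurable fun p : (Fin n → α) × α => (Fin.snoc p.1 p.2 : Fin (n + 1) → α) := by
    refine measurable_pi_lambda _ fun i => ?_
    induction i using Fin.lastCases with
    | last => simpa using measurable_snd
    | cast i => simp only [Fin.snoc_castSucc]; fun_prop
  rw [Measure.map_apply hm (MeasurableSet.univ_pi hs)]
  have : (fun p : (Fin n → α) × α => (Fin.snoc p.1 p.2 : Fin (n + 1) → α)) ⁻¹' (Set.univ.pi s) =
      (Set.univ.pi fun i => s (Fin.castSucc i)) ×ˢ s (Fin.last n) := by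
    ext p
    simp only [Set.mem_preimage, Set.mem_pi, Set.mem_univ, true_implies, Set.mem_prod]
    rw [Fin.forall_fin_succ']
    simp
  rw [this, Measure.prod_prod, Measure.pi_pi, Fin.prod_univ_castSucc]

end NoiseTransformations

/-! ### Bayes' rule at fixed inputs, and resampling of function and pending outputs. -/

section Bayes

variable {X ι : Type*} [Fintype X] [DecidableEq X] [Fintype ι]

/-- The data set with inputs `xs` and outputs `y`. -/
def zipData {X ι : Type*} (xs : ι → X) (y : ι → ℝ) : ι → X × ℝ := fun i => (xs i, y i)

@[fun_prop]
theorem measurable_zipData {X ι : Type*} [MeasurableSpace X] (xs : ι → X) :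
    Measurable (zipData xs) := by
  unfold zipData; fun_prop

variable [MeasurableSpace X] [MeasurableSingletonClass X]

theorem measurable_likelihood_zipData {X ι : Type*} [Fintype X] [Fintype ι] [MeasurableSpace X]
    [MeasurableSingletonClass X] (σ : ℝ≥0) (xs : ι → X) :
    Measurable fun q : (X → ℝ) × (ι → ℝ) => likelihood σ (zipData xs q.2) q.1 := by
  have h : Measurable fun q : (X → ℝ) × (ι → ℝ) => (zipData xs q.2, q.1) :=
    ((measurable_zipData xs).comp measurable_snd).prodMk measurable_fst
  have := (measurable_likelihood (X := X) (ι := ι) σ).comp h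
  exact this

theorem measurable_likelihood_right {X ι : Type*} [Fintype X] [Fintype ι] [MeasurableSpace X]
    [MeasurableSingletonClass X] (σ : ℝ≥0) (D : ι → X × ℝ) : Measurable (likelihood σ D) :=
  (measurable_likelihood σ).of_uncurry_left

/-- Given `f`, the outputs have the likelihood as Lebesgue density. Tonelli then puts the integral
over `f` inside, which is the form needed for Bayes' rule. -/
theorem lintegral_priorNoise (k : X → X → ℝ) {σ : ℝ≥0} (hσ : 0 < σ) (xs : ι → X)
    {φ : (X → ℝ) × (ι → ℝ) → ℝ≥0∞} (hφ : Measurable φ) :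
    ∫⁻ p, φ (p.1, noisyOutputs xs p) ∂(priorNoise k σ ι) =
      ∫⁻ y, ∫⁻ f, likelihood σ (zipData xs y) f * φ (f, y) ∂(gpPrior k) := by
  have hL := measurable_likelihood_zipData (ι := ι) σ xs
  have hsw : Measurable (Function.uncurry fun (y : ι → ℝ) (f : X → ℝ) =>
      likelihood σ (zipData xs y) f * φ (f, y)) := by
    have := (hL.mul hφ).comp (measurable_swap (α := ι → ℝ) (β := X → ℝ))
    exact this
  rw [priorNoise, lintegral_prod _ (by fun_prop), lintegral_lintegral_swap hsw.aemeasurable]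
  refine lintegral_congr fun f => ?_
  have h1 : ∫⁻ e, φ (f, noisyOutputs xs (f, e)) ∂(noisePi σ ι) =
      ∫⁻ y, φ (f, y) ∂((noisePi σ ι).map fun e i => f (xs i) + e i) := by
    rw [lintegral_map (by fun_prop) (by fun_prop)]
    rfl
  have hf : Measurable fun y : ι → ℝ => (f, y) := measurable_const.prodMk measurable_id
  have h2 := hL.comp hf
  have h3 : (fun y : ι → ℝ => ∏ i, gaussianPDF (f (xs i)) (σ ^ 2) (y i)) =
      fun y => likelihood σ (zipData xs y) f := rfl
  have h4 : Measurable fun y : ι → ℝ => φ (f, y) := hφ.comp hf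
  rw [h1, map_add_noisePi hσ, h3]
  exact lintegral_withDensity_eq_lintegral_mul _ h2 h4

theorem lintegral_posterior (k : X → X → ℝ) (σ : ℝ≥0) (D : ι → X × ℝ)
    {ψ : (X → ℝ) → ℝ≥0∞} (hψ : Measurable ψ) :
    ∫⁻ g, ψ g ∂(posterior k σ D) =
      (∫⁻ f, likelihood σ D f ∂(gpPrior k))⁻¹ * ∫⁻ f, likelihood σ D f * ψ f ∂(gpPrior k) := by
  have hL := measurable_likelihood_right (X := X) σ D
  rw [posterior, Kernel.lintegral_withDensity _ (measurable_posteriorDensity k σ) _ hψ,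
    Kernel.const_apply]
  refine Eq.trans ?_ (lintegral_const_mul _ (hL.mul hψ))
  refine lintegral_congr fun f => ?_
  rw [ENNReal.div_eq_inv_mul, mul_assoc]

/-- The normalising constant is neither `0` nor `∞`, so it cancels. -/
theorem evidence_mul_lintegral_posterior (k : X → X → ℝ) {σ : ℝ≥0} (hσ : 0 < σ) (D : ι → X × ℝ)
    {ψ : (X → ℝ) → ℝ≥0∞} (hψ : Measurable ψ) :
    (∫⁻ f, likelihood σ D f ∂(gpPrior k)) * ∫⁻ g, ψ g ∂(posterior k σ D) =
      ∫⁻ f, likelihood σ D f * ψ f ∂(gpPrior k) := by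
  rw [lintegral_posterior k σ _ hψ, ← mul_assoc,
    ENNReal.mul_inv_cancel (evidence_ne_zero k σ hσ _) (evidence_ne_top k σ _), one_mul]

theorem measurable_lintegral_posterior (k : X → X → ℝ) {σ : ℝ≥0} (hσ : 0 < σ) (xs : ι → X)
    {φ : (X → ℝ) × (ι → ℝ) → ℝ≥0∞} (hφ : Measurable φ) :
    Measurable fun y : ι → ℝ => ∫⁻ g, φ (g, y) ∂(posterior k σ (zipData xs y)) := by
  have := isMarkovKernel_posterior (ι := ι) k σ hσ
  have h : Measurable (Function.uncurry fun (y : ι → ℝ) g => φ (g, y)) := hφ.comp measurable_swap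
  exact h.lintegral_kernel_prod_right (κ := (posterior k σ).comap (zipData xs) (by fun_prop))

/-- Given the outputs at fixed inputs, the random function has the posterior distribution. -/
theorem lintegral_priorNoise_eq_posterior (k : X → X → ℝ) {σ : ℝ≥0} (hσ : 0 < σ) (xs : ι → X)
    {φ : (X → ℝ) × (ι → ℝ) → ℝ≥0∞} (hφ : Measurable φ) :
    ∫⁻ p, φ (p.1, noisyOutputs xs p) ∂(priorNoise k σ ι) =
      ∫⁻ p, ∫⁻ g, φ (g, noisyOutputs xs p) ∂(posterior k σ (zipData xs (noisyOutputs xs p)))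
        ∂(priorNoise k σ ι) := by
  have hΦ := measurable_lintegral_posterior k hσ xs hφ
  have hR := lintegral_priorNoise k hσ xs
    (φ := fun q => ∫⁻ g, φ (g, q.2) ∂(posterior k σ (zipData xs q.2))) (hΦ.comp measurable_snd)
  rw [lintegral_priorNoise k hσ xs hφ]
  refine Eq.trans ?_ hR.symm
  -- For each `y` the right-hand integrand is constant in `f` apart from the likelihood. Integrating
  -- out `f` gives the evidence times the posterior integral.
  refine lintegral_congr fun y => ?_
  have hL := measurable_likelihood_right (X := X) σ (zipData xs y)
  refine Eq.trans ?_ (lintegral_mul_const (∫⁻ g, φ (g, y) ∂(posterior k σ (zipData xs y))) hL).symm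
  exact (evidence_mul_lintegral_posterior k hσ (zipData xs y)
    (ψ := fun f => φ (f, y)) (by fun_prop)).symm

theorem map_restrict_priorNoise {X ι : Type*} [Fintype X] [DecidableEq X] [Fintype ι]
    (k : X → X → ℝ) (σ : ℝ≥0) (p : ι → Prop) [DecidablePred p] :
    (priorNoise k σ ι).map (fun q => (q.1, fun i : {i // p i} => q.2 i)) =
      priorNoise k σ {i // p i} := by
  have h := Measure.map_prod_map (gpPrior k) (noisePi σ ι) (f := id)
    (g := fun e (i : {i // p i}) => e i) measurable_id (by fun_prop)
  rw [Measure.map_id, map_restrict_noisePi] at h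
  exact h.symm

/-- Resampling the random function given the outputs with indices in `p`, together with all other
outputs, does not change the joint law of the function and the outputs. -/
theorem lintegral_priorNoise_resample (k : X → X → ℝ) {σ : ℝ≥0} (hσ : 0 < σ)
    (p : ι → Prop) [DecidablePred p] (xs : ι → X)
    {φ : (X → ℝ) × (ι → ℝ) → ℝ≥0∞} (hφ : Measurable φ) :
    ∫⁻ q, φ (q.1, noisyOutputs xs q) ∂(priorNoise k σ ι) =
      ∫⁻ q, ∫⁻ g, ∫⁻ e, φ (g, fun i => if p i then noisyOutputs xs q i else g (xs i) + e i)
          ∂(noisePi σ ι)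
        ∂(posterior k σ fun i : {i // p i} => zipData xs (noisyOutputs xs q) i)
        ∂(priorNoise k σ ι) := by
  set mix : (ι → ℝ) × (ι → ℝ) → ι → ℝ := fun y i => if p i then y.1 i else y.2 i with hmix
  have hmixm : Measurable mix := by
    refine measurable_pi_lambda _ fun i => ?_
    by_cases h : p i <;> simp only [hmix, h, if_true, if_false] <;> fun_prop
  -- Padding by `0` is harmless: `mix` reads its first argument only on the kept coordinates
  -- (`hmixext`). It turns the integrand into a function of the kept outputs alone, so that Bayes'
  -- rule applies to them.
  set ext : ({i // p i} → ℝ) → ι → ℝ := fun v i => if h : p i then v ⟨i, h⟩ else 0 with hext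
  have hextm : Measurable ext := by
    refine measurable_pi_lambda _ fun i => ?_
    by_cases h : p i <;> simp only [hext, h, dite_true, dite_false] <;> fun_prop
  have hmixext : ∀ y z : ι → ℝ, mix (ext fun i => y i, z) = mix (y, z) := fun y z => by
    funext i
    by_cases h : p i <;> simp [hmix, hext, h]
  set xs' : {i // p i} → X := fun i => xs i with hxs'
  set ρ : (X → ℝ) × (ι → ℝ) → (X → ℝ) × ({i // p i} → ℝ) :=
    fun q => (q.1, fun i => q.2 i) with hρ
  have hρm : Measurable ρ := by fun_prop
  set Θ : (X → ℝ) × ({i // p i} → ℝ) → ℝ≥0∞ :=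
    fun r => ∫⁻ e, φ (r.1, mix (ext r.2, fun i => r.1 (xs i) + e i)) ∂(noisePi σ ι) with hΘ
  have hΘm : Measurable Θ := by
    refine Measurable.lintegral_prod_right' (f := fun q : ((X → ℝ) × ({i // p i} → ℝ)) × (ι → ℝ) =>
      φ (q.1.1, mix (ext q.1.2, fun i => q.1.1 (xs i) + q.2 i))) ?_
    exact hφ.comp (measurable_fst.fst.prodMk (hmixm.comp (by fun_prop)))
  have hF := measurable_lintegral_posterior k hσ xs' hΘm
  have hR : ∀ q, ∫⁻ g, ∫⁻ e, φ (g, fun i => if p i then noisyOutputs xs q i else g (xs i) + e i)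
          ∂(noisePi σ ι)
        ∂(posterior k σ fun i : {i // p i} => zipData xs (noisyOutputs xs q) i) =
      ∫⁻ g, Θ (g, noisyOutputs xs' (ρ q)) ∂(posterior k σ
        (zipData xs' (noisyOutputs xs' (ρ q)))) := fun q => by
    refine lintegral_congr fun g => lintegral_congr fun e => ?_
    have := hmixext (noisyOutputs xs q) fun i => g (xs i) + e i
    change φ (g, mix (noisyOutputs xs q, fun i => g (xs i) + e i)) =
      φ (g, mix (ext fun i => noisyOutputs xs q i, fun i => g (xs i) + e i))
    rw [this]
  simp_rw [hR]
  have h1 := lintegral_map (μ := priorNoise k σ ι) (f := fun r => ∫⁻ g, Θ (g, noisyOutputs xs' r)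
    ∂(posterior k σ (zipData xs' (noisyOutputs xs' r)))) (g := ρ)
    (hF.comp (measurable_noisyOutputs xs')) hρm
  have h2 := lintegral_map (μ := priorNoise k σ ι) (f := fun r => Θ (r.1, noisyOutputs xs' r))
    (g := ρ) (by fun_prop) hρm
  -- Pass to the kept outputs, undo the posterior integral by Bayes' rule, and return to the full
  -- noise. The sampled path becomes the original `f`, and only fresh noise at the discarded indices
  -- remains.
  rw [← h1, map_restrict_priorNoise, ← lintegral_priorNoise_eq_posterior k hσ xs' hΘm,
    ← map_restrict_priorNoise, h2, priorNoise, lintegral_prod _ (by fun_prop),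
    lintegral_prod _ (by fun_prop)]
  refine lintegral_congr fun f => ?_
  -- With the path equal to `f`, imputing with fresh noise `e'` is the same as observing `f` with
  -- the recombined noise `mix (e, e')`.
  have h3 : ∀ e, Θ ((ρ (f, e)).1, noisyOutputs xs' (ρ (f, e))) =
      ∫⁻ e', φ (f, noisyOutputs xs (f, mix (e, e'))) ∂(noisePi σ ι) := fun e => by
    refine lintegral_congr fun e' => ?_
    have h4 := hmixext (noisyOutputs xs (f, e)) fun i => f (xs i) + e' i
    have h5 : mix (noisyOutputs xs (f, e), fun i => f (xs i) + e' i) =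
        noisyOutputs xs (f, mix (e, e')) := by
      funext i
      by_cases h : p i <;> simp [hmix, noisyOutputs, h]
    rw [← h5, ← h4]
    rfl
  simp_rw [h3]
  have h6 : Measurable fun e : (ι → ℝ) × (ι → ℝ) => φ (f, noisyOutputs xs (f, mix e)) :=
    hφ.comp (measurable_const.prodMk ((measurable_noisyOutputs xs).comp
      (measurable_const.prodMk hmixm)))
  have h7 := lintegral_prod (μ := noisePi σ ι) (ν := noisePi σ ι) _ h6.aemeasurable
  rw [← h7, ← lintegral_map (f := fun e => φ (f, noisyOutputs xs (f, e))) (by fun_prop) hmixm,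
    map_piecewise_noisePi]

end Bayes

/-! ### Entropy of a real Gaussian. -/

section GaussianEntropy

/-- The differential entropy of a real Gaussian measure with variance `v`. -/
noncomputable def gaussianEntropy (v : ℝ≥0) : ℝ := (Real.log (2 * Real.pi * v) + 1) / 2

theorem log_gaussianPDFReal {v : ℝ≥0} (hv : v ≠ 0) (m s : ℝ) :
    Real.log (gaussianPDFReal m v (m + s)) = -Real.log (2 * Real.pi * v) / 2 - s ^ 2 / (2 * v) := by
  have hv' : (0 : ℝ) < v := by positivity
  rw [gaussianPDFReal, Real.log_mul (by positivity) (Real.exp_pos _).ne', Real.log_exp,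
    Real.log_inv, Real.log_sqrt (by positivity), add_sub_cancel_left]
  ring

theorem integrable_sq_gaussianReal (v : ℝ≥0) : Integrable (fun s => s ^ 2) (gaussianReal 0 v) :=
  (memLp_id_gaussianReal 2).integrable_sq

theorem integral_sq_gaussianReal (v : ℝ≥0) : ∫ s, s ^ 2 ∂(gaussianReal 0 v) = v := by
  have h := variance_eq_sub (memLp_id_gaussianReal (μ := 0) (v := v) 2)
  rw [variance_id_gaussianReal] at h
  simp only [id_eq, integral_id_gaussianReal, Pi.pow_apply] at h
  linarith

theorem integrable_log_gaussianPDFReal (v : ℝ≥0) :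
    Integrable (fun s => -Real.log (2 * Real.pi * v) / 2 - s ^ 2 / (2 * v)) (gaussianReal 0 v) :=
  (integrable_const _).sub ((integrable_sq_gaussianReal v).div_const _)

theorem integral_log_gaussianPDFReal {v : ℝ≥0} (hv : v ≠ 0) :
    ∫ s, (-Real.log (2 * Real.pi * v) / 2 - s ^ 2 / (2 * v)) ∂(gaussianReal 0 v) =
      -gaussianEntropy v := by
  have hv' : (v : ℝ) ≠ 0 := by exact_mod_cast hv
  rw [integral_sub (integrable_const _) ((integrable_sq_gaussianReal v).div_const _),
    integral_const, integral_div, integral_sq_gaussianReal, gaussianEntropy]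
  simp
  field_simp
  ring

end GaussianEntropy

/-! ### Density and entropy of the outputs by the chain rule. -/

section PredictiveDensity

theorem measurable_snoc_real {T : ℕ} :
    Measurable fun p : (Fin T → ℝ) × ℝ => (Fin.snoc p.1 p.2 : Fin (T + 1) → ℝ) := by
  refine measurable_pi_lambda _ fun i => ?_
  induction i using Fin.lastCases with
  | last => simpa using measurable_snd
  | cast i => simp only [Fin.snoc_castSucc]; fun_prop

variable {X : Type*} [Fintype X] [DecidableEq X]

theorem priorNoise_succ (k : X → X → ℝ) (σ : ℝ≥0) (T : ℕ) :
    ((priorNoise k σ (Fin T)).prod (gaussianReal 0 (σ ^ 2))).map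
      (fun r => (r.1.1, (Fin.snoc r.1.2 r.2 : Fin (T + 1) → ℝ))) =
      priorNoise k σ (Fin (T + 1)) := by
  have h2 := Measure.map_prod_map (gpPrior k) ((noisePi σ (Fin T)).prod (gaussianReal 0 (σ ^ 2)))
    (f := id) (g := fun p => (Fin.snoc p.1 p.2 : Fin (T + 1) → ℝ)) measurable_id
    measurable_snoc_real
  rw [noisePi, map_snoc_prod_pi, Measure.map_id, ← (measurePreserving_prodAssoc _ _ _).map_eq,
    Measure.map_map (measurable_id.prodMap measurable_snoc_real)
      (MeasurableEquiv.measurable _)] at h2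
  exact h2.symm

/-- The law of the noisy outputs at the inputs `xs`. -/
noncomputable def outputLaw {ι : Type*} [Fintype ι] (k : X → X → ℝ) (σ : ℝ≥0) (xs : ι → X) :
    Measure (ι → ℝ) :=
  (priorNoise k σ ι).map (noisyOutputs xs)

instance {ι : Type*} [Fintype ι] (k : X → X → ℝ) (σ : ℝ≥0) (xs : ι → X) :
    IsProbabilityMeasure (outputLaw k σ xs) :=
  Measure.isProbabilityMeasure_map (by fun_prop)

theorem noisyOutputs_snoc {X : Type*} {T : ℕ} (xs : Fin (T + 1) → X) (f : X → ℝ) (e : Fin T → ℝ)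
    (e' : ℝ) :
    noisyOutputs xs (f, Fin.snoc e e') =
      Fin.snoc (noisyOutputs (Fin.init xs) (f, e)) (f (xs (Fin.last T)) + e') := by
  funext i
  induction i using Fin.lastCases with
  | last => simp [noisyOutputs]
  | cast i => simp [noisyOutputs, Fin.init]

/-- The variance of the next output given the previous ones. -/
noncomputable def predictiveVar {X ι : Type*} [Fintype ι] [DecidableEq ι] (k : X → X → ℝ) (σ : ℝ≥0)
    (xs : ι → X) (x : X) : ℝ≥0 := (posteriorVar k σ xs x).toNNReal + σ ^ 2

theorem predictiveVar_ne_zero {X ι : Type*} [Fintype ι] [DecidableEq ι] (k : X → X → ℝ) {σ : ℝ≥0}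
    (hσ : 0 < σ) (xs : ι → X) (x : X) : predictiveVar k σ xs x ≠ 0 :=
  (add_pos_of_nonneg_of_pos zero_le (pow_pos hσ 2)).ne'

/-- Appends to the outputs `y` the output at `x` with prediction error `s`. -/
noncomputable def appendOutput {X : Type*} {T : ℕ} (k : X → X → ℝ) (σ : ℝ≥0) (xs : Fin T → X)
    (x : X)
    (r : (Fin T → ℝ) × ℝ) : Fin (T + 1) → ℝ :=
  Fin.snoc r.1 (posteriorMean k σ xs x r.1 + r.2)

theorem measurable_appendOutput {X : Type*} {T : ℕ} (k : X → X → ℝ) (σ : ℝ≥0) (xs : Fin T → X)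
    (x : X) :
    Measurable (appendOutput k σ xs x) :=
  measurable_snoc_real.comp (measurable_fst.prodMk
    (((measurable_posteriorMean k σ xs x).comp measurable_fst).add measurable_snd))

/-- The prediction error of the next output is Gaussian and independent of the previous outputs. -/
theorem outputLaw_succ {k : X → X → ℝ} (hk : (Matrix.of k).PosSemidef) {σ : ℝ≥0} (hσ : 0 < σ)
    {T : ℕ} (xs : Fin (T + 1) → X) :
    outputLaw k σ xs = ((outputLaw k σ (Fin.init xs)).prod
      (gaussianReal 0 (predictiveVar k σ (Fin.init xs) (xs (Fin.last T))))).map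
        (appendOutput k σ (Fin.init xs) (xs (Fin.last T))) := by
  set x := xs (Fin.last T)
  have hind := (indepFun_iff_map_prod_eq_prod_map_map (by fun_prop) (by fun_prop)).1
    (indepFun_residual_outputs hk hσ (Fin.init xs) x).symm
  rw [map_residual hk hσ] at hind
  change _ = (outputLaw k σ (Fin.init xs)).prod _ at hind
  -- The error in predicting the next output is the residual at `x` plus fresh noise. The two are
  -- independent Gaussians, so their variances add up to `predictiveVar`.
  have hconv := gaussianReal_conv_gaussianReal (m₁ := 0) (m₂ := 0)
    (v₁ := (posteriorVar k σ (Fin.init xs) x).toNNReal) (v₂ := σ ^ 2)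
  rw [add_zero] at hconv
  have hadd : Measurable fun r : ((Fin T → ℝ) × ℝ) × ℝ => (r.1.1, r.1.2 + r.2) := by fun_prop
  have hassoc : (((outputLaw k σ (Fin.init xs)).prod (gaussianReal 0
      (posteriorVar k σ (Fin.init xs) x).toNNReal)).prod (gaussianReal 0 (σ ^ 2))).map
        (fun r => (r.1.1, r.1.2 + r.2)) =
      (outputLaw k σ (Fin.init xs)).prod (gaussianReal 0 (predictiveVar k σ (Fin.init xs) x)) := by
    have hsum : Measurable fun p : ℝ × ℝ => p.1 + p.2 := by fun_prop
    have h2 := Measure.map_prod_map (outputLaw k σ (Fin.init xs))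
      ((gaussianReal 0 (posteriorVar k σ (Fin.init xs) x).toNNReal).prod (gaussianReal 0 (σ ^ 2)))
      (f := id) (g := fun p => p.1 + p.2) measurable_id hsum
    rw [Measure.map_id, ← (measurePreserving_prodAssoc _ _ _).map_eq,
      Measure.map_map (measurable_id.prodMap hsum)
        (MeasurableEquiv.measurable _)] at h2
    rw [predictiveVar, ← hconv]
    exact h2.symm
  have hm : Measurable fun q : (X → ℝ) × (Fin T → ℝ) =>
    (noisyOutputs (Fin.init xs) q, residual k σ (Fin.init xs) x q) := by fun_prop
  have hprod := Measure.map_prod_map (priorNoise k σ (Fin T)) (gaussianReal 0 (σ ^ 2))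
    hm measurable_id
  rw [hind, Measure.map_id] at hprod
  have hs : Measurable fun r : ((X → ℝ) × (Fin T → ℝ)) × ℝ =>
      (r.1.1, (Fin.snoc r.1.2 r.2 : Fin (T + 1) → ℝ)) :=
    measurable_fst.fst.prodMk
        (measurable_snoc_real.comp (measurable_fst.snd.prodMk measurable_snd))
  rw [← hassoc, hprod, Measure.map_map (measurable_appendOutput _ _ _ _) hadd,
    Measure.map_map ((measurable_appendOutput _ _ _ _).comp hadd) (hm.prodMap measurable_id),
    outputLaw, ← priorNoise_succ, Measure.map_map (measurable_noisyOutputs _) hs]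
  congr 1
  funext r
  simp only [Function.comp_apply, noisyOutputs_snoc, appendOutput, Prod.map, residual, id_eq]
  congr 1
  ring

/-- The density of the law of the outputs as a product of predictive densities. -/
noncomputable def predictiveDensity {X : Type*} (k : X → X → ℝ) (σ : ℝ≥0) :
    ∀ T : ℕ, (Fin T → X) → (Fin T → ℝ) → ℝ
  | 0, _, _ => 1
  | T + 1, xs, y => predictiveDensity k σ T (Fin.init xs) (Fin.init y) *
      gaussianPDFReal (posteriorMean k σ (Fin.init xs) (xs (Fin.last T)) (Fin.init y))
        (predictiveVar k σ (Fin.init xs) (xs (Fin.last T))) (y (Fin.last T))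

theorem predictiveDensity_pos {X : Type*} (k : X → X → ℝ) {σ : ℝ≥0} (hσ : 0 < σ) (T : ℕ)
    (xs : Fin T → X)
    (y : Fin T → ℝ) : 0 < predictiveDensity k σ T xs y := by
  induction T with
  | zero => exact one_pos
  | succ T ih => exact mul_pos (ih _ _) (gaussianPDFReal_pos _ _ _ (predictiveVar_ne_zero k hσ _ _))

theorem measurable_predictiveDensity {X : Type*} (k : X → X → ℝ) (σ : ℝ≥0) (T : ℕ)
    (xs : Fin T → X) :
    Measurable (predictiveDensity k σ T xs) := by
  induction T with
  | zero => exact measurable_const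
  | succ T ih =>
    have hinit : Measurable fun y : Fin (T + 1) → ℝ => (Fin.init y : Fin T → ℝ) := by
      unfold Fin.init; fun_prop
    refine ((ih (Fin.init xs)).comp hinit).mul ?_
    exact measurable_uncurry_gaussianPDFReal.comp
      (((measurable_posteriorMean k σ _ _).comp hinit).prodMk (measurable_const.prodMk
        (measurable_pi_apply (Fin.last T))))

/-- Induction along `outputLaw_succ`: translating the centred prediction error by the posterior mean
contributes one Gaussian factor per output. -/
theorem outputLaw_eq_withDensity {k : X → X → ℝ} (hk : (Matrix.of k).PosSemidef) {σ : ℝ≥0}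
    (hσ : 0 < σ) {T : ℕ} (xs : Fin T → X) :
    outputLaw k σ xs = (volume : Measure (Fin T → ℝ)).withDensity
      fun y => ENNReal.ofReal (predictiveDensity k σ T xs y) := by
  induction T with
  | zero =>
    have h : IsProbabilityMeasure (outputLaw k σ xs) := inferInstance
    simp only [predictiveDensity, ENNReal.ofReal_one]
    rw [show (fun _ : Fin 0 → ℝ => (1 : ℝ≥0∞)) = 1 from rfl, withDensity_one]
    ext s hs
    rcases s.eq_empty_or_nonempty with h0 | h0
    · simp [h0]
    · simp [h0.eq_univ, volume_pi]
  | succ T ih =>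
    set x := xs (Fin.last T)
    set v := predictiveVar k σ (Fin.init xs) x
    have hv : v ≠ 0 := predictiveVar_ne_zero k hσ _ _
    have hd := (measurable_predictiveDensity k σ T (Fin.init xs)).ennreal_ofReal
    refine Measure.ext_of_lintegral _ fun φ hφ => ?_
    have hms : Measurable fun r : (Fin T → ℝ) × ℝ => φ (Fin.snoc r.1 r.2 : Fin (T + 1) → ℝ) :=
      hφ.comp measurable_snoc_real
    have hin : ∀ y : Fin T → ℝ, ∫⁻ s, φ (appendOutput k σ (Fin.init xs) x (y, s))
        ∂(gaussianReal 0 v)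
        = ∫⁻ z, gaussianPDF (posteriorMean k σ (Fin.init xs) x y) v z *
            φ (Fin.snoc y z : Fin (T + 1) → ℝ) := fun y => by
      have hsy : Measurable fun z : ℝ => φ (Fin.snoc y z : Fin (T + 1) → ℝ) :=
        hms.comp measurable_prodMk_left
      have h1 : gaussianReal (posteriorMean k σ (Fin.init xs) x y) v =
          (gaussianReal 0 v).map (posteriorMean k σ (Fin.init xs) x y + ·) := by
        rw [gaussianReal_map_const_add, zero_add]
      have h2 := lintegral_withDensity_eq_lintegral_mul volume
        (measurable_gaussianPDF (posteriorMean k σ (Fin.init xs) x y) v) hsy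
      rw [← gaussianReal_of_var_ne_zero _ hv, h1, lintegral_map hsy (by fun_prop)] at h2
      exact h2
    have hq := (measurable_predictiveDensity k σ (T + 1) xs).ennreal_ofReal
    have hsφ : Measurable fun r : (Fin T → ℝ) × ℝ => φ (appendOutput k σ (Fin.init xs) x r) :=
      hφ.comp (measurable_appendOutput k σ (Fin.init xs) x)
    have hqφ : Measurable fun r : (Fin T → ℝ) × ℝ =>
        ENNReal.ofReal (predictiveDensity k σ (T + 1) xs (Fin.snoc r.1 r.2)) *
          φ (Fin.snoc r.1 r.2 : Fin (T + 1) → ℝ) := (hq.mul hφ).comp measurable_snoc_real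
    have e1 : ∫⁻ y, φ y ∂(outputLaw k σ xs) = ∫⁻ y, ∫⁻ s,
        φ (appendOutput k σ (Fin.init xs) x (y, s)) ∂(gaussianReal 0 v)
          ∂(outputLaw k σ (Fin.init xs)) := by
      rw [outputLaw_succ hk hσ, lintegral_map hφ (measurable_appendOutput _ _ _ _)]
      exact lintegral_prod _ hsφ.aemeasurable
    have e2 : ∫⁻ y, φ y ∂((volume : Measure (Fin (T + 1) → ℝ)).withDensity
        fun y => ENNReal.ofReal (predictiveDensity k σ (T + 1) xs y)) =
        ∫⁻ y : Fin T → ℝ, ∫⁻ z : ℝ,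
          ENNReal.ofReal (predictiveDensity k σ (T + 1) xs (Fin.snoc y z)) *
            φ (Fin.snoc y z : Fin (T + 1) → ℝ) := by
      rw [lintegral_withDensity_eq_lintegral_mul _ hq hφ, volume_pi, ← map_snoc_prod_pi,
        lintegral_map (hq.mul hφ) measurable_snoc_real]
      exact lintegral_prod _ hqφ.aemeasurable
    rw [e1, e2, ih]
    simp_rw [hin]
    have hg : Measurable fun r : (Fin T → ℝ) × ℝ =>
        gaussianPDF (posteriorMean k σ (Fin.init xs) x r.1) v r.2 *
          φ (Fin.snoc r.1 r.2 : Fin (T + 1) → ℝ) :=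
      (measurable_uncurry_gaussianPDF.comp (((measurable_posteriorMean k σ _ _).comp
        measurable_fst).prodMk (measurable_const.prodMk measurable_snd))).mul hms
    rw [lintegral_withDensity_eq_lintegral_mul _ hd hg.lintegral_prod_right']
    refine lintegral_congr fun y => ?_
    have hgy : Measurable fun z : ℝ => gaussianPDF (posteriorMean k σ (Fin.init xs) x y) v z *
          φ (Fin.snoc y z : Fin (T + 1) → ℝ) := by
      have hy : Measurable fun z : ℝ => (y, z) := measurable_prodMk_left
      have := hg.comp hy
      exact this
    have hc := lintegral_const_mul (ENNReal.ofReal (predictiveDensity k σ T (Fin.init xs) y))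
      (μ := volume) hgy
    refine Eq.trans hc.symm (lintegral_congr fun z => ?_)
    simp only [predictiveDensity, Fin.init_snoc, Fin.snoc_last]
    rw [ENNReal.ofReal_mul (predictiveDensity_pos k hσ _ _ _).le, mul_assoc]
    rfl

/-- The differential entropy of the outputs. -/
noncomputable def outputEntropy {X : Type*} (k : X → X → ℝ) (σ : ℝ≥0) : ∀ T : ℕ, (Fin T → X) → ℝ
  | 0, _ => 0
  | T + 1, xs => outputEntropy k σ T (Fin.init xs) +
      gaussianEntropy (predictiveVar k σ (Fin.init xs) (xs (Fin.last T)))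

/-- In the coordinates of `appendOutput` the logarithm of the last factor depends on the prediction
error alone, so every round adds the entropy of one Gaussian. -/
theorem integral_log_predictiveDensity {k : X → X → ℝ} (hk : (Matrix.of k).PosSemidef) {σ : ℝ≥0}
    (hσ : 0 < σ) {T : ℕ} (xs : Fin T → X) :
    Integrable (fun y => Real.log (predictiveDensity k σ T xs y)) (outputLaw k σ xs) ∧
    ∫ y, Real.log (predictiveDensity k σ T xs y) ∂(outputLaw k σ xs) =
      -outputEntropy k σ T xs := by
  induction T with
  | zero => simp [predictiveDensity, outputEntropy]
  | succ T ih =>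
    obtain ⟨ih1, ih2⟩ := ih (Fin.init xs)
    set x := xs (Fin.last T) with hx
    set v := predictiveVar k σ (Fin.init xs) x with hvdef
    have hv : v ≠ 0 := predictiveVar_ne_zero k hσ _ _
    have hlog : ∀ r : (Fin T → ℝ) × ℝ, Real.log (predictiveDensity k σ (T + 1) xs
        (appendOutput k σ (Fin.init xs) x r)) =
        Real.log (predictiveDensity k σ T (Fin.init xs) r.1) +
          (-Real.log (2 * Real.pi * v) / 2 - r.2 ^ 2 / (2 * v)) := fun r => by
      rw [← log_gaussianPDFReal hv (posteriorMean k σ (Fin.init xs) x r.1)]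
      simp only [predictiveDensity, appendOutput, Fin.init_snoc, Fin.snoc_last]
      exact Real.log_mul (predictiveDensity_pos k hσ _ _ _).ne' (gaussianPDFReal_pos _ _ _ hv).ne'
    have hmeas : Measurable fun y => Real.log (predictiveDensity k σ (T + 1) xs y) :=
      (measurable_predictiveDensity k σ (T + 1) xs).log
    have hma := measurable_appendOutput k σ (Fin.init xs) x
    have i1 := ih1.comp_fst (gaussianReal 0 v)
    have i2 := (integrable_log_gaussianPDFReal v).comp_snd (outputLaw k σ (Fin.init xs))
    rw [outputLaw_succ hk hσ, integrable_map_measure hmeas.aestronglyMeasurable hma.aemeasurable,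
      integral_map hma.aemeasurable hmeas.aestronglyMeasurable]
    simp only [Function.comp_def]
    simp_rw [← hx, ← hvdef, hlog]
    refine ⟨i1.add i2, ?_⟩
    rw [integral_add i1 i2, integral_fun_fst (fun y => Real.log (predictiveDensity k σ T _ y)),
      integral_fun_snd (fun s : ℝ => -Real.log (2 * Real.pi * v) / 2 - s ^ 2 / (2 * v)),
      ih2, integral_log_gaussianPDFReal hv, outputEntropy]
    simp
    ring

end PredictiveDensity

/-! ### Mutual information as an entropy difference, and its bound on posterior variances. -/

section InformationGain

variable {X : Type*} [Fintype X] [DecidableEq X]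

/-- The density of the outputs `r.1` given the function values `r.2`. -/
noncomputable def noiseDensity {T : ℕ} (σ : ℝ≥0) (r : (Fin T → ℝ) × (Fin T → ℝ)) : ℝ :=
  ∏ i, gaussianPDFReal (r.2 i) (σ ^ 2) (r.1 i)

theorem noiseDensity_pos {T : ℕ} {σ : ℝ≥0} (hσ : 0 < σ) (r : (Fin T → ℝ) × (Fin T → ℝ)) :
    0 < noiseDensity σ r :=
  Finset.prod_pos fun _ _ => gaussianPDFReal_pos _ _ _ (pow_ne_zero 2 hσ.ne')

theorem measurable_noiseDensity {T : ℕ} (σ : ℝ≥0) :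
    Measurable (noiseDensity σ : (Fin T → ℝ) × (Fin T → ℝ) → ℝ) := by
  unfold noiseDensity
  refine Finset.measurable_prod _ fun i _ => ?_
  have h : Measurable fun r : (Fin T → ℝ) × (Fin T → ℝ) => (r.2 i, σ ^ 2, r.1 i) := by fun_prop
  have := measurable_uncurry_gaussianPDFReal.comp h
  exact this

theorem outputValueLaw_eq_map (k : X → X → ℝ) (σ : ℝ≥0) {T : ℕ} (xs : Fin T → X) :
    outputValueLaw k σ xs = (priorNoise k σ (Fin T)).map
      fun q => (noisyOutputs xs q, fun i => q.1 (xs i)) := rfl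

theorem outputValueLaw_fst (k : X → X → ℝ) (σ : ℝ≥0) {T : ℕ} (xs : Fin T → X) :
    (outputValueLaw k σ xs).fst = outputLaw k σ xs := by
  rw [outputValueLaw_eq_map, Measure.fst, Measure.map_map measurable_fst (by fun_prop)]
  rfl

theorem outputValueLaw_snd (k : X → X → ℝ) (σ : ℝ≥0) {T : ℕ} (xs : Fin T → X) :
    (outputValueLaw k σ xs).snd = (gpPrior k).map fun f i => f (xs i) := by
  have h : (priorNoise k σ (Fin T)).map Prod.fst = gpPrior k := by simp [priorNoise]
  rw [outputValueLaw_eq_map, Measure.snd, Measure.map_map measurable_snd (by fun_prop), ← h,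
    Measure.map_map (by fun_prop) measurable_fst]
  rfl

/-- The density is `p(y ∣ f) / p(y)`. It is taken relative to the product of the marginals because
the function values need not have a Lebesgue density: the kernel may be singular and inputs may
repeat. -/
theorem outputValueLaw_eq_withDensity {k : X → X → ℝ} (hk : (Matrix.of k).PosSemidef) {σ : ℝ≥0}
    (hσ : 0 < σ) {T : ℕ} (xs : Fin T → X) :
    outputValueLaw k σ xs =
      ((outputValueLaw k σ xs).fst.prod (outputValueLaw k σ xs).snd).withDensity
      fun r => ENNReal.ofReal (noiseDensity σ r / predictiveDensity k σ T xs r.1) := by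
  set F : Measure (Fin T → ℝ) := (gpPrior k).map fun f i => f (xs i) with hF
  have hxs : Measurable fun (f : X → ℝ) i => f (xs i) := by fun_prop
  have hFp : IsProbabilityMeasure F := Measure.isProbabilityMeasure_map hxs.aemeasurable
  have hq := (measurable_predictiveDensity k σ T xs).ennreal_ofReal
  have hn := (measurable_noiseDensity (T := T) σ).ennreal_ofReal
  have hd : Measurable fun r : (Fin T → ℝ) × (Fin T → ℝ) =>
      ENNReal.ofReal (noiseDensity σ r / predictiveDensity k σ T xs r.1) :=
    ((measurable_noiseDensity σ).div
      ((measurable_predictiveDensity k σ T xs).comp measurable_fst)).ennreal_ofReal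
  rw [outputValueLaw_fst, outputValueLaw_snd, outputLaw_eq_withDensity hk hσ, ← hF,
    prod_withDensity_left hq]
  have hq1 : Measurable fun r : (Fin T → ℝ) × (Fin T → ℝ) =>
      ENNReal.ofReal (predictiveDensity k σ T xs r.1) := hq.comp measurable_fst
  refine Eq.trans ?_ (withDensity_mul _ hq1 hd)
  have hmul : ((fun r : (Fin T → ℝ) × (Fin T → ℝ) =>
      ENNReal.ofReal (predictiveDensity k σ T xs r.1)) * fun r =>
        ENNReal.ofReal (noiseDensity σ r / predictiveDensity k σ T xs r.1)) =
      fun r => ENNReal.ofReal (noiseDensity σ r) := by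
    funext r
    have := predictiveDensity_pos k hσ T xs r.1
    rw [Pi.mul_apply, ← ENNReal.ofReal_mul this.le, mul_div_cancel₀ _ this.ne']
  refine Eq.trans ?_ (congrArg _ hmul.symm)
  refine Measure.ext_of_lintegral _ fun φ hφ => ?_
  have hnφ := hn.mul hφ
  have hφ' : Measurable fun q : (X → ℝ) × (Fin T → ℝ) =>
    φ (noisyOutputs xs q, fun i => q.1 (xs i)) := by fun_prop
  rw [outputValueLaw_eq_map, lintegral_map hφ (by fun_prop),
    lintegral_withDensity_eq_lintegral_mul _ hn hφ, lintegral_prod_symm' _ hnφ,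
    lintegral_map hnφ.lintegral_prod_left' (by fun_prop), priorNoise,
    lintegral_prod _ hφ'.aemeasurable]
  refine lintegral_congr fun f => ?_
  have hv : Measurable fun y : Fin T → ℝ => (y, fun i => f (xs i)) := by fun_prop
  have h1 := lintegral_map (μ := noisePi σ (Fin T)) (f := fun y => φ (y, fun i => f (xs i)))
    (g := fun e i => f (xs i) + e i) (hφ.comp hv) (by fun_prop)
  refine h1.symm.trans ?_
  have h2 : (fun y : Fin T → ℝ => ∏ i, gaussianPDF (f (xs i)) (σ ^ 2) (y i)) =
      fun y => ENNReal.ofReal (noiseDensity σ (y, fun i => f (xs i))) := by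
    funext y
    rw [noiseDensity, ENNReal.ofReal_prod_of_nonneg fun i _ => gaussianPDFReal_nonneg _ _ _]
    rfl
  rw [map_add_noisePi hσ, h2]
  exact lintegral_withDensity_eq_lintegral_mul _ (hn.comp hv) (hφ.comp hv)

/-- Evaluated at the noisy outputs, the density of `y` given `f` depends on the noise alone, which
gives `T` times the entropy of one noise variable. -/
theorem integral_log_noiseDensity (k : X → X → ℝ) {σ : ℝ≥0} (hσ : 0 < σ) {T : ℕ}
    (xs : Fin T → X) :
    Integrable (fun r => Real.log (noiseDensity σ r)) (outputValueLaw k σ xs) ∧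
    ∫ r, Real.log (noiseDensity σ r) ∂(outputValueLaw k σ xs) = -(T * gaussianEntropy (σ ^ 2)) := by
  have hσ2 : σ ^ 2 ≠ 0 := pow_ne_zero 2 hσ.ne'
  have hlog : ∀ q : (X → ℝ) × (Fin T → ℝ),
      Real.log (noiseDensity σ (noisyOutputs xs q, fun i => q.1 (xs i))) =
        ∑ i, (-Real.log (2 * Real.pi * (σ ^ 2 : ℝ≥0)) / 2 - q.2 i ^ 2 / (2 * (σ ^ 2 : ℝ≥0))) :=
    fun q => by
      rw [noiseDensity, Real.log_prod fun i _ => (gaussianPDFReal_pos _ _ _ hσ2).ne']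
      exact Finset.sum_congr rfl fun i _ => log_gaussianPDFReal hσ2 _ _
  have hm : Measurable fun q : (X → ℝ) × (Fin T → ℝ) =>
    (noisyOutputs xs q, fun i => q.1 (xs i)) := by fun_prop
  have hl := (measurable_noiseDensity (T := T) σ).log.aestronglyMeasurable
    (μ := (priorNoise k σ (Fin T)).map fun q => (noisyOutputs xs q, fun i => q.1 (xs i)))
  have hi : ∀ i, Integrable (fun q : (X → ℝ) × (Fin T → ℝ) =>
      -Real.log (2 * Real.pi * (σ ^ 2 : ℝ≥0)) / 2 - q.2 i ^ 2 / (2 * (σ ^ 2 : ℝ≥0)))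
      (priorNoise k σ (Fin T)) := fun i =>
    (integrable_comp_eval (μ := fun _ : Fin T => gaussianReal 0 (σ ^ 2)) (i := i)
      (integrable_log_gaussianPDFReal (σ ^ 2))).comp_snd (gpPrior k)
  have hv : ∀ i, ∫ q : (X → ℝ) × (Fin T → ℝ),
      (-Real.log (2 * Real.pi * (σ ^ 2 : ℝ≥0)) / 2 - q.2 i ^ 2 / (2 * (σ ^ 2 : ℝ≥0)))
      ∂(priorNoise k σ (Fin T)) = -gaussianEntropy (σ ^ 2) := fun i => by
    rw [← integral_log_gaussianPDFReal hσ2, priorNoise, integral_fun_snd (fun e : Fin T → ℝ =>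
      -Real.log (2 * Real.pi * (σ ^ 2 : ℝ≥0)) / 2 - e i ^ 2 / (2 * (σ ^ 2 : ℝ≥0)))]
    simp only [probReal_univ, one_smul]
    exact integral_comp_eval (μ := fun _ : Fin T => gaussianReal 0 (σ ^ 2)) (i := i)
      (integrable_log_gaussianPDFReal (σ ^ 2)).aestronglyMeasurable
  rw [outputValueLaw_eq_map, integrable_map_measure hl hm.aemeasurable,
    integral_map hm.aemeasurable hl]
  simp only [Function.comp_def, hlog]
  refine ⟨integrable_finsetSum _ fun i _ => hi i, ?_⟩
  rw [integral_finsetSum _ fun i _ => hi i]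
  simp only [hv, Finset.sum_const, Finset.card_univ, Fintype.card_fin, nsmul_eq_mul, mul_neg]

/-- This is `I(y; f) = h(y) - h(y ∣ f)`: integrate the logarithm of the density ratio. -/
theorem toReal_mutualInformation_outputValueLaw {k : X → X → ℝ} (hk : (Matrix.of k).PosSemidef)
    {σ : ℝ≥0} (hσ : 0 < σ) {T : ℕ} (xs : Fin T → X) :
    (mutualInformation (outputValueLaw k σ xs)).toReal =
      outputEntropy k σ T xs - T * gaussianEntropy (σ ^ 2) := by
  have hJ : IsProbabilityMeasure (outputValueLaw k σ xs) := by
    rw [outputValueLaw_eq_map]; exact Measure.isProbabilityMeasure_map (by fun_prop)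
  set J := outputValueLaw k σ xs with hJdef
  set π := J.fst.prod J.snd with hπ
  have hd : Measurable fun r : (Fin T → ℝ) × (Fin T → ℝ) =>
      ENNReal.ofReal (noiseDensity σ r / predictiveDensity k σ T xs r.1) :=
    ((measurable_noiseDensity σ).div
      ((measurable_predictiveDensity k σ T xs).comp measurable_fst)).ennreal_ofReal
  have hJπ : J = π.withDensity _ := outputValueLaw_eq_withDensity hk hσ xs
  have hac : J ≪ π := by rw [hJπ]; exact withDensity_absolutelyContinuous _ _
  have hrn : J.rnDeriv π =ᵐ[π] fun r =>
      ENNReal.ofReal (noiseDensity σ r / predictiveDensity k σ T xs r.1) := by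
    rw [hJπ]; exact Measure.rnDeriv_withDensity π hd
  have hllr : llr J π =ᵐ[J] fun r => Real.log (noiseDensity σ r) -
      Real.log (predictiveDensity k σ T xs r.1) := by
    filter_upwards [hac.ae_le hrn] with r hr
    have h1 := predictiveDensity_pos k hσ T xs r.1
    have h2 := noiseDensity_pos hσ r
    rw [llr, hr, ENNReal.toReal_ofReal (div_pos h2 h1).le, Real.log_div h2.ne' h1.ne']
  obtain ⟨i1, e1⟩ := integral_log_noiseDensity k hσ xs
  obtain ⟨i2, e2⟩ := integral_log_predictiveDensity hk hσ xs
  rw [← outputValueLaw_fst, ← hJdef, Measure.fst] at i2 e2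
  have hl := (measurable_predictiveDensity k σ T xs).log.aestronglyMeasurable
    (μ := J.map Prod.fst)
  rw [integrable_map_measure hl measurable_fst.aemeasurable] at i2
  rw [integral_map measurable_fst.aemeasurable hl] at e2
  have i2' : Integrable (fun r => Real.log (predictiveDensity k σ T xs r.1)) J := i2
  rw [mutualInformation, InformationTheory.toReal_klDiv_of_measure_eq hac (by simp [π]),
    integral_congr_ae hllr, integral_sub i1 i2', e1, e2]
  ring

/-- The sum of the posterior variances of the successive inputs `xs`. -/
noncomputable def sumPosteriorVar {X : Type*} (k : X → X → ℝ) (σ : ℝ≥0) :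
    ∀ T : ℕ, (Fin T → X) → ℝ
  | 0, _ => 0
  | T + 1, xs => sumPosteriorVar k σ T (Fin.init xs) +
      posteriorVar k σ (Fin.init xs) (xs (Fin.last T))

/-- The entropy difference is `log (1 + V/σ²) / 2`. It is concave in `V`, so on `[0, 1]` it lies
above its chord; in exponential form this is Bernoulli's inequality `(1 + s)^V ≤ 1 + V s`. The slope
of the chord is `1 / C₁`. -/
theorem mul_log_le_gaussianEntropy_sub {σ : ℝ≥0} (hσ : 0 < σ) {V : ℝ} (h0 : 0 ≤ V) (h1 : V ≤ 1) :
    V * (Real.log (1 + ((σ : ℝ) ^ 2)⁻¹) / 2) ≤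
      gaussianEntropy (V.toNNReal + σ ^ 2) - gaussianEntropy (σ ^ 2) := by
  have hσ' : (0 : ℝ) < (σ : ℝ) ^ 2 := by positivity
  have hlog : V * Real.log (1 + ((σ : ℝ) ^ 2)⁻¹) ≤ Real.log (1 + V * ((σ : ℝ) ^ 2)⁻¹) := by
    rw [← Real.log_rpow (by positivity)]
    refine Real.log_le_log (by positivity) ?_
    exact rpow_one_add_le_one_add_mul_self (by linarith [inv_pos.2 hσ']) h0 h1
  have hsub : gaussianEntropy (V.toNNReal + σ ^ 2) - gaussianEntropy (σ ^ 2) =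
      Real.log (1 + V * ((σ : ℝ) ^ 2)⁻¹) / 2 := by
    have hfac : 2 * Real.pi * (V + (σ : ℝ) ^ 2) =
        2 * Real.pi * (σ : ℝ) ^ 2 * (1 + V * ((σ : ℝ) ^ 2)⁻¹) := by field_simp; ring
    simp only [gaussianEntropy, NNReal.coe_add, NNReal.coe_pow, Real.coe_toNNReal _ h0]
    rw [hfac, Real.log_mul (by positivity) (by positivity)]
    ring
  rw [hsub]
  linarith

/-- One application of `mul_log_le_gaussianEntropy_sub` per round. The bound holds for every
sequence of inputs, so it can later be integrated over random ones. -/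
theorem sumPosteriorVar_mul_le {k : X → X → ℝ} (hk : (Matrix.of k).PosSemidef)
    (hk1 : ∀ x, k x x ≤ 1) {σ : ℝ≥0} (hσ : 0 < σ) (T : ℕ) (xs : Fin T → X) :
    sumPosteriorVar k σ T xs * (Real.log (1 + ((σ : ℝ) ^ 2)⁻¹) / 2) ≤
      outputEntropy k σ T xs - T * gaussianEntropy (σ ^ 2) := by
  induction T with
  | zero => simp [sumPosteriorVar, outputEntropy]
  | succ T ih =>
    have h1 := ih (Fin.init xs)
    have h2 := mul_log_le_gaussianEntropy_sub hσ
      (posteriorVar_nonneg hk hσ (Fin.init xs) (xs (Fin.last T)))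
      ((posteriorVar_le_prior hk hσ (Fin.init xs) (xs (Fin.last T))).trans (hk1 _))
    rw [sumPosteriorVar, outputEntropy, predictiveVar]
    push_cast
    linarith

theorem log_one_add_inv_pos {σ : ℝ≥0} (hσ : 0 < σ) :
    0 < Real.log (1 + ((σ : ℝ) ^ 2)⁻¹) :=
  Real.log_pos (by have : (0 : ℝ) < ((σ : ℝ) ^ 2)⁻¹ := by positivity
                   linarith)

/-- The sum of the posterior variances is bounded by the maximum information gain. -/
theorem sumPosteriorVar_le {k : X → X → ℝ} (hk : (Matrix.of k).PosSemidef)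
    (hk1 : ∀ x, k x x ≤ 1) {σ : ℝ≥0} (hσ : 0 < σ) (T : ℕ) (xs : Fin T → X) :
    sumPosteriorVar k σ T xs ≤ constC₁ σ * maxInfoGain k σ T := by
  have h1 := sumPosteriorVar_mul_le hk hk1 hσ T xs
  rw [← toReal_mutualInformation_outputValueLaw hk hσ] at h1
  have h2 : (mutualInformation (outputValueLaw k σ xs)).toReal ≤ maxInfoGain k σ T :=
    le_ciSup (f := fun xs : Fin T → X => (mutualInformation (outputValueLaw k σ xs)).toReal)
      (Set.finite_range _).bddAbove xs
  have hpos := log_one_add_inv_pos hσ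
  rw [constC₁, div_mul_eq_mul_div, le_div_iff₀ hpos]
  linarith

end InformationGain

/-! ### Gaussian tail and expected excess of the squared positive part. -/

section GaussianTail

/-- For `z, s ≥ 0` one has `(z + s)² ≥ z² + s²`, so the shifted density is at most `exp (-s²/2)`
times the original one, whose mass on the positive half-line is `1/2`. This `1/2` is the source of
the `|X| / 2` in `C₂`. -/
theorem gaussianReal_Ioi_le {s : ℝ} (hs : 0 ≤ s) :
    gaussianReal 0 1 (Set.Ioi s) ≤ ENNReal.ofReal (Real.exp (-s ^ 2 / 2) / 2) := by
  have hshift : gaussianReal 0 1 (Set.Ioi s) =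
      ∫⁻ z in Set.Ioi 0, gaussianPDF 0 1 (z + s) := by
    rw [gaussianReal_apply _ one_ne_zero]
    have h := (measurePreserving_add_right (volume : Measure ℝ) s).setLIntegral_comp_preimage
      (s := Set.Ioi s) measurableSet_Ioi (measurable_gaussianPDF 0 1)
    rw [← h]
    simp
  have hhalf : gaussianReal 0 1 (Set.Ioi 0) = ENNReal.ofReal (1 / 2) := by
    have hneg : gaussianReal 0 1 (Set.Iio 0) = gaussianReal 0 1 (Set.Ioi 0) := by
      have h := gaussianReal_map_neg (μ := 0) (v := 1)
      rw [neg_zero] at h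
      nth_rewrite 1 [← h]
      rw [Measure.map_apply measurable_neg measurableSet_Iio]
      simp
    have : NullSingletonClass (gaussianReal 0 1) := nullSingletonClass_gaussianReal one_ne_zero
    have hsum := measure_add_measure_compl (μ := gaussianReal 0 1)
        (measurableSet_Ioi (a := (0 : ℝ)))
    rw [Set.compl_Ioi, ← Iio_ae_eq_Iic.measure_eq, hneg, measure_univ] at hsum
    rw [one_div, ENNReal.ofReal_inv_of_pos two_pos, ENNReal.ofReal_ofNat]
    exact ENNReal.eq_inv_of_mul_eq_one_left (by rw [mul_two, hsum])
  have hle : ∀ z ∈ Set.Ioi (0 : ℝ), gaussianPDF 0 1 (z + s) ≤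
      ENNReal.ofReal (Real.exp (-s ^ 2 / 2)) * gaussianPDF 0 1 z := fun z hz => by
    have hz' : 0 < z := hz
    rw [gaussianPDF, gaussianPDF, ← ENNReal.ofReal_mul (Real.exp_pos _).le]
    refine ENNReal.ofReal_le_ofReal ?_
    rw [gaussianPDFReal, gaussianPDFReal, mul_left_comm, ← Real.exp_add]
    refine mul_le_mul_of_nonneg_left (Real.exp_le_exp.2 ?_) (by positivity)
    simp only [sub_zero, NNReal.coe_one, mul_one]
    nlinarith [mul_nonneg hz'.le hs]
  rw [hshift]
  refine (setLIntegral_mono' measurableSet_Ioi hle).trans_eq ?_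
  rw [lintegral_const_mul _ (measurable_gaussianPDF 0 1), ← gaussianReal_apply _ one_ne_zero, hhalf,
    ← ENNReal.ofReal_mul (Real.exp_pos _).le]
  congr 1
  ring

theorem lintegral_exp_neg_half_Ioi (c : ℝ) :
    ∫⁻ t in Set.Ioi c, ENNReal.ofReal (Real.exp (-t / 2) / 2) =
      ENNReal.ofReal (Real.exp (-c / 2)) := by
  have h1 : ∀ t, Real.exp (-t / 2) / 2 = Real.exp ((-1 / 2) * t) / 2 := fun t => by ring_nf
  simp_rw [h1]
  rw [← ofReal_integral_eq_lintegral_ofReal]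
  · rw [integral_div, integral_exp_mul_Ioi (by norm_num)]
    congr 1
    ring_nf
  · exact (integrableOn_exp_mul_Ioi (by norm_num) c).div_const _
  · exact Filter.Eventually.of_forall fun t => by positivity

/-- The excess of the squared positive part of a standard Gaussian variable over `c`. -/
theorem lintegral_sq_posPart_sub_le {c : ℝ} (hc : 0 ≤ c) :
    ∫⁻ z, ENNReal.ofReal ((max z 0) ^ 2 - c) ∂(gaussianReal 0 1) ≤
      ENNReal.ofReal (Real.exp (-c / 2)) := by
  have h1 : ∀ z : ℝ, ENNReal.ofReal ((max z 0) ^ 2 - c) =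
      ENNReal.ofReal (max ((max z 0) ^ 2 - c) 0) := fun z => by
    rw [ENNReal.ofReal_max, ENNReal.ofReal_zero, max_eq_left (zero_le (a := ENNReal.ofReal _))]
  simp_rw [h1]
  have hpp : Measurable fun z : ℝ => max ((max z 0) ^ 2 - c) 0 := by fun_prop
  -- Layer-cake formula: the excess is above `t > 0` only if the variable exceeds `√(t + c)`, which
  -- has probability at most `exp (-(t + c)/2) / 2`.
  have hlc := lintegral_eq_lintegral_meas_lt (gaussianReal 0 1)
      (f := fun z => max ((max z 0) ^ 2 - c) 0)
    (Filter.Eventually.of_forall fun z => le_max_right _ _) hpp.aemeasurable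
  rw [hlc, ← lintegral_exp_neg_half_Ioi]
  have hshift : ∫⁻ t in Set.Ioi c, ENNReal.ofReal (Real.exp (-t / 2) / 2) =
      ∫⁻ t in Set.Ioi 0, ENNReal.ofReal (Real.exp (-(t + c) / 2) / 2) := by
    have h := (measurePreserving_add_right (volume : Measure ℝ) c).setLIntegral_comp_preimage
      (s := Set.Ioi c) measurableSet_Ioi
      (f := fun t => ENNReal.ofReal (Real.exp (-t / 2) / 2)) (by fun_prop)
    rw [← h]
    simp
  rw [hshift]
  refine setLIntegral_mono' measurableSet_Ioi fun t ht => ?_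
  have ht' : 0 < t := ht
  have hsub : {z : ℝ | t < max ((max z 0) ^ 2 - c) 0} ⊆ Set.Ioi √(t + c) := fun z hz => by
    simp only [Set.mem_ofPred_eq, lt_max_iff, not_lt.2 ht'.le, or_false] at hz
    have h2 : t + c < (max z 0) ^ 2 := by linarith
    have h3 : √(t + c) < max z 0 := (Real.sqrt_lt' (by
      by_contra h
      have : max z 0 = 0 := le_antisymm (not_lt.1 h) (le_max_right _ _)
      rw [this] at h2
      nlinarith)).2 h2
    rcases lt_max_iff.1 h3 with h | h
    · exact h
    · exact absurd h (not_lt.2 (Real.sqrt_nonneg _))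
  refine (measure_mono hsub).trans ((gaussianReal_Ioi_le (Real.sqrt_nonneg _)).trans_eq ?_)
  rw [Real.sq_sqrt (by linarith)]

end GaussianTail

/-! ### An adaptive run as a weighted mixture of fixed designs. -/

section RunLaw

theorem sum_fin_succ_fun {X M : Type*} [Fintype X] [AddCommMonoid M] {t : ℕ}
    (G : (Fin t → X) → X → M) :
    ∑ xs : Fin (t + 1) → X, G (Fin.init xs) (xs (Fin.last t)) = ∑ xs, ∑ x, G xs x := by
  rw [← Fintype.sum_prod_type']
  exact Fintype.sum_bijective (fun xs : Fin (t + 1) → X => ((Fin.init xs : Fin t → X),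
    xs (Fin.last t))) ⟨fun a b h => by
      obtain ⟨h1, h2⟩ := Prod.ext_iff.1 h
      simp only at h1 h2
      rw [← Fin.snoc_init_self a, ← Fin.snoc_init_self b, h1, h2], fun r =>
          ⟨Fin.snoc r.1 r.2, by simp⟩⟩ _ _ fun _ => rfl

variable {X : Type*} [MeasurableSpace X]

/-- The conditional probability, given the random function and the noise, of selecting the inputs
in the data set. -/
noncomputable def pathWeight (R : ∀ t, Kernel (Dataset X t) X) : ∀ t, Dataset X t → ℝ≥0∞
  | 0, _ => 1
  | t + 1, D => pathWeight R t (Fin.init D) * R t (Fin.init D) {(D (Fin.last t)).1}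

variable [Fintype X] [MeasurableSingletonClass X]

theorem measurable_kernel_singleton {α : Type*} [MeasurableSpace α] (κ : Kernel α X) :
    Measurable fun p : α × X => κ p.1 {p.2} :=
  measurable_from_prod_countable_left fun x => κ.measurable_coe (measurableSet_singleton x)

theorem measurable_pathWeight (R : ∀ t, Kernel (Dataset X t) X) (t : ℕ) :
    Measurable (pathWeight R t) := by
  induction t with
  | zero => exact measurable_const
  | succ t ih =>
    have hinit : Measurable fun D : Dataset X (t + 1) => (Fin.init D : Dataset X t) := by
      unfold Fin.init; fun_prop
    have h : Measurable fun D : Dataset X (t + 1) =>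
        ((Fin.init D : Dataset X t), (D (Fin.last t)).1) :=
      hinit.prodMk (measurable_pi_apply (Fin.last t)).fst
    exact (ih.comp hinit).mul ((measurable_kernel_singleton (R t)).comp h)

theorem lintegral_roundKernel (σ : ℝ≥0) (t : ℕ) (R : Kernel (Dataset X t) X) [IsMarkovKernel R]
    {φ : X × ℝ → ℝ≥0∞} (hφ : Measurable φ) (p : (X → ℝ) × Dataset X t) :
    ∫⁻ z, φ z ∂(roundKernel σ t R p) =
      ∑ x, R p.2 {x} * ∫⁻ e, φ (x, p.1 x + e) ∂(gaussianReal 0 (σ ^ 2)) := by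
  have h1 : Measurable (fun r : ((X → ℝ) × Dataset X t) × (X × ℝ) => r.1.1 r.2.1) :=
    measurable_eval.comp
      (f := fun r : ((X → ℝ) × Dataset X t) × (X × ℝ) => (r.1.1, r.2.1)) (by fun_prop)
  have h2 : Measurable (fun r : ((X → ℝ) × Dataset X t) × (X × ℝ) =>
      (r.2.1, r.1.1 r.2.1 + r.2.2)) := by fun_prop
  have h3 : Measurable (fun r : X × ℝ => φ (r.1, p.1 r.1 + r.2)) :=
    hφ.comp (h2.comp (measurable_prodMk_left (x := p)))
  have h4 : Measurable (fun r : ((X → ℝ) × Dataset X t) × (X × ℝ) =>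
      φ (r.2.1, r.1.1 r.2.1 + r.2.2)) := hφ.comp h2
  rw [roundKernel, Kernel.lintegral_map _ h2 _ hφ, Kernel.prod_apply, Kernel.id_apply,
    Kernel.prod_apply, Kernel.comap_apply, Kernel.const_apply]
  refine (lintegral_prod _ h4.aemeasurable).trans ?_
  refine (lintegral_dirac' _ h4.lintegral_prod_right').trans ?_
  refine (lintegral_prod _ h3.aemeasurable).trans ?_
  rw [lintegral_fintype]
  exact Finset.sum_congr rfl fun x _ => mul_comm _ _

variable [DecidableEq X]

theorem zipData_snoc {X : Type*} {t : ℕ} (xs : Fin (t + 1) → X) (y : Fin t → ℝ) (z : ℝ) :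
    zipData xs (Fin.snoc y z : Fin (t + 1) → ℝ) =
      (Fin.snoc (zipData (Fin.init xs) y) (xs (Fin.last t), z) : Dataset X (t + 1)) := by
  funext i
  induction i using Fin.lastCases with
  | last => simp [zipData]
  | cast i => simp [zipData, Fin.init]

/-- The data set that results from evaluating at the inputs `xs`. -/
def designData {X ι : Type*} (xs : ι → X) (q : (X → ℝ) × (ι → ℝ)) : ι → X × ℝ :=
  zipData xs (noisyOutputs xs q)

theorem measurable_designData {X ι : Type*} [MeasurableSpace X] (xs : ι → X) :
    Measurable (designData xs) :=
  (measurable_zipData xs).comp (measurable_noisyOutputs xs)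

theorem designData_snoc {X : Type*} {t : ℕ} (xs : Fin (t + 1) → X) (f : X → ℝ) (e : Fin t → ℝ)
    (e' : ℝ) :
    designData xs (f, Fin.snoc e e') = (Fin.snoc (designData (Fin.init xs) (f, e))
      (xs (Fin.last t), f (xs (Fin.last t)) + e') : Dataset X (t + 1)) := by
  rw [designData, noisyOutputs_snoc, zipData_snoc]
  rfl

/-- The law of a run as a mixture over the selected inputs. -/
theorem lintegral_runLaw (k : X → X → ℝ) (σ : ℝ≥0) (R : ∀ t, Kernel (Dataset X t) X)
    (hR : ∀ t, IsMarkovKernel (R t)) (t : ℕ) {φ : (X → ℝ) × Dataset X t → ℝ≥0∞}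
    (hφ : Measurable φ) :
    ∫⁻ p, φ p ∂(runLaw k σ R t) =
      ∑ xs : Fin t → X, ∫⁻ q, pathWeight R t (designData xs q) * φ (q.1, designData xs q)
        ∂(priorNoise k σ (Fin t)) := by
  induction t with
  | zero =>
    rw [runLaw, lintegral_map hφ (by fun_prop)]
    simp only [Finset.univ_unique, Finset.sum_singleton, pathWeight, one_mul]
    have h : (priorNoise k σ (Fin 0)).map Prod.fst = gpPrior k := by simp [priorNoise]
    have hf : Measurable fun f : X → ℝ => φ (f, Fin.elim0) := hφ.comp (by fun_prop)
    rw [← h, lintegral_map hf measurable_fst]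
    refine lintegral_congr fun q => ?_
    congr 2
    exact Subsingleton.elim _ _
  | succ t ih =>
    have := hR t
    have hprob := isProbabilityMeasure_runLaw k σ R hR t
    have hmark := isMarkovKernel_roundKernel σ t (R t)
    have hs := measurable_snocData (X := X) t
    set g := gaussianReal 0 (σ ^ 2) with hg
    set Ψ : X → ((X → ℝ) × Dataset X t) × ℝ → ℝ≥0∞ := fun x r =>
      φ (r.1.1, (Fin.snoc r.1.2 (x, r.1.1 x + r.2) : Dataset X (t + 1))) with hΨ
    have hΨm : ∀ x, Measurable (Ψ x) := fun x => by
      have h1 : Measurable fun r : ((X → ℝ) × Dataset X t) × ℝ => (r.1, (x, r.1.1 x + r.2)) := by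
        fun_prop
      exact hφ.comp (hs.comp h1)
    have hin : Measurable fun p : (X → ℝ) × Dataset X t => ∑ x, R t p.2 {x} * ∫⁻ e, Ψ x (p, e)
        ∂g := by
      refine Finset.measurable_sum _ fun x _ => Measurable.mul ?_ (hΨm x).lintegral_prod_right'
      exact ((R t).measurable_coe (measurableSet_singleton x)).comp measurable_snd
    have e1 : ∫⁻ p, φ p ∂(runLaw k σ R (t + 1)) =
        ∫⁻ p, ∑ x, R t p.2 {x} * ∫⁻ e, Ψ x (p, e) ∂g ∂(runLaw k σ R t) := by
      rw [runLaw, lintegral_map hφ hs]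
      refine (Measure.lintegral_compProd (hφ.comp hs)).trans ?_
      refine lintegral_congr fun p => ?_
      have hp : Measurable fun z : X × ℝ => φ (p.1, (Fin.snoc p.2 z : Dataset X (t + 1))) := by
        have hz : Measurable fun z : X × ℝ => (p, z) := measurable_prodMk_left
        have := (hφ.comp hs).comp hz
        exact this
      exact lintegral_roundKernel σ t (R t) hp p
    rw [e1, ih hin]
    -- The path weight at `t + 1` does not involve the last output, so the noise of the last round
    -- can be integrated first.
    have e2 : ∀ xs : Fin (t + 1) → X,
        ∫⁻ q, pathWeight R (t + 1) (designData xs q) * φ (q.1, designData xs q)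
          ∂(priorNoise k σ (Fin (t + 1))) =
        ∫⁻ q, pathWeight R t (designData (Fin.init xs) q) *
          (R t (designData (Fin.init xs) q) {xs (Fin.last t)} *
            ∫⁻ e, Ψ (xs (Fin.last t)) ((q.1, designData (Fin.init xs) q), e) ∂g)
          ∂(priorNoise k σ (Fin t)) := fun xs => by
      have hm : Measurable fun q : (X → ℝ) × (Fin (t + 1) → ℝ) =>
          pathWeight R (t + 1) (designData xs q) * φ (q.1, designData xs q) :=
        ((measurable_pathWeight R (t + 1)).comp (measurable_designData xs)).mul
          (hφ.comp (measurable_fst.prodMk (measurable_designData xs)))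
      have hs' : Measurable fun r : ((X → ℝ) × (Fin t → ℝ)) × ℝ =>
          (r.1.1, (Fin.snoc r.1.2 r.2 : Fin (t + 1) → ℝ)) :=
        measurable_fst.fst.prodMk
          (measurable_snoc_real.comp (measurable_fst.snd.prodMk measurable_snd))
      have hms := hm.comp hs'
      rw [← priorNoise_succ, lintegral_map hm hs']
      refine (lintegral_prod _ hms.aemeasurable).trans (lintegral_congr fun q => ?_)
      have hΨe : Measurable fun e : ℝ =>
          Ψ (xs (Fin.last t)) ((q.1, designData (Fin.init xs) q), e) :=
        (hΨm _).comp measurable_prodMk_left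
      rw [← mul_assoc]
      refine Eq.trans ?_ (lintegral_const_mul _ hΨe)
      refine lintegral_congr fun e => ?_
      simp only [Function.comp_apply, pathWeight, hΨ, designData_snoc, Fin.init_snoc,
        Fin.snoc_last]
    simp_rw [e2]
    have e3 := sum_fin_succ_fun (fun (xs : Fin t → X) x =>
      ∫⁻ q, pathWeight R t (designData xs q) * (R t (designData xs q) {x} *
        ∫⁻ e, Ψ x ((q.1, designData xs q), e) ∂g) ∂(priorNoise k σ (Fin t)))
    refine Eq.trans ?_ e3.symm
    refine Finset.sum_congr rfl fun xs _ => ?_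
    rw [← lintegral_finsetSum _ fun x _ => ?_]
    · simp_rw [Finset.mul_sum]
    · have hd := measurable_designData (ι := Fin t) xs
      refine ((measurable_pathWeight R t).comp hd).mul (Measurable.mul ?_ ?_)
      · exact ((R t).measurable_coe (measurableSet_singleton x)).comp hd
      · exact (hΨm x).lintegral_prod_right'.comp (measurable_fst.prodMk hd)

end RunLaw

/-! ### The posterior law of the function during an adaptive run. -/

section Posterior

variable {X : Type*} [Fintype X] [DecidableEq X] [MeasurableSpace X] [MeasurableSingletonClass X]

theorem measurable_lintegral_posterior_data {t : ℕ} (k : X → X → ℝ) {σ : ℝ≥0} (hσ : 0 < σ)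
    {φ : (X → ℝ) × Dataset X t → ℝ≥0∞} (hφ : Measurable φ) :
    Measurable fun D : Dataset X t => ∫⁻ g, φ (g, D) ∂(posterior k σ D) := by
  have := isMarkovKernel_posterior (ι := Fin t) k σ hσ
  have h : Measurable (Function.uncurry fun (D : Dataset X t) g => φ (g, D)) :=
    hφ.comp measurable_swap
  exact h.lintegral_kernel_prod_right

/-- During a run, the random function given the data has the posterior distribution. -/
theorem lintegral_runLaw_eq_posterior (k : X → X → ℝ) {σ : ℝ≥0} (hσ : 0 < σ)
    (R : ∀ t, Kernel (Dataset X t) X) (hR : ∀ t, IsMarkovKernel (R t)) (t : ℕ)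
    {φ : (X → ℝ) × Dataset X t → ℝ≥0∞} (hφ : Measurable φ) :
    ∫⁻ p, φ p ∂(runLaw k σ R t) =
      ∫⁻ p, ∫⁻ g, φ (g, p.2) ∂(posterior k σ p.2) ∂(runLaw k σ R t) := by
  have hp : Measurable fun p : (X → ℝ) × Dataset X t => ∫⁻ g, φ (g, p.2) ∂(posterior k σ p.2) :=
    (measurable_lintegral_posterior_data k hσ hφ).comp measurable_snd
  rw [lintegral_runLaw k σ R hR t hφ, lintegral_runLaw k σ R hR t hp]
  refine Finset.sum_congr rfl fun xs _ => ?_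
  have hz : Measurable fun q : (X → ℝ) × (Fin t → ℝ) => zipData xs q.2 :=
    (measurable_zipData xs).comp measurable_snd
  -- The selection probabilities depend on `f` only through the data. They can therefore be absorbed
  -- into the test function, and the fixed-design Bayes rule applies.
  have hΦ : Measurable fun q : (X → ℝ) × (Fin t → ℝ) =>
      pathWeight R t (zipData xs q.2) * φ (q.1, zipData xs q.2) :=
    ((measurable_pathWeight R t).comp hz).mul (hφ.comp (measurable_fst.prodMk hz))
  refine (lintegral_priorNoise_eq_posterior k hσ xs hΦ).trans (lintegral_congr fun q => ?_)
  have hg : Measurable fun g : X → ℝ => φ (g, designData xs q) := hφ.comp (by fun_prop)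
  exact lintegral_const_mul (pathWeight R t (designData xs q)) hg

end Posterior

/-! ### Invariance under changes of pending outputs, and resampling during a run. -/

section Agreement

variable {X : Type*}

/-- Two data sets have the same inputs and agree in the outputs with indices in `N`. -/
def AgreeOn (N : Finset ℕ) {t : ℕ} (D D' : Dataset X t) : Prop :=
  ∀ i, (D i).1 = (D' i).1 ∧ ((i : ℕ) ∈ N → D i = D' i)

theorem AgreeOn.init {N N' : Finset ℕ} (h : N ⊆ N') {t : ℕ} {D D' : Dataset X (t + 1)}
    (hD : AgreeOn N' D D') : AgreeOn N (Fin.init D : Dataset X t) (Fin.init D') := fun i =>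
  ⟨(hD i.castSucc).1, fun hi => (hD i.castSucc).2 (h (by simpa using hi))⟩

theorem AgreeOn.observedPart_eq {N : Finset ℕ} {t : ℕ} {D D' : Dataset X t}
    (hD : AgreeOn N D D') : observedPart N D = observedPart N D' :=
  funext fun i => (hD i.1).2 i.2

theorem AgreeOn.impute_eq {N : Finset ℕ} {t : ℕ} {D D' : Dataset X t}
    (hD : AgreeOn N D D') (r : (X → ℝ) × (Fin t → ℝ)) : impute N (D, r) = impute N (D', r) := by
  funext i
  by_cases h : (i : ℕ) ∈ N
  · simp only [impute, h, if_true]; exact (hD i).2 h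
  · simp only [impute, h, if_false, (hD i).1]

theorem agreeOn_impute (N : Finset ℕ) {t : ℕ} (D : Dataset X t) (r : (X → ℝ) × (Fin t → ℝ)) :
    AgreeOn N D (impute N (D, r)) := fun i => by
  by_cases h : (i : ℕ) ∈ N <;> simp [impute, h]

theorem agreeOn_zipData {N : Finset ℕ} {t : ℕ} (xs : Fin t → X) {y y' : Fin t → ℝ}
    (h : ∀ i : Fin t, (i : ℕ) ∈ N → y i = y' i) : AgreeOn N (zipData xs y) (zipData xs y') :=
  fun i => ⟨rfl, fun hi => by simp [zipData, h i hi]⟩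

variable [Fintype X] [DecidableEq X] [MeasurableSpace X] [MeasurableSingletonClass X]

theorem imputedData_apply (k : X → X → ℝ) {σ : ℝ≥0} (hσ : 0 < σ) (N : Finset ℕ) {t : ℕ}
    (D : Dataset X t) :
    imputedData k σ N t D = ((posterior k σ (observedPart N D)).prod (noiseVec σ t)).map
      fun r => impute N (D, r) := by
  have := isMarkovKernel_posterior (ι := {i : Fin t // (i : ℕ) ∈ N}) k σ hσ
  rw [imputedData, Kernel.map_apply _ (measurable_impute N), Kernel.prod_apply, Kernel.id_apply,
    Kernel.prod_apply, Kernel.comap_apply, Kernel.const_apply, Measure.dirac_prod,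
    Measure.map_map (measurable_impute N) measurable_prodMk_left]
  rfl

theorem lintegral_imputedData (k : X → X → ℝ) {σ : ℝ≥0} (hσ : 0 < σ) (N : Finset ℕ) {t : ℕ}
    (D : Dataset X t) {φ : Dataset X t → ℝ≥0∞} (hφ : Measurable φ) :
    ∫⁻ D', φ D' ∂(imputedData k σ N t D) = ∫⁻ g, ∫⁻ e, φ (impute N (D, (g, e))) ∂(noiseVec σ t)
      ∂(posterior k σ (observedPart N D)) := by
  have hm : Measurable fun r : (X → ℝ) × (Fin t → ℝ) => impute N (D, r) :=
    (measurable_impute N).comp measurable_prodMk_left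
  rw [imputedData_apply k hσ, lintegral_map hφ hm]
  exact lintegral_prod _ (hφ.comp hm).aemeasurable

variable {S : Type*} [MeasurableSpace S]

theorem AgreeOn.rkbQuery_eq {k : X → X → ℝ} {σ : ℝ≥0} (hσ : 0 < σ) {N : ℕ → Finset ℕ}
    (A : BOAlgorithm X S) {t : ℕ} {D D' : Dataset X t} (hD : AgreeOn (N t) D D') :
    rkbQuery k σ N A t D = rkbQuery k σ N A t D' := by
  have h : imputedData k σ (N t) t D = imputedData k σ (N t) t D' := by
    rw [imputedData_apply k hσ, imputedData_apply k hσ, hD.observedPart_eq]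
    simp_rw [hD.impute_eq]
  rw [rkbQuery, Kernel.comp_apply, Kernel.comp_apply, h]

/-- Each earlier query used only outputs available at its time. By monotonicity these are all in `N
t`, so pending outputs have no influence on the path weight. -/
theorem AgreeOn.pathWeight_eq {k : X → X → ℝ} {σ : ℝ≥0} (hσ : 0 < σ) {N : ℕ → Finset ℕ}
    (hmono : Monotone N) (A : BOAlgorithm X S) {t : ℕ} {D D' : Dataset X t}
    (hD : AgreeOn (N t) D D') :
    pathWeight (rkbQuery k σ N A) t D = pathWeight (rkbQuery k σ N A) t D' := by
  induction t with
  | zero => rfl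
  | succ t ih =>
    have h := hD.init (hmono t.le_succ)
    rw [pathWeight, pathWeight, ih h, h.rkbQuery_eq hσ A, (hD (Fin.last t)).1]

/-- Resampling the function from the posterior given the available outputs, and the pending outputs
from this function, does not change the law of a run. -/
theorem lintegral_runLaw_resample (k : X → X → ℝ) {σ : ℝ≥0} (hσ : 0 < σ) {N : ℕ → Finset ℕ}
    (hmono : Monotone N) (A : BOAlgorithm X S) (t : ℕ) {φ : (X → ℝ) × Dataset X t → ℝ≥0∞}
    (hφ : Measurable φ) :
    ∫⁻ p, φ p ∂(runLaw k σ (rkbQuery k σ N A) t) =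
      ∫⁻ p, ∫⁻ g, ∫⁻ e, φ (g, impute (N t) (p.2, (g, e))) ∂(noiseVec σ t)
        ∂(posterior k σ (observedPart (N t) p.2)) ∂(runLaw k σ (rkbQuery k σ N A) t) := by
  have hR := isMarkovKernel_rkbQuery k σ hσ N A
  set R := rkbQuery k σ N A with hRdef
  have hpost := isMarkovKernel_posterior (ι := {i : Fin t // (i : ℕ) ∈ N t}) k σ hσ
  have him : Measurable fun r : (Dataset X t × (X → ℝ)) × (Fin t → ℝ) =>
      φ (r.1.2, impute (N t) (r.1.1, (r.1.2, r.2))) :=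
    hφ.comp (measurable_fst.snd.prodMk ((measurable_impute (N t)).comp
      (measurable_fst.fst.prodMk (measurable_fst.snd.prodMk measurable_snd))))
  have hΨ : Measurable fun p : (X → ℝ) × Dataset X t =>
      ∫⁻ g, ∫⁻ e, φ (g, impute (N t) (p.2, (g, e))) ∂(noiseVec σ t)
        ∂(posterior k σ (observedPart (N t) p.2)) := by
    have h := him.lintegral_prod_right' (ν := noiseVec σ t)
    have h2 := h.lintegral_kernel_prod_right'
      (κ := (posterior k σ).comap (observedPart (N t)) (measurable_observedPart (N t)))
    exact h2.comp measurable_snd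
  rw [lintegral_runLaw k σ R hR t hφ, lintegral_runLaw k σ R hR t hΨ]
  refine Finset.sum_congr rfl fun xs _ => ?_
  have hz : Measurable fun q : (X → ℝ) × (Fin t → ℝ) => zipData xs q.2 :=
    (measurable_zipData xs).comp measurable_snd
  have hΦ : Measurable fun q : (X → ℝ) × (Fin t → ℝ) =>
      pathWeight R t (zipData xs q.2) * φ (q.1, zipData xs q.2) :=
    ((measurable_pathWeight R t).comp hz).mul (hφ.comp (measurable_fst.prodMk hz))
  refine (lintegral_priorNoise_resample k hσ (fun i : Fin t => (i : ℕ) ∈ N t) xs hΦ).trans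
    (lintegral_congr fun q => ?_)
  -- The path weight is the same for the actual and the imputed outputs, so it factors out of the
  -- resampling integrals.
  have hpw : ∀ (g : X → ℝ) (e : Fin t → ℝ), pathWeight R t
      (zipData xs fun i => if (i : ℕ) ∈ N t then noisyOutputs xs q i
      else g (xs i) + e i) = pathWeight R t (designData xs q) := fun g e =>
    (AgreeOn.pathWeight_eq hσ hmono A (agreeOn_zipData xs fun i hi => by simp [hi]))
  have him2 : ∀ (g : X → ℝ) (e : Fin t → ℝ),
      (zipData xs fun i => if (i : ℕ) ∈ N t then noisyOutputs xs q i
      else g (xs i) + e i) = impute (N t) (designData xs q, (g, e)) := fun g e => by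
    funext i
    by_cases h : (i : ℕ) ∈ N t <;> simp [zipData, impute, designData, h]
  simp_rw [hpw, him2]
  have hq1 : ∀ g, Measurable fun e => φ (g, impute (N t) (designData xs q, (g, e))) := fun g =>
    him.comp (measurable_prodMk_left (x := (designData xs q, g)))
  have hq2 : Measurable fun g => ∫⁻ e, φ (g, impute (N t) (designData xs q, (g, e)))
      ∂(noiseVec σ t) :=
    (him.lintegral_prod_right' (ν := noiseVec σ t)).comp
      (measurable_prodMk_left (x := designData xs q))
  refine Eq.trans ?_ (lintegral_const_mul _ hq2)
  exact lintegral_congr fun g => lintegral_const_mul _ (hq1 g)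

theorem rkbQuery_singleton (k : X → X → ℝ) {σ : ℝ≥0} (hσ : 0 < σ) (N : ℕ → Finset ℕ)
    (A : BOAlgorithm X S) {t : ℕ} (D : Dataset X t) (x : X) :
    rkbQuery k σ N A t D {x} = ∫⁻ g, ∫⁻ e, A.queryKernel t (impute (N t) (D, (g, e))) {x}
      ∂(noiseVec σ t) ∂(posterior k σ (observedPart (N t) D)) := by
  rw [rkbQuery, Kernel.comp_apply' _ _ _ (measurableSet_singleton x)]
  exact lintegral_imputedData k hσ (N t) D
    ((A.queryKernel t).measurable_coe (measurableSet_singleton x))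

/-- For quantities that do not depend on the pending outputs, the input selected from the imputed
data can be replaced by the input which the base algorithm selects from the full data. -/
theorem lintegral_rkbQuery_eq_queryKernel (k : X → X → ℝ) {σ : ℝ≥0} (hσ : 0 < σ)
    {N : ℕ → Finset ℕ} (hmono : Monotone N) (A : BOAlgorithm X S) (t : ℕ) (x : X)
    {φ : Dataset X t → ℝ≥0∞} (hφ : Measurable φ) (hag : ∀ D D', AgreeOn (N t) D D' → φ D = φ D') :
    ∫⁻ p, rkbQuery k σ N A t p.2 {x} * φ p.2 ∂(runLaw k σ (rkbQuery k σ N A) t) =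
      ∫⁻ p, A.queryKernel t p.2 {x} * φ p.2 ∂(runLaw k σ (rkbQuery k σ N A) t) := by
  have hA : Measurable fun D : Dataset X t => A.queryKernel t D {x} :=
    (A.queryKernel t).measurable_coe (measurableSet_singleton x)
  have hm : Measurable fun p : (X → ℝ) × Dataset X t => A.queryKernel t p.2 {x} * φ p.2 :=
    (hA.mul hφ).comp measurable_snd
  -- Resampling on the right replaces the actual data by imputed data. Averaging the base query over
  -- the imputation is the definition of `rkbQuery`, and `φ` does not notice the change.
  rw [lintegral_runLaw_resample k hσ hmono A t hm]
  refine lintegral_congr fun p => ?_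
  have hag' : ∀ g e, φ (impute (N t) (p.2, (g, e))) = φ p.2 := fun g e =>
    (hag _ _ (agreeOn_impute (N t) p.2 (g, e))).symm
  have hi : Measurable fun r : (X → ℝ) × (Fin t → ℝ) =>
      A.queryKernel t (impute (N t) (p.2, (r.1, r.2))) {x} :=
    hA.comp ((measurable_impute (N t)).comp measurable_prodMk_left)
  simp_rw [hag']
  rw [rkbQuery_singleton k hσ]
  refine (lintegral_mul_const _ hi.lintegral_prod_right').symm.trans (lintegral_congr fun g => ?_)
  exact (lintegral_mul_const _ (hi.comp measurable_prodMk_left)).symm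

end Agreement

/-! ### The residual given the available outputs, during a run. -/

section ResidualOfRun

variable {X : Type*}

/-- The posterior mean at `x` given the part of the data with indices in `N`. -/
noncomputable def observedMean (k : X → X → ℝ) (σ : ℝ≥0) (N : Finset ℕ) {t : ℕ} (D : Dataset X t)
    (x : X) : ℝ :=
  posteriorMean k σ (fun i : {i : Fin t // (i : ℕ) ∈ N} => (D i).1) x fun i => (D i).2

/-- The posterior variance at `x` given the part of the data with indices in `N`. -/
noncomputable def observedVar (k : X → X → ℝ) (σ : ℝ≥0) (N : Finset ℕ) {t : ℕ} (D : Dataset X t)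
    (x : X) : ℝ :=
  posteriorVar k σ (fun i : {i : Fin t // (i : ℕ) ∈ N} => (D i).1) x

theorem AgreeOn.observedMean_eq {k : X → X → ℝ} {σ : ℝ≥0} {N : Finset ℕ} {t : ℕ}
    {D D' : Dataset X t} (hD : AgreeOn N D D') (x : X) :
    observedMean k σ N D x = observedMean k σ N D' x := by
  have h := hD.observedPart_eq
  have h1 : (fun i : {i : Fin t // (i : ℕ) ∈ N} => (D i).1) =
      fun i : {i : Fin t // (i : ℕ) ∈ N} => (D' i).1 :=
    funext fun i => congrArg Prod.fst (congrFun h i)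
  have h2 : (fun i : {i : Fin t // (i : ℕ) ∈ N} => (D i).2) =
      fun i : {i : Fin t // (i : ℕ) ∈ N} => (D' i).2 :=
    funext fun i => congrArg Prod.snd (congrFun h i)
  rw [observedMean, observedMean, h1, h2]

theorem AgreeOn.inputs_eq {N : Finset ℕ} {t : ℕ} {D D' : Dataset X t} (hD : AgreeOn N D D') :
    (fun i => (D i).1) = fun i => (D' i).1 := funext fun i => (hD i).1

variable [Fintype X] [MeasurableSpace X] [MeasurableSingletonClass X]

theorem measurable_observedMean (k : X → X → ℝ) (σ : ℝ≥0) (N : Finset ℕ) {t : ℕ} (x : X) :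
    Measurable fun D : Dataset X t => observedMean k σ N D x := by
  have h : Measurable fun r : ({i : Fin t // (i : ℕ) ∈ N} → ℝ) × ({i : Fin t // (i : ℕ) ∈ N} → X) =>
      posteriorMean k σ r.2 x r.1 := by
    refine measurable_from_prod_countable_left fun xs => ?_
    have := measurable_posteriorMean k σ xs x
    exact this
  have h2 : Measurable fun D : Dataset X t =>
      ((fun i : {i : Fin t // (i : ℕ) ∈ N} => (D i).2), fun i : {i : Fin t // (i : ℕ) ∈ N} =>
        (D i).1) := by fun_prop
  have := h.comp h2
  exact this

theorem measurable_observedVar (k : X → X → ℝ) (σ : ℝ≥0) (N : Finset ℕ) {t : ℕ} (x : X) :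
    Measurable fun D : Dataset X t => observedVar k σ N D x := by
  have h : Measurable fun xs : {i : Fin t // (i : ℕ) ∈ N} → X => posteriorVar k σ xs x :=
    measurable_of_countable _
  have h2 : Measurable fun (D : Dataset X t) (i : {i : Fin t // (i : ℕ) ∈ N}) => (D i).1 := by
    fun_prop
  exact h.comp h2

theorem measurable_posteriorVar_inputs (k : X → X → ℝ) (σ : ℝ≥0) {t : ℕ} (x : X) :
    Measurable fun D : Dataset X t => posteriorVar k σ (fun i => (D i).1) x := by
  have h : Measurable fun xs : Fin t → X => posteriorVar k σ xs x := measurable_of_countable _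
  have h2 : Measurable fun (D : Dataset X t) (i : Fin t) => (D i).1 := by fun_prop
  exact h.comp h2

theorem measurable_lintegral_gaussianReal_observedVar (k : X → X → ℝ) (σ : ℝ≥0) (N : Finset ℕ)
    {t : ℕ} (x : X) (ψ : ℝ → ℝ → ℝ≥0∞) :
    Measurable fun D : Dataset X t => ∫⁻ z, ψ (observedVar k σ N D x) z
      ∂(gaussianReal 0 (observedVar k σ N D x).toNNReal) := by
  have h : Measurable fun xs : {i : Fin t // (i : ℕ) ∈ N} → X =>
      ∫⁻ z, ψ (posteriorVar k σ xs x) z ∂(gaussianReal 0 (posteriorVar k σ xs x).toNNReal) :=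
    measurable_of_countable _
  have h2 : Measurable fun (D : Dataset X t) (i : {i : Fin t // (i : ℕ) ∈ N}) => (D i).1 := by
    fun_prop
  exact h.comp h2

/-- During a run, the error of the posterior mean given the available outputs is centred Gaussian,
also conditionally on all inputs and on the available outputs. -/
theorem lintegral_runLaw_residual [DecidableEq X] {S : Type*} [MeasurableSpace S] {k : X → X → ℝ}
    (hk : (Matrix.of k).PosSemidef) {σ : ℝ≥0}
    (hσ : 0 < σ) {N : ℕ → Finset ℕ} (hmono : Monotone N) (A : BOAlgorithm X S) (t : ℕ) (x : X)
    {c : Dataset X t → ℝ≥0∞} (hc : Measurable c) (hag : ∀ D D', AgreeOn (N t) D D' → c D = c D')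
    {ψ : ℝ → ℝ → ℝ≥0∞} (hψ : Measurable (Function.uncurry ψ)) :
    ∫⁻ p, c p.2 * ψ (observedVar k σ (N t) p.2 x) (p.1 x - observedMean k σ (N t) p.2 x)
        ∂(runLaw k σ (rkbQuery k σ N A) t) =
      ∫⁻ p, c p.2 * ∫⁻ z, ψ (observedVar k σ (N t) p.2 x) z
        ∂(gaussianReal 0 (observedVar k σ (N t) p.2 x).toNNReal)
        ∂(runLaw k σ (rkbQuery k σ N A) t) := by
  have hR := isMarkovKernel_rkbQuery k σ hσ N A
  have hpair : Measurable fun p : (X → ℝ) × Dataset X t =>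
      (observedVar k σ (N t) p.2 x, p.1 x - observedMean k σ (N t) p.2 x) :=
    ((measurable_observedVar k σ (N t) x).comp measurable_snd).prodMk
      (((measurable_pi_apply x).comp measurable_fst).sub
        ((measurable_observedMean k σ (N t) x).comp measurable_snd))
  have hm1 : Measurable fun p : (X → ℝ) × Dataset X t =>
      c p.2 * ψ (observedVar k σ (N t) p.2 x) (p.1 x - observedMean k σ (N t) p.2 x) :=
    (hc.comp measurable_snd).mul (hψ.comp hpair)
  have hm2 : Measurable fun p : (X → ℝ) × Dataset X t =>
      c p.2 * ∫⁻ z, ψ (observedVar k σ (N t) p.2 x) z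
        ∂(gaussianReal 0 (observedVar k σ (N t) p.2 x).toNNReal) :=
    (hc.mul (measurable_lintegral_gaussianReal_observedVar k σ (N t) x ψ)).comp measurable_snd
  rw [lintegral_runLaw k σ _ hR t hm1, lintegral_runLaw k σ _ hR t hm2]
  refine Finset.sum_congr rfl fun xs _ => ?_
  set ext : ({i : Fin t // (i : ℕ) ∈ N t} → ℝ) → Fin t → ℝ :=
    fun v i => if h : (i : ℕ) ∈ N t then v ⟨i, h⟩ else 0 with hext
  have hextm : Measurable ext := by
    refine measurable_pi_lambda _ fun i => ?_
    by_cases h : (i : ℕ) ∈ N t <;> simp only [hext, h, dite_true, dite_false] <;> fun_prop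
  set ρ : (X → ℝ) × (Fin t → ℝ) → (X → ℝ) × ({i : Fin t // (i : ℕ) ∈ N t} → ℝ) :=
    fun q => (q.1, fun i => q.2 i) with hρ
  have hρm : Measurable ρ := by fun_prop
  set xs' : {i : Fin t // (i : ℕ) ∈ N t} → X := fun i => xs i with hxs'
  -- For fixed inputs, the path weight and `c` are functions of the available outputs alone,
  -- evaluated here after padding by `0`. The residual is independent of these outputs.
  set C : ({i : Fin t // (i : ℕ) ∈ N t} → ℝ) → ℝ≥0∞ := fun v =>
    pathWeight (rkbQuery k σ N A) t (zipData xs (ext v)) * c (zipData xs (ext v)) with hC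
  have hzm : Measurable fun v => zipData xs (ext v) := (measurable_zipData xs).comp hextm
  have hCm : Measurable C := ((measurable_pathWeight _ t).comp hzm).mul (hc.comp hzm)
  have hCq : ∀ q, C (noisyOutputs xs' (ρ q)) =
      pathWeight (rkbQuery k σ N A) t (designData xs q) * c (designData xs q) := fun q => by
    have h : AgreeOn (N t) (zipData xs (ext (noisyOutputs xs' (ρ q)))) (designData xs q) :=
      agreeOn_zipData xs fun i hi => by simp [hext, hi, noisyOutputs, hρ, hxs']
    rw [hC, ← h.pathWeight_eq hσ hmono A, ← hag _ _ h]
  set V := posteriorVar k σ xs' x with hV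
  have hψV : Measurable (ψ V) := hψ.comp measurable_prodMk_left
  have e1 : ∀ q, pathWeight (rkbQuery k σ N A) t (designData xs q) *
      (c (designData xs q) * ψ (observedVar k σ (N t) (designData xs q) x)
        (q.1 x - observedMean k σ (N t) (designData xs q) x)) =
      C (noisyOutputs xs' (ρ q)) * ψ V (residual k σ xs' x (ρ q)) := fun q => by
    rw [hCq, mul_assoc]
    rfl
  have e2 : ∀ q, pathWeight (rkbQuery k σ N A) t (designData xs q) *
      (c (designData xs q) * ∫⁻ z, ψ (observedVar k σ (N t) (designData xs q) x) z
        ∂(gaussianReal 0 (observedVar k σ (N t) (designData xs q) x).toNNReal)) =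
      C (noisyOutputs xs' (ρ q)) * ∫⁻ z, ψ V z ∂(gaussianReal 0 V.toNNReal) := fun q => by
    rw [hCq, mul_assoc]
    rfl
  simp_rw [e1, e2]
  have hCo : Measurable fun r => C (noisyOutputs xs' r) := hCm.comp (measurable_noisyOutputs xs')
  have hψr : Measurable fun r => ψ V (residual k σ xs' x r) :=
    hψV.comp (measurable_residual k σ xs' x)
  have h1 := lintegral_map (μ := priorNoise k σ (Fin t))
    (f := fun r => C (noisyOutputs xs' r) * ψ V (residual k σ xs' x r)) (g := ρ)
    (hCo.mul hψr) hρm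
  have h2 := lintegral_map (μ := priorNoise k σ (Fin t))
    (f := fun r => C (noisyOutputs xs' r)) (g := ρ) hCo hρm
  have hCρ : Measurable fun q => C (noisyOutputs xs' (ρ q)) := hCo.comp hρm
  rw [← h1, lintegral_mul_const _ hCρ, ← h2, map_restrict_priorNoise,
    lintegral_mul_eq_lintegral_mul_lintegral_of_indepFun'' hCo.aemeasurable hψr.aemeasurable
      ((indepFun_residual_outputs hk hσ xs' x).symm.comp hCm hψV),
    ← map_residual hk hσ, lintegral_map hψV (by fun_prop)]

end ResidualOfRun

/-! ### Passing from one round to the next. -/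

section Step

variable {X : Type*} [Fintype X] [DecidableEq X] [MeasurableSpace X] [MeasurableSingletonClass X]

theorem lintegral_runLaw_succ (k : X → X → ℝ) (σ : ℝ≥0) (R : ∀ t, Kernel (Dataset X t) X)
    (hR : ∀ t, IsMarkovKernel (R t)) (t : ℕ) {φ : ((X → ℝ) × Dataset X t) × X → ℝ≥0∞}
    (hφ : Measurable φ) :
    ∫⁻ p, φ ((p.1, Fin.init p.2), (p.2 (Fin.last t)).1) ∂(runLaw k σ R (t + 1)) =
      ∫⁻ p, ∑ x, R t p.2 {x} * φ (p, x) ∂(runLaw k σ R t) := by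
  have := hR t
  have hprob := isProbabilityMeasure_runLaw k σ R hR t
  have hmark := isMarkovKernel_roundKernel σ t (R t)
  have hs := measurable_snocData (X := X) t
  have hinit : Measurable fun D : Dataset X (t + 1) => (Fin.init D : Dataset X t) := by
    unfold Fin.init; fun_prop
  have hm : Measurable fun p : (X → ℝ) × Dataset X (t + 1) =>
      φ ((p.1, Fin.init p.2), (p.2 (Fin.last t)).1) :=
    hφ.comp ((measurable_fst.prodMk (hinit.comp measurable_snd)).prodMk
      ((measurable_pi_apply (Fin.last t)).comp measurable_snd).fst)
  rw [runLaw, lintegral_map hm hs]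
  refine (Measure.lintegral_compProd (hm.comp hs)).trans (lintegral_congr fun p => ?_)
  have hz : Measurable fun z : X × ℝ => φ (p, z.1) := hφ.comp (by fun_prop)
  have h := lintegral_roundKernel σ t (R t) hz p
  simp only [lintegral_const, measure_univ, mul_one] at h
  rw [← h]
  refine lintegral_congr fun z => ?_
  simp

theorem sum_kernel_singleton {X α : Type*} [Fintype X] [MeasurableSpace X]
    [MeasurableSingletonClass X] [MeasurableSpace α] (κ : Kernel α X) [IsMarkovKernel κ] (a : α) :
    ∑ x, κ a {x} = 1 := by
  simp

theorem lintegral_runLaw_fst (k : X → X → ℝ) (σ : ℝ≥0) (R : ∀ t, Kernel (Dataset X t) X)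
    (hR : ∀ t, IsMarkovKernel (R t)) (t : ℕ) {φ : (X → ℝ) → ℝ≥0∞} (hφ : Measurable φ) :
    ∫⁻ p, φ p.1 ∂(runLaw k σ R t) = ∫⁻ f, φ f ∂(gpPrior k) := by
  induction t with
  | zero =>
    have h : Measurable fun p : (X → ℝ) × Dataset X 0 => φ p.1 := hφ.comp measurable_fst
    rw [runLaw, lintegral_map h (by fun_prop)]
  | succ t ih =>
    have := hR t
    have h := lintegral_runLaw_succ k σ R hR t (φ := fun r => φ r.1.1)
      (hφ.comp measurable_fst.fst)
    simp only [← Finset.sum_mul, sum_kernel_singleton, one_mul] at h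
    rw [h, ih]

theorem integrable_runLaw_value (k : X → X → ℝ) (σ : ℝ≥0) (R : ∀ t, Kernel (Dataset X t) X)
    (hR : ∀ t, IsMarkovKernel (R t)) (t : ℕ) (x : X) :
    Integrable (fun p => p.1 x) (runLaw k σ R t) := by
  have hG : HasGaussianLaw (fun f : X → ℝ => f) (gpPrior k) := IsGaussian.hasGaussianLaw_id
  have hi := (hG.eval x).integrable
  refine ⟨((measurable_pi_apply x).comp measurable_fst).aestronglyMeasurable, ?_⟩
  have h2 := hi.2
  rw [HasFiniteIntegral] at h2 ⊢
  rwa [lintegral_runLaw_fst k σ R hR t (φ := fun f => ‖f x‖ₑ) (by fun_prop)]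

end Step

/-- The quadratic `r ↦ ∫ (r f + g)²` is nonnegative, so its discriminant is at most zero. -/
theorem integral_mul_le_sqrt_mul_sqrt {α : Type*} [MeasurableSpace α] {μ : Measure α} {f g : α → ℝ}
    (hf : MemLp f 2 μ) (hg : MemLp g 2 μ) :
    ∫ a, f a * g a ∂μ ≤ √(∫ a, f a ^ 2 ∂μ) * √(∫ a, g a ^ 2 ∂μ) := by
  have hff := hf.integrable_sq
  have hgg := hg.integrable_sq
  have hfg : Integrable (fun a => f a * g a) μ := hf.integrable_mul hg
  have h : ∀ r : ℝ, 0 ≤ (∫ a, f a ^ 2 ∂μ) * (r * r) + (2 * ∫ a, f a * g a ∂μ) * r +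
      ∫ a, g a ^ 2 ∂μ := fun r => by
    have e : ∫ a, (r * f a + g a) ^ 2 ∂μ = (∫ a, f a ^ 2 ∂μ) * (r * r) +
        (2 * ∫ a, f a * g a ∂μ) * r + ∫ a, g a ^ 2 ∂μ := by
      have e1 : ∀ a, (r * f a + g a) ^ 2 = f a ^ 2 * (r * r) + f a * g a * (2 * r) + g a ^ 2 :=
        fun a => by ring
      simp_rw [e1]
      have i1 : Integrable (fun a => f a ^ 2 * (r * r) + f a * g a * (2 * r)) μ :=
        (hff.mul_const _).add (hfg.mul_const _)
      rw [integral_add i1 hgg, integral_add (hff.mul_const _) (hfg.mul_const _),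
        integral_mul_const, integral_mul_const]
      ring
    rw [← e]
    exact integral_nonneg fun a => sq_nonneg _
  have hd := discrim_le_zero h
  rw [discrim] at hd
  rw [← Real.sqrt_mul (integral_nonneg fun a => sq_nonneg _)]
  exact Real.le_sqrt_of_sq_le (by linarith)

theorem integral_sqrt_le_sqrt_integral {α : Type*} [MeasurableSpace α] {μ : Measure α}
    [IsProbabilityMeasure μ] {f : α → ℝ} (hf : Integrable f μ) (h0 : ∀ a, 0 ≤ f a) :
    ∫ a, √(f a) ∂μ ≤ √(∫ a, f a ∂μ) := by
  have hm : MemLp (fun a => √(f a)) 2 μ :=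
    (memLp_two_iff_integrable_sq
      (Real.continuous_sqrt.comp_aestronglyMeasurable hf.1)).2 (by
        simpa only [Real.sq_sqrt (h0 _)] using hf)
  have h := integral_mul_le_sqrt_mul_sqrt hm (memLp_const (1 : ℝ))
  simpa [Real.sq_sqrt (h0 _)] using h

theorem lintegral_enorm_gaussianReal_le (v : ℝ≥0) :
    ∫⁻ z, ‖z‖ₑ ∂(gaussianReal 0 v) ≤ 1 + v := by
  have hv : ∫ z, z ^ 2 ∂(gaussianReal 0 v) = v := by
    rw [← variance_of_integral_eq_zero (X := fun z : ℝ => z) measurable_id'.aemeasurable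
      integral_id_gaussianReal, variance_fun_id_gaussianReal]
  have hi : Integrable (fun z : ℝ => z ^ 2) (gaussianReal 0 v) :=
    (memLp_id_gaussianReal 2).integrable_sq
  calc ∫⁻ z, ‖z‖ₑ ∂(gaussianReal 0 v)
      ≤ ∫⁻ z, ENNReal.ofReal (1 + z ^ 2) ∂(gaussianReal 0 v) := lintegral_mono fun z => by
        rw [Real.enorm_eq_ofReal_abs]
        refine ENNReal.ofReal_le_ofReal ?_
        nlinarith [sq_abs z, sq_nonneg (|z| - 1), abs_nonneg z]
    _ = ENNReal.ofReal (∫ z, (1 + z ^ 2) ∂(gaussianReal 0 v)) :=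
        (ofReal_integral_eq_lintegral_ofReal ((integrable_const 1).add hi)
          (Filter.Eventually.of_forall fun z => add_nonneg zero_le_one (sq_nonneg z))).symm
    _ ≤ 1 + v := by
        rw [integral_add (integrable_const 1) hi, hv]
        simp [ENNReal.ofReal_add]

theorem lintegral_ofReal_neg_gaussianReal (v : ℝ≥0) :
    ∫⁻ z, ENNReal.ofReal (-z) ∂(gaussianReal 0 v) = ∫⁻ z, ENNReal.ofReal z ∂(gaussianReal 0 v) := by
  conv_rhs => rw [← neg_zero, ← gaussianReal_map_neg,
    lintegral_map ENNReal.measurable_ofReal measurable_neg]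

theorem lintegral_sq_posPart_div_sqrt_sub_le {c : ℝ} (hc : 0 ≤ c) (v : ℝ≥0) :
    ∫⁻ z, ENNReal.ofReal ((max (z / √v) 0) ^ 2 - c) ∂(gaussianReal 0 v) ≤
      ENNReal.ofReal (Real.exp (-c / 2)) := by
  rcases eq_or_ne v 0 with rfl | hv
  -- For variance `0` the variable is `0` and division by `√0` gives `0`; the excess `-c` is cut off
  -- at `0`.
  · simp [ENNReal.ofReal_of_nonpos (neg_nonpos.2 hc)]
  · refine le_of_eq_of_le ?_ (lintegral_sq_posPart_sub_le hc)
    have h : (gaussianReal 0 v).map (fun z => z / √v) = gaussianReal 0 1 := by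
      rw [gaussianReal_map_div_const, zero_div]
      congr 1
      ext
      simp [hv]
    have hm : Measurable fun z : ℝ => ENNReal.ofReal ((max z 0) ^ 2 - c) := by fun_prop
    have hd : Measurable fun z : ℝ => z / √v := by fun_prop
    rw [← h, lintegral_map hm hd]

theorem observedVar_nonneg {X : Type*} [Fintype X] [DecidableEq X] {k : X → X → ℝ}
    (hk : (Matrix.of k).PosSemidef) {σ : ℝ≥0} (hσ : 0 < σ)
    (N : Finset ℕ) {t : ℕ} (D : Dataset X t) (x : X) : 0 ≤ observedVar k σ N D x :=
  posteriorVar_nonneg hk hσ _ x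

theorem measurable_runLaw_residual {X : Type*} [Fintype X] [MeasurableSpace X]
    [MeasurableSingletonClass X] (k : X → X → ℝ) (σ : ℝ≥0) (N : Finset ℕ) (t : ℕ) (x : X) :
    Measurable fun p : (X → ℝ) × Dataset X t => p.1 x - observedMean k σ N p.2 x :=
  ((measurable_pi_apply x).comp measurable_fst).sub
    ((measurable_observedMean k σ N x).comp measurable_snd)

theorem measurable_kernel_real_singleton {X α : Type*} [MeasurableSpace X]
    [MeasurableSingletonClass X] [MeasurableSpace α] (κ : Kernel α X) (x : X) :
    Measurable fun a => (κ a).real {x} :=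
  (κ.measurable_coe (measurableSet_singleton x)).ennreal_toReal

theorem sum_kernel_real_singleton {X α : Type*} [Fintype X] [MeasurableSpace X]
    [MeasurableSingletonClass X] [MeasurableSpace α] (κ : Kernel α X)
    [IsMarkovKernel κ] (a : α) : ∑ x, (κ a).real {x} = 1 := by
  simp

/-! ### Centred residuals, and exchange of actual and fictitious queries. -/

section ObservedResidual

variable {X : Type*} [Fintype X] [DecidableEq X] [MeasurableSpace X] [MeasurableSingletonClass X]
  {S : Type*} [MeasurableSpace S]

theorem integrable_runLaw_residual {k : X → X → ℝ} (hk : (Matrix.of k).PosSemidef)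
    (hk1 : ∀ x, k x x ≤ 1) {σ : ℝ≥0} (hσ : 0 < σ) {N : ℕ → Finset ℕ} (hmono : Monotone N)
    (A : BOAlgorithm X S) (t : ℕ) (x : X) :
    Integrable (fun p => p.1 x - observedMean k σ (N t) p.2 x)
      (runLaw k σ (rkbQuery k σ N A) t) := by
  have hprob := isProbabilityMeasure_runLaw k σ _ (isMarkovKernel_rkbQuery k σ hσ N A) t
  refine ⟨(measurable_runLaw_residual k σ (N t) t x).aestronglyMeasurable, ?_⟩
  have h := lintegral_runLaw_residual hk hσ hmono A t x (c := fun _ => 1) measurable_const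
    (fun _ _ _ => rfl) (ψ := fun _ z => ‖z‖ₑ) (by unfold Function.uncurry; fun_prop)
  simp only [one_mul] at h
  rw [HasFiniteIntegral, h]
  refine lt_of_le_of_lt (lintegral_mono (g := fun _ => 1 + 1) fun p => ?_) (by simp)
  refine (lintegral_enorm_gaussianReal_le _).trans (add_le_add le_rfl ?_)
  exact_mod_cast (Real.toNNReal_le_one.2
    ((posteriorVar_le_prior hk hσ _ x).trans (hk1 x)) : _ ≤ (1 : ℝ≥0))

theorem integrable_observedMean {k : X → X → ℝ} (hk : (Matrix.of k).PosSemidef)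
    (hk1 : ∀ x, k x x ≤ 1) {σ : ℝ≥0} (hσ : 0 < σ) {N : ℕ → Finset ℕ} (hmono : Monotone N)
    (A : BOAlgorithm X S) (t : ℕ) (x : X) :
    Integrable (fun p => observedMean k σ (N t) p.2 x) (runLaw k σ (rkbQuery k σ N A) t) := by
  have h := (integrable_runLaw_value k σ _ (isMarkovKernel_rkbQuery k σ hσ N A) t x).sub
    (integrable_runLaw_residual hk hk1 hσ hmono A t x)
  exact h.congr (Filter.Eventually.of_forall fun p => by simp)

/-- Given the inputs and the available outputs the residual is a symmetric Gaussian, so its positive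
and negative parts have equal weighted integrals. -/
theorem integral_mul_runLaw_residual {k : X → X → ℝ} (hk : (Matrix.of k).PosSemidef)
    (hk1 : ∀ x, k x x ≤ 1) {σ : ℝ≥0} (hσ : 0 < σ) {N : ℕ → Finset ℕ} (hmono : Monotone N)
    (A : BOAlgorithm X S) (t : ℕ) (x : X) {c : Dataset X t → ℝ} (hc : Measurable c)
    (h0 : ∀ D, 0 ≤ c D) (h1 : ∀ D, c D ≤ 1) (hag : ∀ D D', AgreeOn (N t) D D' → c D = c D') :
    ∫ p, c p.2 * (p.1 x - observedMean k σ (N t) p.2 x) ∂(runLaw k σ (rkbQuery k σ N A) t) = 0 := by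
  have hi : Integrable (fun p : (X → ℝ) × Dataset X t =>
      c p.2 * (p.1 x - observedMean k σ (N t) p.2 x)) (runLaw k σ (rkbQuery k σ N A) t) :=
    (integrable_runLaw_residual hk hk1 hσ hmono A t x).bdd_mul (c := 1)
      (hc.comp measurable_snd).aestronglyMeasurable
      (Filter.Eventually.of_forall fun p => by
        rw [Real.norm_of_nonneg (h0 _)]; exact h1 _)
  rw [integral_eq_lintegral_pos_part_sub_lintegral_neg_part hi, sub_eq_zero]
  congr 1
  simp_rw [← mul_neg, ENNReal.ofReal_mul (h0 _)]
  have hco : Measurable fun D => ENNReal.ofReal (c D) := ENNReal.measurable_ofReal.comp hc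
  have e1 := lintegral_runLaw_residual hk hσ hmono A t x hco (fun D D' h => by rw [hag D D' h])
    (ψ := fun _ z => ENNReal.ofReal z) (by unfold Function.uncurry; fun_prop)
  have e2 := lintegral_runLaw_residual hk hσ hmono A t x hco (fun D D' h => by rw [hag D D' h])
    (ψ := fun _ z => ENNReal.ofReal (-z)) (by unfold Function.uncurry; fun_prop)
  simp only [lintegral_ofReal_neg_gaussianReal] at e2
  rw [e1, e2]

/-- A statistic of the inputs and of the available outputs correlates in the same way with the
inputs of the base algorithm run on the actual data as on the imputed data. -/
theorem integral_rkbQuery_eq_queryKernel (k : X → X → ℝ) {σ : ℝ≥0} (hσ : 0 < σ)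
    {N : ℕ → Finset ℕ} (hmono : Monotone N) (A : BOAlgorithm X S) (t : ℕ) (x : X)
    {φ : Dataset X t → ℝ} (hφ : Measurable φ)
    (hi : Integrable (fun p => φ p.2) (runLaw k σ (rkbQuery k σ N A) t))
    (hag : ∀ D D', AgreeOn (N t) D D' → φ D = φ D') :
    ∫ p, (rkbQuery k σ N A t p.2).real {x} * φ p.2 ∂(runLaw k σ (rkbQuery k σ N A) t) =
      ∫ p, (A.queryKernel t p.2).real {x} * φ p.2 ∂(runLaw k σ (rkbQuery k σ N A) t) := by
  have hR := isMarkovKernel_rkbQuery k σ hσ N A t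
  have hAq := A.isMarkovKernel_queryKernel t
  have hint : ∀ κ : Kernel (Dataset X t) X, IsMarkovKernel κ →
      Integrable (fun p : (X → ℝ) × Dataset X t => (κ p.2).real {x} * φ p.2)
        (runLaw k σ (rkbQuery k σ N A) t) := fun κ _ =>
    hi.bdd_mul (c := 1)
      ((measurable_kernel_real_singleton κ x).comp measurable_snd).aestronglyMeasurable
      (Filter.Eventually.of_forall fun p => by
        rw [Real.norm_of_nonneg measureReal_nonneg]; exact measureReal_le_one)
  have hsplit : ∀ κ : Kernel (Dataset X t) X, IsMarkovKernel κ → ∀ (D : Dataset X t) (r : ℝ),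
      ENNReal.ofReal ((κ D).real {x} * r) = κ D {x} * ENNReal.ofReal r := fun κ _ D r => by
    rw [ENNReal.ofReal_mul measureReal_nonneg, ofReal_measureReal]
  rw [integral_eq_lintegral_pos_part_sub_lintegral_neg_part (hint _ hR),
    integral_eq_lintegral_pos_part_sub_lintegral_neg_part (hint _ hAq)]
  simp_rw [← mul_neg, hsplit _ hR, hsplit _ hAq]
  rw [lintegral_rkbQuery_eq_queryKernel k hσ hmono A t x (φ := fun D => ENNReal.ofReal (φ D))
      (ENNReal.measurable_ofReal.comp hφ) (fun D D' h => by rw [hag D D' h]),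
    lintegral_rkbQuery_eq_queryKernel k hσ hmono A t x (φ := fun D => ENNReal.ofReal (-φ D))
      (ENNReal.measurable_ofReal.comp hφ.neg) (fun D D' h => by rw [hag D D' h])]

end ObservedResidual

/-! ### Regret and variance of a single round. -/

/-- The expected instantaneous regret, given `f` and the data, when the next input has the
conditional law `κ`. -/
noncomputable def expectedRegret {X : Type*} [Fintype X] [MeasurableSpace X] {t : ℕ}
    (κ : Kernel (Dataset X t) X) (p : (X → ℝ) × Dataset X t) : ℝ :=
  ∑ x, (κ p.2).real {x} * ((⨆ y, p.1 y) - p.1 x)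

/-- The expected posterior variance at the next input, given the data, when the next input has the
conditional law `κ`. -/
noncomputable def expectedVar {X : Type*} [Fintype X] [MeasurableSpace X] (k : X → X → ℝ)
    (σ : ℝ≥0) {t : ℕ} (κ : Kernel (Dataset X t) X) (D : Dataset X t) : ℝ :=
  ∑ x, (κ D).real {x} * posteriorVar k σ (fun i => (D i).1) x

theorem regret_nonneg {X : Type*} [Finite X] (f : X → ℝ) (x : X) : 0 ≤ (⨆ y, f y) - f x :=
  sub_nonneg.2 (le_ciSup (Set.finite_range f).bddAbove x)

theorem expectedRegret_nonneg {X : Type*} [Fintype X] [MeasurableSpace X] {t : ℕ}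
    (κ : Kernel (Dataset X t) X) (p : (X → ℝ) × Dataset X t) : 0 ≤ expectedRegret κ p :=
  Finset.sum_nonneg fun x _ => mul_nonneg measureReal_nonneg (regret_nonneg p.1 x)

theorem expectedVar_nonneg {X : Type*} [Fintype X] [DecidableEq X] [MeasurableSpace X]
    {k : X → X → ℝ} (hk : (Matrix.of k).PosSemidef) {σ : ℝ≥0} (hσ : 0 < σ) {t : ℕ}
    (κ : Kernel (Dataset X t) X) (D : Dataset X t) : 0 ≤ expectedVar k σ κ D :=
  Finset.sum_nonneg fun x _ => mul_nonneg measureReal_nonneg (posteriorVar_nonneg hk hσ _ x)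

theorem expectedVar_le_one {X : Type*} [Fintype X] [DecidableEq X] [MeasurableSpace X]
    [MeasurableSingletonClass X] {k : X → X → ℝ} (hk : (Matrix.of k).PosSemidef)
    (hk1 : ∀ x, k x x ≤ 1) {σ : ℝ≥0} (hσ : 0 < σ) {t : ℕ}
    (κ : Kernel (Dataset X t) X) [IsMarkovKernel κ] (D : Dataset X t) :
    expectedVar k σ κ D ≤ 1 := by
  rw [← sum_kernel_real_singleton κ D]
  exact Finset.sum_le_sum fun x _ => mul_le_of_le_one_right measureReal_nonneg
    ((posteriorVar_le_prior hk hσ _ x).trans (hk1 x))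

theorem measurable_iSup_apply {X : Type*} [Finite X] : Measurable fun f : X → ℝ => ⨆ y, f y :=
  Measurable.iSup fun y => measurable_pi_apply y

theorem measurable_regret {X : Type*} [Finite X] (x : X) :
    Measurable fun f : X → ℝ => (⨆ y, f y) - f x :=
  measurable_iSup_apply.sub (measurable_pi_apply x)

theorem integrable_kernel_real_mul {X α : Type*} [MeasurableSpace X] [MeasurableSingletonClass X]
    [MeasurableSpace α] {t : ℕ}
    {μ : Measure (α × Dataset X t)} {φ : α × Dataset X t → ℝ} (hφ : Integrable φ μ)
    (κ : Kernel (Dataset X t) X) [IsMarkovKernel κ] (x : X) :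
    Integrable (fun p => (κ p.2).real {x} * φ p) μ :=
  hφ.bdd_mul (c := 1)
    ((measurable_kernel_real_singleton κ x).comp measurable_snd).aestronglyMeasurable
    (Filter.Eventually.of_forall fun p => by
      rw [Real.norm_of_nonneg measureReal_nonneg]; exact measureReal_le_one)

/-- The condition holds at every data set, so one arbitrary data set suffices: `ζ t` dominates the
integral of a square. -/
theorem RegretCondition.zeta_nonneg {X S : Type*} [Fintype X] [Nonempty X] [DecidableEq X]
    [MeasurableSpace X] [MeasurableSpace S] {k : X → X → ℝ} {σ : ℝ≥0} {A : BOAlgorithm X S}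
    {ζ ξ : ℕ → ℝ} (hA : RegretCondition k σ A ζ ξ) (t : ℕ) : 0 ≤ ζ t := by
  obtain ⟨u, v, h⟩ := hA.exists_bound t
  obtain ⟨-, -, -, h, -⟩ := h fun _ => (Classical.arbitrary X, 0)
  exact (integral_nonneg fun _ => sq_nonneg _).trans h

/-! ### Regret of the base algorithm on the actual data. -/

section SequentialRegret

variable {X : Type*} [Fintype X] [MeasurableSpace X] [MeasurableSingletonClass X]

theorem measurable_expectedRegret {t : ℕ} (κ : Kernel (Dataset X t) X) :
    Measurable (expectedRegret κ) :=
  Finset.measurable_sum _ fun x _ =>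
    ((measurable_kernel_real_singleton κ x).comp measurable_snd).mul
      ((measurable_regret x).comp measurable_fst)

theorem measurable_expectedVar (k : X → X → ℝ) (σ : ℝ≥0) {t : ℕ} (κ : Kernel (Dataset X t) X) :
    Measurable (expectedVar k σ κ) :=
  Finset.measurable_sum _ fun x _ =>
    (measurable_kernel_real_singleton κ x).mul (measurable_posteriorVar_inputs k σ x)

variable [DecidableEq X] {S : Type*} [MeasurableSpace S]

theorem integrable_runLaw_iSup [Nonempty X] (k : X → X → ℝ) (σ : ℝ≥0)
    (R : ∀ t, Kernel (Dataset X t) X) (hR : ∀ t, IsMarkovKernel (R t)) (t : ℕ) :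
    Integrable (fun p => ⨆ y, p.1 y) (runLaw k σ R t) := by
  have h : Integrable (fun p : (X → ℝ) × Dataset X t => ∑ x, |p.1 x|) (runLaw k σ R t) :=
    integrable_finsetSum _ fun x _ => (integrable_runLaw_value k σ R hR t x).abs
  refine h.mono' (measurable_iSup_apply.comp measurable_fst).aestronglyMeasurable
    (Filter.Eventually.of_forall fun p => ?_)
  obtain ⟨x, hx⟩ := exists_eq_ciSup_of_finite (f := p.1)
  rw [← hx, Real.norm_eq_abs]
  exact Finset.single_le_sum (f := fun x => |p.1 x|) (fun x _ => abs_nonneg _) (Finset.mem_univ x)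

theorem integrable_expectedRegret [Nonempty X] (k : X → X → ℝ) (σ : ℝ≥0)
    (R : ∀ t, Kernel (Dataset X t) X) (hR : ∀ t, IsMarkovKernel (R t)) (t : ℕ)
    (κ : Kernel (Dataset X t) X) [IsMarkovKernel κ] :
    Integrable (expectedRegret κ) (runLaw k σ R t) :=
  integrable_finsetSum _ fun x _ => integrable_kernel_real_mul
    ((integrable_runLaw_iSup k σ R hR t).sub (integrable_runLaw_value k σ R hR t x)) κ x

theorem integrable_expectedVar {k : X → X → ℝ} (hk : (Matrix.of k).PosSemidef)
    (hk1 : ∀ x, k x x ≤ 1) {σ : ℝ≥0} (hσ : 0 < σ) {t : ℕ}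
    (μ : Measure ((X → ℝ) × Dataset X t)) [IsProbabilityMeasure μ]
    (κ : Kernel (Dataset X t) X) [IsMarkovKernel κ] :
    Integrable (fun p => expectedVar k σ κ p.2) μ :=
  (integrable_const (1 : ℝ)).mono'
    ((measurable_expectedVar k σ κ).comp measurable_snd).aestronglyMeasurable
    (Filter.Eventually.of_forall fun p => by
      rw [Real.norm_of_nonneg (expectedVar_nonneg hk hσ κ _)]
      exact expectedVar_le_one hk hk1 hσ κ _)

/-- Given `D`, the seed is independent of `f`, so it matters only through the law of the query. -/
theorem lintegral_conditionalLaw (k : X → X → ℝ) {σ : ℝ≥0} (hσ : 0 < σ) (A : BOAlgorithm X S)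
    {t : ℕ} (D : Dataset X t) {φ : (X → ℝ) × X → ℝ≥0∞} (hφ : Measurable φ) :
    ∫⁻ p, φ (p.1, A.query t (D, p.2)) ∂(conditionalLaw k σ A D) =
      ∫⁻ f, ∑ x, A.queryKernel t D {x} * φ (f, x) ∂(posterior k σ D) := by
  have hp := isMarkovKernel_posterior (ι := Fin t) k σ hσ
  have hs := A.isMarkovKernel_seed t
  have hq : Measurable fun s => A.query t (D, s) :=
    (A.measurable_query t).comp measurable_prodMk_left
  have hm : Measurable fun p : (X → ℝ) × S => φ (p.1, A.query t (D, p.2)) :=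
    hφ.comp (measurable_fst.prodMk (hq.comp measurable_snd))
  have hmap : A.queryKernel t D = (A.seed t D).map fun s => A.query t (D, s) := by
    rw [BOAlgorithm.queryKernel, Kernel.map_apply _ (A.measurable_query t), Kernel.prod_apply,
      Kernel.id_apply, Measure.dirac_prod,
      Measure.map_map (A.measurable_query t) measurable_prodMk_left]
    rfl
  rw [conditionalLaw]
  refine (lintegral_prod _ hm.aemeasurable).trans (lintegral_congr fun f => ?_)
  have hf : Measurable fun x => φ (f, x) := hφ.comp measurable_prodMk_left
  have h := lintegral_fintype (μ := A.queryKernel t D) fun x => φ (f, x)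
  rw [hmap, lintegral_map hf hq] at h
  rw [hmap, h]
  exact Finset.sum_congr rfl fun x _ => mul_comm _ _

/-- The regret condition at a fixed data set, after the Cauchy-Schwarz inequality. -/
theorem RegretCondition.posterior_le {k : X → X → ℝ} (hk : (Matrix.of k).PosSemidef)
    (hk1 : ∀ x, k x x ≤ 1) {σ : ℝ≥0} (hσ : 0 < σ) {A : BOAlgorithm X S} {ζ ξ : ℕ → ℝ}
    (hA : RegretCondition k σ A ζ ξ) {t : ℕ} (D : Dataset X t) :
    (∫⁻ f, ENNReal.ofReal (expectedRegret (A.queryKernel t) (f, D)) ∂(posterior k σ D)).toReal ≤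
      √(ζ t) * √(expectedVar k σ (A.queryKernel t) D) + ξ t := by
  have hp := isMarkovKernel_posterior (ι := Fin t) k σ hσ
  have hs := A.isMarkovKernel_seed t
  have hprob : IsProbabilityMeasure (conditionalLaw k σ A D) := by
    unfold conditionalLaw; infer_instance
  have hAq := A.isMarkovKernel_queryKernel t
  have hq : Measurable fun p : (X → ℝ) × S => A.query t (D, p.2) :=
    (A.measurable_query t).comp (measurable_const.prodMk measurable_snd)
  obtain ⟨u, v, h⟩ := hA.exists_bound t
  obtain ⟨hu, hv, h1, h2, h3⟩ := h D
  have hreg : Measurable fun r : (X → ℝ) × X => (⨆ y, r.1 y) - r.1 r.2 :=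
    (measurable_iSup_apply.comp measurable_fst).sub measurable_eval
  have hregm : Measurable fun p : (X → ℝ) × S =>
      (⨆ x, p.1 x) - p.1 (A.query t (D, p.2)) := by
    have := hreg.comp (measurable_fst.prodMk hq)
    exact this
  have hnn : 0 ≤ᵐ[conditionalLaw k σ A D] fun p : (X → ℝ) × S =>
      (⨆ x, p.1 x) - p.1 (A.query t (D, p.2)) :=
    Filter.Eventually.of_forall fun p => regret_nonneg p.1 _
  have e1 : ∫ p, ((⨆ x, p.1 x) - p.1 (A.query t (D, p.2))) ∂(conditionalLaw k σ A D) =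
      (∫⁻ f, ENNReal.ofReal (expectedRegret (A.queryKernel t) (f, D))
        ∂(posterior k σ D)).toReal := by
    rw [integral_eq_lintegral_of_nonneg_ae hnn hregm.aestronglyMeasurable,
      lintegral_conditionalLaw k hσ A D (φ := fun r => ENNReal.ofReal ((⨆ y, r.1 y) - r.1 r.2))
        (ENNReal.measurable_ofReal.comp hreg)]
    congr 1
    refine lintegral_congr fun f => ?_
    rw [expectedRegret, ENNReal.ofReal_sum_of_nonneg fun x _ =>
      mul_nonneg measureReal_nonneg (regret_nonneg f x)]
    refine Finset.sum_congr rfl fun x _ => ?_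
    rw [ENNReal.ofReal_mul measureReal_nonneg, ofReal_measureReal]
  have hstd : Measurable fun x => posteriorStd k σ D x := measurable_of_countable _
  have hstdm : Measurable fun p : (X → ℝ) × S => posteriorStd k σ D (A.query t (D, p.2)) := by
    have := hstd.comp hq
    exact this
  have hstd2 : Measurable fun r : (X → ℝ) × X =>
      ENNReal.ofReal (posteriorStd k σ D r.2 ^ 2) := by
    have := ENNReal.measurable_ofReal.comp (hstd.pow_const 2)
    exact this.comp measurable_snd
  have e2 : ∫ p, posteriorStd k σ D (A.query t (D, p.2)) ^ 2 ∂(conditionalLaw k σ A D) =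
      expectedVar k σ (A.queryKernel t) D := by
    rw [integral_eq_lintegral_of_nonneg_ae (Filter.Eventually.of_forall fun p => sq_nonneg _)
      (hstdm.pow_const 2).aestronglyMeasurable,
      lintegral_conditionalLaw k hσ A D (φ := fun r => ENNReal.ofReal (posteriorStd k σ D r.2 ^ 2))
        hstd2]
    dsimp only
    rw [lintegral_const, measure_univ, mul_one, ENNReal.toReal_sum fun x _ =>
        ENNReal.mul_ne_top (measure_ne_top _ _) ENNReal.ofReal_ne_top]
    refine Finset.sum_congr rfl fun x _ => ?_
    rw [ENNReal.toReal_mul, ENNReal.toReal_ofReal (sq_nonneg _), posteriorStd_sq hk hσ]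
    rfl
  have hsL : MemLp (fun p : (X → ℝ) × S => posteriorStd k σ D (A.query t (D, p.2))) 2
      (conditionalLaw k σ A D) :=
    MemLp.of_bound hstdm.aestronglyMeasurable 1 (Filter.Eventually.of_forall fun p => by
      rw [posteriorStd, Real.norm_of_nonneg (Real.sqrt_nonneg _), Real.sqrt_le_one]
      exact (posteriorVar_le_prior hk hσ _ _).trans (hk1 _))
  rw [← e1]
  refine h1.trans ?_
  have hus : Integrable (fun p => u D p * posteriorStd k σ D (A.query t (D, p.2)))
      (conditionalLaw k σ A D) := hu.integrable_mul hsL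
  rw [integral_add hus hv]
  refine add_le_add ((integral_mul_le_sqrt_mul_sqrt hu hsL).trans ?_) h3
  rw [e2]
  exact mul_le_mul_of_nonneg_right (Real.sqrt_le_sqrt h2) (Real.sqrt_nonneg _)

/-- The data may come from any rules `R`, since the function given the data has the posterior law
regardless. The bound of `RegretCondition.posterior_le` no longer contains `u` and `v`, which need
not be measurable in the data, so it can be integrated; Jensen then moves the expectation under the
root. -/
theorem integral_expectedRegret_queryKernel_le [Nonempty X] {k : X → X → ℝ}
    (hk : (Matrix.of k).PosSemidef) (hk1 : ∀ x, k x x ≤ 1) {σ : ℝ≥0} (hσ : 0 < σ)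
    {A : BOAlgorithm X S} {ζ ξ : ℕ → ℝ} (hA : RegretCondition k σ A ζ ξ)
    (R : ∀ t, Kernel (Dataset X t) X) (hR : ∀ t, IsMarkovKernel (R t)) (t : ℕ) :
    ∫ p, expectedRegret (A.queryKernel t) p ∂(runLaw k σ R t) ≤
      √(ζ t) * √(∫ p, expectedVar k σ (A.queryKernel t) p.2 ∂(runLaw k σ R t)) + ξ t := by
  have hAq := A.isMarkovKernel_queryKernel t
  have hprob := isProbabilityMeasure_runLaw k σ R hR t
  have hm := measurable_expectedRegret (A.queryKernel t)
  have hmo : Measurable fun p => ENNReal.ofReal (expectedRegret (A.queryKernel t) p) :=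
    ENNReal.measurable_ofReal.comp hm
  have hin : Measurable fun p : (X → ℝ) × Dataset X t =>
      ∫⁻ g, ENNReal.ofReal (expectedRegret (A.queryKernel t) (g, p.2)) ∂(posterior k σ p.2) :=
    (measurable_lintegral_posterior_data k hσ hmo).comp measurable_snd
  have hfin : ∫⁻ p, ∫⁻ g, ENNReal.ofReal (expectedRegret (A.queryKernel t) (g, p.2))
      ∂(posterior k σ p.2) ∂(runLaw k σ R t) ≠ ∞ := by
    rw [← lintegral_runLaw_eq_posterior k hσ R hR t hmo]
    exact (integrable_expectedRegret k σ R hR t (A.queryKernel t)).lintegral_lt_top.ne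
  have hG := integrable_expectedVar hk hk1 hσ (runLaw k σ R t) (A.queryKernel t)
  have hsq : Integrable (fun p => √(expectedVar k σ (A.queryKernel t) p.2)) (runLaw k σ R t) :=
    (integrable_const (1 : ℝ)).mono' (Real.continuous_sqrt.comp_aestronglyMeasurable hG.1)
      (Filter.Eventually.of_forall fun p => by
        rw [Real.norm_of_nonneg (Real.sqrt_nonneg _), Real.sqrt_le_one]
        exact expectedVar_le_one hk hk1 hσ _ _)
  rw [integral_eq_lintegral_of_nonneg_ae
    (Filter.Eventually.of_forall fun p => expectedRegret_nonneg _ p) hm.aestronglyMeasurable,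
    lintegral_runLaw_eq_posterior k hσ R hR t hmo]
  have htoReal := integral_toReal hin.aemeasurable (ae_lt_top hin hfin)
  have hint := integrable_toReal_of_lintegral_ne_top hin.aemeasurable hfin
  refine htoReal.symm.trans_le ?_
  refine (integral_mono hint ((hsq.const_mul _).add (integrable_const _)) fun p =>
    hA.posterior_le hk hk1 hσ p.2).trans ?_
  have hadd : ∫ p, (√(ζ t) * √(expectedVar k σ (A.queryKernel t) p.2) + ξ t) ∂(runLaw k σ R t) =
      √(ζ t) * ∫ p, √(expectedVar k σ (A.queryKernel t) p.2) ∂(runLaw k σ R t) + ξ t := by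
    rw [integral_add (hsq.const_mul _) (integrable_const _), integral_const_mul]
    simp
  refine hadd.trans_le (add_le_add_left ?_ _)
  exact mul_le_mul_of_nonneg_left
    (integral_sqrt_le_sqrt_integral hG fun p => expectedVar_nonneg hk hσ _ _) (Real.sqrt_nonneg _)

end SequentialRegret

/-! ### The correction term: maximal standardised residual and pending outputs. -/

theorem constCQ_nonneg (σ : ℝ≥0) (Q : ℕ) : 0 ≤ constCQ σ Q := by
  unfold constCQ; positivity

theorem card_pending_le {N : Finset ℕ} {t Q : ℕ} (hN : N ⊆ Finset.range t) (hQ : t - N.card ≤ Q) :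
    Fintype.card {i : Fin t // ¬ (i : ℕ) ∈ N} ≤ Q := by
  have h : Fintype.card {i : Fin t // (i : ℕ) ∈ N} = N.card := by
    rw [← Fintype.card_coe N]
    exact Fintype.card_congr
      { toFun := fun i => ⟨i.1, i.2⟩
        invFun := fun n => ⟨⟨n.1, Finset.mem_range.1 (hN n.2)⟩, n.2⟩
        left_inv := fun _ => rfl
        right_inv := fun _ => rfl }
  rw [Fintype.card_subtype_compl, h, Fintype.card_fin]
  exact hQ

/-- The standardised error of the posterior mean given the available outputs. -/
noncomputable def standardizedResidual {X : Type*} (k : X → X → ℝ) (σ : ℝ≥0) (N : Finset ℕ) {t : ℕ}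
    (x : X) (p : (X → ℝ) × Dataset X t) : ℝ :=
  (p.1 x - observedMean k σ N p.2 x) / √(observedVar k σ N p.2 x)

theorem measurable_standardizedResidual {X : Type*} [Fintype X] [MeasurableSpace X]
    [MeasurableSingletonClass X] (k : X → X → ℝ) (σ : ℝ≥0) (N : Finset ℕ) {t : ℕ} (x : X) :
    Measurable (standardizedResidual k σ N (t := t) x) :=
  (measurable_runLaw_residual k σ N t x).div
    ((measurable_observedVar k σ N x).comp measurable_snd).sqrt

section PendingRegret

variable {X : Type*} [Fintype X] [DecidableEq X] [MeasurableSpace X] [MeasurableSingletonClass X]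
  {S : Type*} [MeasurableSpace S]

/-- Only variance `0` needs an argument: the standardised residual is then `0` by the convention for
division, and the residual vanishes almost surely as a Gaussian of variance `0`. -/
theorem ae_residual_eq {k : X → X → ℝ} (hk : (Matrix.of k).PosSemidef) {σ : ℝ≥0} (hσ : 0 < σ)
    {N : ℕ → Finset ℕ} (hmono : Monotone N) (A : BOAlgorithm X S) (t : ℕ) (x : X) :
    ∀ᵐ p ∂(runLaw k σ (rkbQuery k σ N A) t), p.1 x - observedMean k σ (N t) p.2 x =
      √(observedVar k σ (N t) p.2 x) * standardizedResidual k σ (N t) x p := by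
  have hψ : Measurable (Function.uncurry fun v z : ℝ => if v = 0 then ‖z‖ₑ else 0) := by
    refine Measurable.ite ?_ (by fun_prop) measurable_const
    exact measurable_fst (measurableSet_singleton 0)
  have h := lintegral_runLaw_residual hk hσ hmono A t x (c := fun _ => 1) measurable_const
    (fun _ _ _ => rfl) hψ
  have h0 : ∀ v : ℝ, ∫⁻ z, (if v = 0 then ‖z‖ₑ else 0) ∂(gaussianReal 0 v.toNNReal) = 0 :=
    fun v => by
      by_cases hv : v = 0
      · simp [hv, gaussianReal_zero_var]
      · simp [hv]
  simp only [h0, mul_zero, lintegral_zero, one_mul] at h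
  have hm : Measurable fun p : (X → ℝ) × Dataset X t =>
      if observedVar k σ (N t) p.2 x = 0 then ‖p.1 x - observedMean k σ (N t) p.2 x‖ₑ else 0 :=
    hψ.comp (((measurable_observedVar k σ (N t) x).comp measurable_snd).prodMk
      (measurable_runLaw_residual k σ (N t) t x))
  filter_upwards [(lintegral_eq_zero_iff hm).1 h] with p hp
  rcases eq_or_ne (observedVar k σ (N t) p.2 x) 0 with hv | hv
  · simp only [hv, if_true, Pi.zero_apply, enorm_eq_zero] at hp
    rw [hp, hv, Real.sqrt_zero, zero_mul]
  · rw [standardizedResidual, mul_div_cancel₀]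
    rw [Real.sqrt_ne_zero (observedVar_nonneg hk hσ _ _ _)]
    exact hv

theorem lintegral_sq_standardizedResidual_sub_le {k : X → X → ℝ} (hk : (Matrix.of k).PosSemidef)
    {σ : ℝ≥0} (hσ : 0 < σ) {N : ℕ → Finset ℕ} (hmono : Monotone N) (A : BOAlgorithm X S) (t : ℕ)
    (x : X) {c : ℝ} (hc : 0 ≤ c) :
    ∫⁻ p, ENNReal.ofReal ((max (standardizedResidual k σ (N t) x p) 0) ^ 2 - c)
      ∂(runLaw k σ (rkbQuery k σ N A) t) ≤ ENNReal.ofReal (Real.exp (-c / 2)) := by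
  have hprob := isProbabilityMeasure_runLaw k σ _ (isMarkovKernel_rkbQuery k σ hσ N A) t
  have hψ : Measurable (Function.uncurry fun v z : ℝ =>
      ENNReal.ofReal ((max (z / √v) 0) ^ 2 - c)) := by
    unfold Function.uncurry
    fun_prop
  have h := lintegral_runLaw_residual hk hσ hmono A t x (c := fun _ => 1) measurable_const
    (fun _ _ _ => rfl) hψ
  simp only [one_mul] at h
  refine h.trans_le ((lintegral_mono (g := fun _ => ENNReal.ofReal (Real.exp (-c / 2)))
    fun p => ?_).trans_eq ?_)
  · have h2 := lintegral_sq_posPart_div_sqrt_sub_le hc (observedVar k σ (N t) p.2 x).toNNReal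
    rwa [Real.coe_toNNReal _ (observedVar_nonneg hk hσ _ _ _)] at h2
  · simp

/-- Here `κ` may see the pending outputs, so the residual at the selected input need not be centred.
A single random variable `√M` dominates all standardised residuals at once, and Cauchy-Schwarz
separates it from the selected standard deviation. -/
theorem integral_sum_kernel_mul_residual_le {k : X → X → ℝ} (hk : (Matrix.of k).PosSemidef)
    (hk1 : ∀ x, k x x ≤ 1) {σ : ℝ≥0} (hσ : 0 < σ) {N : ℕ → Finset ℕ} (hmono : Monotone N)
    (A : BOAlgorithm X S) {t Q : ℕ} (hN : N t ⊆ Finset.range t) (hQ : t - (N t).card ≤ Q)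
    (hcard : 2 ≤ Fintype.card X) (κ : Kernel (Dataset X t) X) [IsMarkovKernel κ] :
    ∫ p, ∑ x, (κ p.2).real {x} * (p.1 x - observedMean k σ (N t) p.2 x)
        ∂(runLaw k σ (rkbQuery k σ N A) t) ≤
      √(constC₂ X) * √(constCQ σ Q *
        ∫ p, expectedVar k σ κ p.2 ∂(runLaw k σ (rkbQuery k σ N A) t)) := by
  set P := runLaw k σ (rkbQuery k σ N A) t with hP
  have hprob : IsProbabilityMeasure P :=
    isProbabilityMeasure_runLaw k σ _ (isMarkovKernel_rkbQuery k σ hσ N A) t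
  set n : ℝ := (Fintype.card X : ℝ) with hn
  have hn2 : (2 : ℝ) ≤ n := by rw [hn]; exact_mod_cast hcard
  -- This `c` minimises `c + n exp (-c/2)`, and the minimum `c + 2` is `C₂`. It is nonnegative
  -- because `n ≥ 2`.
  set c := 2 * Real.log (n / 2) with hc
  have hc0 : 0 ≤ c := mul_nonneg zero_le_two (Real.log_nonneg (by linarith))
  have hexp : Real.exp (-c / 2) = 2 / n := by
    rw [hc, show -(2 * Real.log (n / 2)) / 2 = -Real.log (n / 2) by ring, Real.exp_neg,
      Real.exp_log (by linarith), inv_div]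
  set e : X → (X → ℝ) × Dataset X t → ℝ := fun x p =>
    max ((max (standardizedResidual k σ (N t) x p) 0) ^ 2 - c) 0 with he
  have hem : ∀ x, Measurable (e x) := fun x =>
    ((((measurable_standardizedResidual k σ (N t) x).max measurable_const).pow_const 2).sub
      measurable_const).max measurable_const
  have he0 : ∀ x p, 0 ≤ e x p := fun x p => le_max_right _ _
  have hel : ∀ x, ∫⁻ p, ENNReal.ofReal (e x p) ∂P ≤ ENNReal.ofReal (2 / n) := fun x => by
    rw [← hexp]
    refine le_of_eq_of_le (lintegral_congr fun p => ?_)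
      (lintegral_sq_standardizedResidual_sub_le hk hσ hmono A t x hc0)
    simp [he, ENNReal.ofReal_max]
  have hei : ∀ x, Integrable (e x) P := fun x =>
    ⟨(hem x).aestronglyMeasurable, by
      rw [hasFiniteIntegral_iff_ofReal (Filter.Eventually.of_forall (he0 x))]
      exact (hel x).trans_lt ENNReal.ofReal_lt_top⟩
  have hint : ∀ x, ∫ p, e x p ∂P ≤ 2 / n := fun x => by
    rw [integral_eq_lintegral_of_nonneg_ae (Filter.Eventually.of_forall (he0 x))
      (hem x).aestronglyMeasurable]
    exact ENNReal.toReal_le_of_le_ofReal (by positivity) (hel x)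
  -- The maximum of the squared positive parts is at most `c` plus the sum of their excesses over
  -- `c`.
  set M : (X → ℝ) × Dataset X t → ℝ := fun p => c + ∑ x, e x p with hM
  have hM0 : ∀ p, 0 ≤ M p := fun p => add_nonneg hc0 (Finset.sum_nonneg fun x _ => he0 x p)
  have hMi : Integrable M P :=
    (integrable_const c).add (integrable_finsetSum _ fun x _ => hei x)
  have hMle : ∫ p, M p ∂P ≤ constC₂ X := by
    have h1 : ∫ p, M p ∂P = c + ∑ x, ∫ p, e x p ∂P := by
      rw [hM, integral_add (integrable_const c) (integrable_finsetSum _ fun x _ => hei x),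
        integral_finsetSum _ fun x _ => hei x]
      simp
    have h2 : ∑ x, ∫ p, e x p ∂P ≤ ∑ _x : X, 2 / n := Finset.sum_le_sum fun x _ => hint x
    have h3 : ∑ _x : X, 2 / n = 2 := by
      rw [Finset.sum_const, Finset.card_univ, nsmul_eq_mul, ← hn]
      field_simp
    rw [h1, constC₂, ← hn]
    linarith
  have hηM : ∀ x p, standardizedResidual k σ (N t) x p ≤ √(M p) := fun x p => by
    refine (le_max_left _ 0).trans (Real.le_sqrt_of_sq_le ?_)
    have h1 : e x p ≤ ∑ x, e x p :=
      Finset.single_le_sum (f := fun x => e x p) (fun x _ => he0 x p) (Finset.mem_univ x)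
    have h2 : (max (standardizedResidual k σ (N t) x p) 0) ^ 2 - c ≤ e x p := le_max_left _ _
    simp only [hM]
    linarith
  set W : (X → ℝ) × Dataset X t → ℝ := fun p =>
    ∑ x, (κ p.2).real {x} * √(observedVar k σ (N t) p.2 x) with hW
  have hWm : Measurable W := Finset.measurable_sum _ fun x _ =>
    ((measurable_kernel_real_singleton κ x).comp measurable_snd).mul
      ((measurable_observedVar k σ (N t) x).comp measurable_snd).sqrt
  have hW0 : ∀ p, 0 ≤ W p := fun p =>
    Finset.sum_nonneg fun x _ => mul_nonneg measureReal_nonneg (Real.sqrt_nonneg _)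
  have hW1 : ∀ p, W p ≤ 1 := fun p => by
    rw [← sum_kernel_real_singleton κ p.2]
    refine Finset.sum_le_sum fun x _ => mul_le_of_le_one_right measureReal_nonneg ?_
    rw [Real.sqrt_le_one]
    exact (posteriorVar_le_prior hk hσ _ x).trans (hk1 x)
  -- Jensen for the weights `κ`, then restoring the discarded outputs at the cost of `C_Q`.
  have hWsq : ∀ p, W p ^ 2 ≤ constCQ σ Q * expectedVar k σ κ p.2 := fun p => by
    have h1 : W p ^ 2 ≤ ∑ x, (κ p.2).real {x} * √(observedVar k σ (N t) p.2 x) ^ 2 :=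
      Real.pow_arith_mean_le_arith_mean_pow _ _ _ (fun _ _ => measureReal_nonneg)
        (sum_kernel_real_singleton κ p.2) (fun _ _ => Real.sqrt_nonneg _) 2
    refine h1.trans ?_
    rw [expectedVar, Finset.mul_sum]
    refine Finset.sum_le_sum fun x _ => ?_
    rw [Real.sq_sqrt (observedVar_nonneg hk hσ _ _ _), mul_left_comm]
    exact mul_le_mul_of_nonneg_left (posteriorVar_restrict_le hk hk1 hσ
      (fun i : Fin t => (i : ℕ) ∈ N t) (card_pending_le hN hQ)
      (fun i => (p.2 i).1) x) measureReal_nonneg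
  have hWL : MemLp W 2 P := MemLp.of_bound hWm.aestronglyMeasurable 1
    (Filter.Eventually.of_forall fun p => by rw [Real.norm_of_nonneg (hW0 p)]; exact hW1 p)
  have hML : MemLp (fun p => √(M p)) 2 P :=
    (memLp_two_iff_integrable_sq (Real.continuous_sqrt.comp_aestronglyMeasurable hMi.1)).2 (by
      simpa only [Real.sq_sqrt (hM0 _)] using hMi)
  have hres : ∀ᵐ p ∂P, ∑ x, (κ p.2).real {x} * (p.1 x - observedMean k σ (N t) p.2 x) ≤
      √(M p) * W p := by
    filter_upwards [ae_all_iff.2 fun x => ae_residual_eq hk hσ hmono A t x] with p hp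
    rw [hW, Finset.mul_sum]
    refine Finset.sum_le_sum fun x _ => ?_
    rw [hp x, mul_left_comm (√(M p)), mul_comm (√(M p))]
    exact mul_le_mul_of_nonneg_left
      (mul_le_mul_of_nonneg_left (hηM x p) (Real.sqrt_nonneg _)) measureReal_nonneg
  have hri : Integrable (fun p : (X → ℝ) × Dataset X t =>
      ∑ x, (κ p.2).real {x} * (p.1 x - observedMean k σ (N t) p.2 x)) P :=
    integrable_finsetSum _ fun x _ =>
      integrable_kernel_real_mul (integrable_runLaw_residual hk hk1 hσ hmono A t x) κ x
  have hMW : Integrable (fun p => √(M p) * W p) P := hML.integrable_mul hWL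
  refine (integral_mono_ae hri hMW hres).trans ((integral_mul_le_sqrt_mul_sqrt hML hWL).trans ?_)
  simp only [Real.sq_sqrt (hM0 _)]
  refine mul_le_mul (Real.sqrt_le_sqrt hMle) (Real.sqrt_le_sqrt ?_) (Real.sqrt_nonneg _)
    (Real.sqrt_nonneg _)
  rw [← integral_const_mul]
  exact integral_mono hWL.integrable_sq
    ((integrable_expectedVar hk hk1 hσ P κ).const_mul _) hWsq

end PendingRegret

/-! ### Regret of one round of the kriging believer, and sums over rounds. -/

theorem measurable_cumulativeRegret {X : Type*} [Fintype X] [MeasurableSpace X]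
    [MeasurableSingletonClass X] (T : ℕ) :
    Measurable (cumulativeRegret : (X → ℝ) × Dataset X T → ℝ) := by
  refine Finset.measurable_sum _ fun i _ => ?_
  have h : Measurable fun p : (X → ℝ) × Dataset X T => p.1 (p.2 i).1 :=
    measurable_eval.comp (f := fun p : (X → ℝ) × Dataset X T => (p.1, (p.2 i).1)) (by fun_prop)
  exact (measurable_iSup_apply.comp measurable_fst).sub h

theorem sumPosteriorVar_nonneg {X : Type*} [Fintype X] [DecidableEq X] {k : X → X → ℝ}
    (hk : (Matrix.of k).PosSemidef) {σ : ℝ≥0} (hσ : 0 < σ) (T : ℕ) (xs : Fin T → X) :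
    0 ≤ sumPosteriorVar k σ T xs := by
  induction T with
  | zero => exact le_rfl
  | succ T ih => exact add_nonneg (ih _) (posteriorVar_nonneg hk hσ _ _)

theorem measurable_sumPosteriorVar_inputs {X : Type*} [Finite X] [MeasurableSpace X]
    [MeasurableSingletonClass X] (k : X → X → ℝ) (σ : ℝ≥0) (T : ℕ) :
    Measurable fun p : (X → ℝ) × Dataset X T => sumPosteriorVar k σ T fun i => (p.2 i).1 := by
  have h : Measurable (sumPosteriorVar k σ T) := measurable_of_countable _
  have h2 : Measurable fun (p : (X → ℝ) × Dataset X T) (i : Fin T) => (p.2 i).1 := by fun_prop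
  exact h.comp h2

section CumulativeRegret

variable {X : Type*} [Fintype X] [DecidableEq X] [MeasurableSpace X] [MeasurableSingletonClass X]
  {S : Type*} [MeasurableSpace S]

/-- Split `f* - f(x)` around the mean given the available outputs. Between `rkbQuery` and the base
query on the actual data, only the residual term differs. -/
theorem integral_expectedRegret_eq [Nonempty X] {k : X → X → ℝ} (hk : (Matrix.of k).PosSemidef)
    (hk1 : ∀ x, k x x ≤ 1) {σ : ℝ≥0} (hσ : 0 < σ) {N : ℕ → Finset ℕ} (hmono : Monotone N)
    (A : BOAlgorithm X S) (t : ℕ) (κ : Kernel (Dataset X t) X) [IsMarkovKernel κ] :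
    ∫ p, expectedRegret κ p ∂(runLaw k σ (rkbQuery k σ N A) t) =
      ∫ p, (⨆ y, p.1 y) ∂(runLaw k σ (rkbQuery k σ N A) t) -
      ∑ x, ∫ p, (κ p.2).real {x} * observedMean k σ (N t) p.2 x
        ∂(runLaw k σ (rkbQuery k σ N A) t) -
      ∫ p, ∑ x, (κ p.2).real {x} * (p.1 x - observedMean k σ (N t) p.2 x)
        ∂(runLaw k σ (rkbQuery k σ N A) t) := by
  have hR := isMarkovKernel_rkbQuery k σ hσ N A
  have hs := integrable_runLaw_iSup k σ _ hR t
  have hm := fun x =>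
    integrable_kernel_real_mul (integrable_observedMean hk hk1 hσ hmono A t x) κ x
  have hr := fun x =>
    integrable_kernel_real_mul (integrable_runLaw_residual hk hk1 hσ hmono A t x) κ x
  have hsm : Integrable (fun p : (X → ℝ) × Dataset X t => (⨆ y, p.1 y) -
      ∑ x, (κ p.2).real {x} * observedMean k σ (N t) p.2 x) (runLaw k σ (rkbQuery k σ N A) t) :=
    hs.sub (integrable_finsetSum _ fun x _ => hm x)
  rw [← integral_finsetSum _ fun x _ => hm x,
    ← integral_sub hs (integrable_finsetSum _ fun x _ => hm x), ← integral_sub hsm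
      (integrable_finsetSum _ fun x _ => hr x)]
  refine integral_congr_ae (Filter.Eventually.of_forall fun p => ?_)
  have h1 : ∑ x, (κ p.2).real {x} * ⨆ y, p.1 y = ⨆ y, p.1 y := by
    rw [← Finset.sum_mul, sum_kernel_real_singleton, one_mul]
  simp only [expectedRegret, mul_sub, Finset.sum_sub_distrib, h1]
  ring

/-- The posterior variance depends on the inputs alone, so the exchange of queries applies to it. -/
theorem integral_expectedVar_rkbQuery {k : X → X → ℝ} (hk : (Matrix.of k).PosSemidef)
    (hk1 : ∀ x, k x x ≤ 1) {σ : ℝ≥0} (hσ : 0 < σ) {N : ℕ → Finset ℕ} (hmono : Monotone N)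
    (A : BOAlgorithm X S) (t : ℕ) :
    ∫ p, expectedVar k σ (rkbQuery k σ N A t) p.2 ∂(runLaw k σ (rkbQuery k σ N A) t) =
      ∫ p, expectedVar k σ (A.queryKernel t) p.2 ∂(runLaw k σ (rkbQuery k σ N A) t) := by
  have hR := isMarkovKernel_rkbQuery k σ hσ N A
  have hAq := A.isMarkovKernel_queryKernel t
  have hprob := isProbabilityMeasure_runLaw k σ _ hR t
  have hV : ∀ x, Integrable (fun p : (X → ℝ) × Dataset X t =>
      posteriorVar k σ (fun i => (p.2 i).1) x) (runLaw k σ (rkbQuery k σ N A) t) := fun x =>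
    (integrable_const (1 : ℝ)).mono'
      ((measurable_posteriorVar_inputs k σ x).comp measurable_snd).aestronglyMeasurable
      (Filter.Eventually.of_forall fun p => by
        rw [Real.norm_of_nonneg (posteriorVar_nonneg hk hσ _ _)]
        exact (posteriorVar_le_prior hk hσ _ x).trans (hk1 x))
  have := hR t
  unfold expectedVar
  rw [integral_finsetSum _ fun x _ => integrable_kernel_real_mul (hV x) _ x,
    integral_finsetSum _ fun x _ => integrable_kernel_real_mul (hV x) _ x]
  refine Finset.sum_congr rfl fun x _ => ?_
  exact integral_rkbQuery_eq_queryKernel k hσ hmono A t x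
    (φ := fun D => posteriorVar k σ (fun i => (D i).1) x) (measurable_posteriorVar_inputs k σ x)
    (hV x) fun D D' h => by rw [h.inputs_eq]

/-- The expected instantaneous regret of the randomised kriging believer. -/
theorem integral_expectedRegret_rkbQuery_le [Nonempty X] {k : X → X → ℝ}
    (hk : (Matrix.of k).PosSemidef) (hk1 : ∀ x, k x x ≤ 1) {σ : ℝ≥0} (hσ : 0 < σ)
    {A : BOAlgorithm X S} {ζ ξ : ℕ → ℝ} (hA : RegretCondition k σ A ζ ξ)
    {N : ℕ → Finset ℕ} (hmono : Monotone N) {t Q : ℕ} (hN : N t ⊆ Finset.range t)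
    (hQ : t - (N t).card ≤ Q) :
    ∫ p, expectedRegret (rkbQuery k σ N A t) p ∂(runLaw k σ (rkbQuery k σ N A) t) ≤
      √(ζ t) * √(∫ p, expectedVar k σ (rkbQuery k σ N A t) p.2
        ∂(runLaw k σ (rkbQuery k σ N A) t)) + ξ t +
      √(constC₂ X) * √(constCQ σ Q * ∫ p, expectedVar k σ (rkbQuery k σ N A t) p.2
        ∂(runLaw k σ (rkbQuery k σ N A) t)) := by
  have hR := isMarkovKernel_rkbQuery k σ hσ N A
  have hAq := A.isMarkovKernel_queryKernel t
  have hRt := hR t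
  -- The actual query is a function of the inputs, the available outputs and independent randomness,
  -- so it cannot favour a sign of the residual.
  have hzero : ∫ p, ∑ x, (rkbQuery k σ N A t p.2).real {x} *
      (p.1 x - observedMean k σ (N t) p.2 x) ∂(runLaw k σ (rkbQuery k σ N A) t) = 0 := by
    rw [integral_finsetSum _ fun x _ =>
      integrable_kernel_real_mul (integrable_runLaw_residual hk hk1 hσ hmono A t x) _ x]
    exact Finset.sum_eq_zero fun x _ => integral_mul_runLaw_residual hk hk1 hσ hmono A t x
      (c := fun D => (rkbQuery k σ N A t D).real {x}) (measurable_kernel_real_singleton _ x)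
      (fun _ => measureReal_nonneg) (fun _ => measureReal_le_one)
      fun D D' h => by rw [h.rkbQuery_eq hσ A]
  have hmean : ∀ x, ∫ p, (rkbQuery k σ N A t p.2).real {x} * observedMean k σ (N t) p.2 x
      ∂(runLaw k σ (rkbQuery k σ N A) t) = ∫ p, (A.queryKernel t p.2).real {x} *
        observedMean k σ (N t) p.2 x ∂(runLaw k σ (rkbQuery k σ N A) t) := fun x =>
    integral_rkbQuery_eq_queryKernel k hσ hmono A t x
      (φ := fun D => observedMean k σ (N t) D x) (measurable_observedMean k σ (N t) x)
      (integrable_observedMean hk hk1 hσ hmono A t x) fun D D' h => h.observedMean_eq x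
  have hsum : ∫ p, expectedRegret (rkbQuery k σ N A t) p ∂(runLaw k σ (rkbQuery k σ N A) t) =
      ∫ p, expectedRegret (A.queryKernel t) p ∂(runLaw k σ (rkbQuery k σ N A) t) +
      ∫ p, ∑ x, (A.queryKernel t p.2).real {x} * (p.1 x - observedMean k σ (N t) p.2 x)
        ∂(runLaw k σ (rkbQuery k σ N A) t) := by
    rw [integral_expectedRegret_eq hk hk1 hσ hmono A t (rkbQuery k σ N A t),
      integral_expectedRegret_eq hk hk1 hσ hmono A t (A.queryKernel t), hzero]
    simp_rw [hmean]
    ring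
  rw [hsum, integral_expectedVar_rkbQuery hk hk1 hσ hmono A t]
  refine add_le_add (integral_expectedRegret_queryKernel_le hk hk1 hσ hA _ hR t) ?_
  rcases le_or_gt 2 (Fintype.card X) with hcard | hcard
  · exact integral_sum_kernel_mul_residual_le hk hk1 hσ hmono A hN hQ hcard (A.queryKernel t)
  -- With a single input the constant `c` used for `C₂` would be negative. In this case the query is
  -- deterministic, so the residual is centred and the correction is zero.
  · have hsub : Subsingleton X :=
      Fintype.card_le_one_iff_subsingleton.1 (Nat.lt_succ_iff.1 hcard)
    refine le_of_eq_of_le ?_ (mul_nonneg (Real.sqrt_nonneg _) (Real.sqrt_nonneg _))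
    rw [integral_finsetSum _ fun x _ =>
      integrable_kernel_real_mul (integrable_runLaw_residual hk hk1 hσ hmono A t x) _ x]
    refine Finset.sum_eq_zero fun x _ => ?_
    have hone : ∀ D, (A.queryKernel t D).real {x} = 1 := fun D => by
      rw [Set.eq_univ_of_forall (s := {x}) fun y => Subsingleton.elim y x, probReal_univ]
    exact integral_mul_runLaw_residual hk hk1 hσ hmono A t x
      (c := fun D => (A.queryKernel t D).real {x}) (measurable_kernel_real_singleton _ x)
      (fun _ => measureReal_nonneg) (fun _ => measureReal_le_one)
      fun D D' _ => by rw [hone, hone]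

theorem integral_runLaw_succ (k : X → X → ℝ) (σ : ℝ≥0) (R : ∀ t, Kernel (Dataset X t) X)
    (hR : ∀ t, IsMarkovKernel (R t)) (t : ℕ) {φ : ((X → ℝ) × Dataset X t) × X → ℝ}
    (hφ : Measurable φ) (h0 : ∀ r, 0 ≤ φ r)
    (hi : Integrable (fun p => ∑ x, (R t p.2).real {x} * φ (p, x)) (runLaw k σ R t)) :
    Integrable (fun p => φ ((p.1, Fin.init p.2), (p.2 (Fin.last t)).1)) (runLaw k σ R (t + 1)) ∧
    ∫ p, φ ((p.1, Fin.init p.2), (p.2 (Fin.last t)).1) ∂(runLaw k σ R (t + 1)) =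
      ∫ p, ∑ x, (R t p.2).real {x} * φ (p, x) ∂(runLaw k σ R t) := by
  have := hR t
  have h := lintegral_runLaw_succ k σ R hR t (φ := fun r => ENNReal.ofReal (φ r))
    (ENNReal.measurable_ofReal.comp hφ)
  have hinit : Measurable fun D : Dataset X (t + 1) => (Fin.init D : Dataset X t) := by
    unfold Fin.init; fun_prop
  have hm : Measurable fun p : (X → ℝ) × Dataset X (t + 1) =>
      φ ((p.1, Fin.init p.2), (p.2 (Fin.last t)).1) :=
    hφ.comp ((measurable_fst.prodMk (hinit.comp measurable_snd)).prodMk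
      ((measurable_pi_apply (Fin.last t)).comp measurable_snd).fst)
  have hs0 : ∀ p : (X → ℝ) × Dataset X t, 0 ≤ ∑ x, (R t p.2).real {x} * φ (p, x) := fun p =>
    Finset.sum_nonneg fun x _ => mul_nonneg measureReal_nonneg (h0 _)
  have hsum : ∀ p : (X → ℝ) × Dataset X t, ∑ x, R t p.2 {x} * ENNReal.ofReal (φ (p, x)) =
      ENNReal.ofReal (∑ x, (R t p.2).real {x} * φ (p, x)) := fun p => by
    rw [ENNReal.ofReal_sum_of_nonneg fun x _ => mul_nonneg measureReal_nonneg (h0 _)]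
    refine Finset.sum_congr rfl fun x _ => ?_
    rw [ENNReal.ofReal_mul measureReal_nonneg, ofReal_measureReal]
  simp_rw [hsum] at h
  have h0' : 0 ≤ᵐ[runLaw k σ R (t + 1)] fun p =>
      φ ((p.1, Fin.init p.2), (p.2 (Fin.last t)).1) := Filter.Eventually.of_forall fun p => h0 _
  refine ⟨⟨hm.aestronglyMeasurable, ?_⟩, ?_⟩
  · rw [hasFiniteIntegral_iff_ofReal h0', h]
    exact hi.lintegral_lt_top
  · rw [integral_eq_lintegral_of_nonneg_ae h0' hm.aestronglyMeasurable, h,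
      integral_eq_lintegral_of_nonneg_ae (Filter.Eventually.of_forall hs0) hi.1]

/-- Passing to the next round does not change the law of the past. -/
theorem integral_runLaw_init (k : X → X → ℝ) (σ : ℝ≥0) (R : ∀ t, Kernel (Dataset X t) X)
    (hR : ∀ t, IsMarkovKernel (R t)) (t : ℕ) {φ : (X → ℝ) × Dataset X t → ℝ}
    (hφ : Measurable φ) (h0 : ∀ r, 0 ≤ φ r) (hi : Integrable φ (runLaw k σ R t)) :
    Integrable (fun p => φ (p.1, Fin.init p.2)) (runLaw k σ R (t + 1)) ∧
    ∫ p, φ (p.1, Fin.init p.2) ∂(runLaw k σ R (t + 1)) = ∫ p, φ p ∂(runLaw k σ R t) := by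
  have := hR t
  have e : (fun p : (X → ℝ) × Dataset X t => ∑ x, (R t p.2).real {x} * φ p) = φ :=
    funext fun p => by rw [← Finset.sum_mul, sum_kernel_real_singleton, one_mul]
  have h := integral_runLaw_succ k σ R hR t (φ := fun r => φ r.1) (hφ.comp measurable_fst)
    (fun r => h0 r.1) (by simpa only [e] using hi)
  simpa only [e] using h

theorem integral_cumulativeRegret [Nonempty X] (k : X → X → ℝ) (σ : ℝ≥0)
    (R : ∀ t, Kernel (Dataset X t) X) (hR : ∀ t, IsMarkovKernel (R t)) (T : ℕ) :
    Integrable cumulativeRegret (runLaw k σ R T) ∧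
    ∫ p, cumulativeRegret p ∂(runLaw k σ R T) =
      ∑ t ∈ Finset.range T, ∫ p, expectedRegret (R t) p ∂(runLaw k σ R t) := by
  induction T with
  | zero =>
    have e : (cumulativeRegret : (X → ℝ) × Dataset X 0 → ℝ) = 0 := funext fun p => by
      simp [cumulativeRegret]
    rw [e]
    exact ⟨integrable_zero _ _ _, by simp⟩
  | succ T ih =>
    have := hR T
    have hlast := integral_runLaw_succ k σ R hR T (φ := fun r => (⨆ y, r.1.1 y) - r.1.1 r.2)
      ((measurable_iSup_apply.comp measurable_fst.fst).sub
        (measurable_eval.comp (measurable_fst.fst.prodMk measurable_snd)))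
      (fun r => regret_nonneg r.1.1 r.2) (integrable_expectedRegret k σ R hR T (R T))
    have hinit := integral_runLaw_init k σ R hR T (measurable_cumulativeRegret T)
      (fun p => Finset.sum_nonneg fun i _ => regret_nonneg p.1 _) ih.1
    have e : ∀ p : (X → ℝ) × Dataset X (T + 1), cumulativeRegret p =
        cumulativeRegret (p.1, (Fin.init p.2 : Dataset X T)) +
          ((⨆ y, p.1 y) - p.1 (p.2 (Fin.last T)).1) := fun p => Fin.sum_univ_castSucc _
    refine ⟨(hinit.1.add hlast.1).congr (Filter.Eventually.of_forall fun p => (e p).symm), ?_⟩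
    simp_rw [e]
    rw [integral_add hinit.1 hlast.1, hinit.2, hlast.2, ih.2, Finset.sum_range_succ]
    rfl

theorem integral_sumPosteriorVar {k : X → X → ℝ} (hk : (Matrix.of k).PosSemidef)
    (hk1 : ∀ x, k x x ≤ 1) {σ : ℝ≥0} (hσ : 0 < σ)
    (R : ∀ t, Kernel (Dataset X t) X) (hR : ∀ t, IsMarkovKernel (R t)) (T : ℕ) :
    Integrable (fun p => sumPosteriorVar k σ T fun i => (p.2 i).1) (runLaw k σ R T) ∧
    ∫ p, (sumPosteriorVar k σ T fun i => (p.2 i).1) ∂(runLaw k σ R T) =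
      ∑ t ∈ Finset.range T, ∫ p, expectedVar k σ (R t) p.2 ∂(runLaw k σ R t) := by
  induction T with
  | zero => simp [sumPosteriorVar]
  | succ T ih =>
    have := hR T
    have hprob := isProbabilityMeasure_runLaw k σ R hR T
    have hmeas : Measurable fun r : Dataset X T × X =>
        posteriorVar k σ (fun i => (r.1 i).1) r.2 :=
      measurable_from_prod_countable_left fun x => measurable_posteriorVar_inputs k σ x
    have hlast := integral_runLaw_succ k σ R hR T
      (φ := fun r => posteriorVar k σ (fun i => (r.1.2 i).1) r.2)
      (hmeas.comp (measurable_fst.snd.prodMk measurable_snd))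
      (fun r => posteriorVar_nonneg hk hσ _ _) (integrable_expectedVar hk hk1 hσ _ (R T))
    have hinit := integral_runLaw_init k σ R hR T (measurable_sumPosteriorVar_inputs k σ T)
      (fun p => sumPosteriorVar_nonneg hk hσ T _) ih.1
    have h := integral_add hinit.1 hlast.1
    rw [hinit.2, hlast.2, ih.2] at h
    rw [Finset.sum_range_succ]
    exact ⟨hinit.1.add hlast.1, h⟩

/-- The tower property turns the sum into the expectation of the sum of variances along the run,
which is bounded for every realisation of the inputs. -/
theorem sum_integral_expectedVar_le {k : X → X → ℝ} (hk : (Matrix.of k).PosSemidef)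
    (hk1 : ∀ x, k x x ≤ 1) {σ : ℝ≥0} (hσ : 0 < σ)
    (R : ∀ t, Kernel (Dataset X t) X) (hR : ∀ t, IsMarkovKernel (R t)) (T : ℕ) :
    ∑ t ∈ Finset.range T, ∫ p, expectedVar k σ (R t) p.2 ∂(runLaw k σ R t) ≤
      constC₁ σ * maxInfoGain k σ T := by
  have hprob := isProbabilityMeasure_runLaw k σ R hR T
  obtain ⟨hi, h⟩ := integral_sumPosteriorVar hk hk1 hσ R hR T
  rw [← h]
  refine (integral_mono hi (integrable_const _) fun p =>
    sumPosteriorVar_le hk hk1 hσ T _).trans_eq ?_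
  simp

end CumulativeRegret

end KrigingBeliever

/-! ### Summation over the rounds. -/

open KrigingBeliever in
theorem theorem1 {X S : Type*} [Fintype X] [Nonempty X] [DecidableEq X] [MeasurableSpace X]
    [MeasurableSingletonClass X] [MeasurableSpace S]
    (k : X → X → ℝ) (hk : (Matrix.of k).PosSemidef) (hk1 : ∀ x, k x x ≤ 1)
    (σ : ℝ≥0) (hσ : 0 < σ)
    (A : BOAlgorithm X S) (ζ ξ : ℕ → ℝ) (hA : RegretCondition k σ A ζ ξ)
    (N : ℕ → Finset ℕ) (hN : ∀ t, N t ⊆ Finset.range t) (hmono : Monotone N)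
    (Q : ℕ) (hQ : IsGreatest (Set.range fun t : ℕ => t - (N t).card) Q) (T : ℕ) :
    Integrable cumulativeRegret (runLaw k σ (rkbQuery k σ N A) T) ∧
    bcr k σ (rkbQuery k σ N A) T ≤
      sequentialBound k σ ζ ξ T +
        √(constC₁ σ * constC₂ X * constCQ σ Q * maxInfoGain k σ T * T) := by
  have hR := isMarkovKernel_rkbQuery k σ hσ N A
  obtain ⟨hint, hsum⟩ := integral_cumulativeRegret k σ _ hR T
  refine ⟨hint, ?_⟩
  set a : ℕ → ℝ := fun t => ∫ p, expectedVar k σ (rkbQuery k σ N A t) p.2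
    ∂(runLaw k σ (rkbQuery k σ N A) t) with ha
  have ha0 : ∀ t, 0 ≤ a t := fun t => integral_nonneg fun p => expectedVar_nonneg hk hσ _ _
  have haG : ∑ t ∈ Finset.range T, a t ≤ constC₁ σ * maxInfoGain k σ T :=
    sum_integral_expectedVar_le hk hk1 hσ _ hR T
  have hG0 : 0 ≤ constC₁ σ * maxInfoGain k σ T :=
    (Finset.sum_nonneg fun t _ => ha0 t).trans haG
  have hζ := hA.zeta_nonneg
  -- Cauchy-Schwarz over the rounds, then the information-gain bound on `∑ a t`.
  have h1 : ∑ t ∈ Finset.range T, √(ζ t) * √(a t) ≤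
      √(constC₁ σ * maxInfoGain k σ T * ∑ t ∈ Finset.range T, ζ t) := by
    refine (Real.sum_sqrt_mul_sqrt_le _ hζ ha0).trans ?_
    rw [mul_comm, Real.sqrt_mul hG0]
    exact mul_le_mul_of_nonneg_right (Real.sqrt_le_sqrt haG) (Real.sqrt_nonneg _)
  have h2 : ∑ t ∈ Finset.range T, √(constC₂ X) * √(constCQ σ Q * a t) ≤
      √(constC₁ σ * constC₂ X * constCQ σ Q * maxInfoGain k σ T * T) := by
    have h3 : ∑ t ∈ Finset.range T, √(a t) ≤ √(constC₁ σ * maxInfoGain k σ T) * √T := by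
      -- Cauchy-Schwarz against the constant sequence `1` yields the factor `√T`.
      have h := Real.sum_sqrt_mul_sqrt_le (Finset.range T) ha0 (g := fun _ => 1)
        fun _ => zero_le_one
      simp only [Real.sqrt_one, mul_one, Finset.sum_const, Finset.card_range, nsmul_eq_mul] at h
      exact h.trans (mul_le_mul_of_nonneg_right (Real.sqrt_le_sqrt haG) (Real.sqrt_nonneg _))
    -- The factors are ordered so that `constC₂ X` comes last: splitting the root requires the sign
    -- of the leading factor only.
    rw [show constC₁ σ * constC₂ X * constCQ σ Q * maxInfoGain k σ T * T =
        constCQ σ Q * (constC₁ σ * maxInfoGain k σ T * (T * constC₂ X)) by ring,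
      Real.sqrt_mul (constCQ_nonneg σ Q), Real.sqrt_mul hG0, Real.sqrt_mul T.cast_nonneg]
    simp_rw [Real.sqrt_mul (constCQ_nonneg σ Q), ← mul_assoc]
    rw [← Finset.mul_sum]
    refine (mul_le_mul_of_nonneg_left h3
      (mul_nonneg (Real.sqrt_nonneg _) (Real.sqrt_nonneg _))).trans_eq ?_
    ring
  have hround := Finset.sum_le_sum fun t (_ : t ∈ Finset.range T) =>
    integral_expectedRegret_rkbQuery_le hk hk1 hσ hA hmono (hN t) (hQ.2 ⟨t, rfl⟩)
  rw [Finset.sum_add_distrib, Finset.sum_add_distrib] at hround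
  rw [bcr, hsum, sequentialBound]
  linarith
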